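/- Let $\mathcal H$ be a separable complex Hilbert space and let $H=\sum_{m\in\mathbb N}h_mQ_m$ be a self-adjoint operator in $\mathcal H$ with pairwise distinct eigenvalues $h_m$ ($m\in\mathbb N$) of finite multiplicities $M_m=\dim\mathcal H_m\ge 1$, where $Q_m$ is the orthogonal projection onto the eigenspace $\mathcal H_m=\operatorname{Ran}Q_m$ and $\mathcal H=\bigoplus_m\mathcal H_m$. Put $\Delta_{mn}=h_m-h_n$, $\Delta_0=\inf_{m\ne n}|\Delta_{mn}|$ and $\mu_{mn}=(\min\{M_m,M_n\})^{1/2}M_mM_n$. Let $t\mapsto V(t)\in\mathcal B(\mathcal H)$ be a measurable (that is, $t\mapsto V(t)x$ is measurable for every $x\in\mathcal H$), bounded, $2\pi$-periodic function on $\mathbb R$ with $V(t)^*=V(t)$ for almost every $t$, and set $$V_{knm}=\frac1{2\pi}\int_0^{2\pi}e^{-ikt}\,Q_nV(t)Q_m\,dt\in\mathcal B(\mathcal H_m,\mathcal H_n),\qquad k\in\mathbb Z,\ n,m\in\mathbb N.$$ For $\omega>0$ and $T=2\pi/\omega$ let $\mathbf K=-i\partial_t\otimes1+1\otimes H$ be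 the self-adjoint operator in $\mathcal K=L^2([0,T],dt)\otimes\mathcal H\cong L^2([0,T],\mathcal H,dt)$ with periodic boundary conditions in $t$, i.e. the closure of $-i\partial_t\otimes1+1\otimes H$ defined on the algebraic tensor product of the $T$-periodic $C^1$ functions and $\operatorname{Dom}H$; and let $(\mathbf V\psi)(t)=V(\omega t)\psi(t)$, a bounded Hermitian operator in $\mathcal K$. Fix $J>0$ and set $\Omega_0=[\frac89J,\frac98J]$. Assume that $\Delta_0>0$ and that for some $\sigma>0$ $$\Delta_\sigma(J)=J^\sigma\sum_{\substack{m,n\in\mathbb N\\ \Delta_{mn}>J/2}}\frac{\mu_{mn}}{(\Delta_{mn})^\sigma}<\infty .$$ Let $r>\sigma+\frac12$. Then the constants $$\epsilon_\star=\frac{\min\{4\Delta_0,J\}}{270\,e^3},\qquad \delta_\star=1440\,e^5\,2^\sigma\left(\frac{2\sigma+1}{(1-e^{-2/r})\,e}\right)^{\sigma+\frac12}\left(\sum_{s=1}^\infty s^2e^{-\frac2r(r-\sigma-\frac12)s}\right)\Delta_\sigma(J),$$ which do not depend on $V$, are positive and have the following property for every $V$ as above. If $$\epsilon_V=\sup_{n\in\mathbb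 N}\sum_{k\in\mathbb Z}\sum_{m\in\mathbb N}\|V_{knm}\|\max\{|k|^r,1\}<\min\left\{\epsilon_\star,\frac{|\Omega_0|}{\delta_\star}\right\},$$ where $|\cdot|$ denotes Lebesgue measure, then there is a measurable set $\Omega_\infty\subset\Omega_0$ with $$|\Omega_\infty|\ge|\Omega_0|-\delta_\star\,\epsilon_V$$ such that for every $\omega\in\Omega_\infty$ the operator $\mathbf K+\mathbf V$ (with domain $\operatorname{Dom}\mathbf K$) is self-adjoint and has pure point spectrum, i.e. its eigenvectors span a dense subspace of $\mathcal K$. -/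

import Mathlib

open MeasureTheory Set
open scoped ENNReal

noncomputable section

namespace Floquet

variable {E : Type*} [NormedAddCommGroup E] [InnerProductSpace ℂ E]

/-- Eigenspace of a (possibly unbounded) operator:
all `x` in the domain of `A` with `A x = z • x`. -/
def eigenspace (A : E →ₗ.[ℂ] E) (z : ℂ) : Submodule ℂ E :=
  (LinearMap.ker (A.toFun - z • A.domain.subtype)).map A.domain.subtype

/-- A self-adjoint operator has pure point spectrum if its eigenvectors span a dense subspace. -/
structure HasPurePointSpectrum [CompleteSpace E] (A : E →ₗ.[ℂ] E) : Prop where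
  isSelfAdjoint : IsSelfAdjoint A
  total : (⨆ z : ℂ, eigenspace A z).topologicalClosure = ⊤

/-- A self-adjoint operator `H = ∑ₘ hₘ Qₘ` with pairwise distinct eigenvalues `hₘ`, `m ∈ ℕ`,
of finite multiplicity, whose eigenspaces `Ran Qₘ` decompose the Hilbert space. -/
structure Hamiltonian (E : Type*) [NormedAddCommGroup E] [InnerProductSpace ℂ E]
    [CompleteSpace E] where
  op : E →ₗ.[ℂ] E
  isSelfAdjoint : IsSelfAdjoint op
  h : ℕ → ℝ
  h_injective : Function.Injective h
  eigenspace_ne_bot : ∀ m, eigenspace op (h m : ℂ) ≠ ⊥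
  finiteDimensional : ∀ m, FiniteDimensional ℂ (eigenspace op (h m : ℂ))
  total : (⨆ m, eigenspace op (h m : ℂ)).topologicalClosure = ⊤

/-- A bounded measurable `2π`-periodic function `t ↦ V(t)`
whose values are bounded operators, Hermitian for almost every `t`. -/
structure Potential (E : Type*) [NormedAddCommGroup E] [InnerProductSpace ℂ E]
    [CompleteSpace E] where
  toFun : ℝ → E →L[ℂ] E
  stronglyMeasurable : ∀ x, StronglyMeasurable fun t => toFun t x
  bounded : ∃ C, ∀ t, ‖toFun t‖ ≤ C
  periodic : Function.Periodic toFun (2 * Real.pi)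
  isSelfAdjoint : ∀ᵐ t, IsSelfAdjoint (toFun t)

/-- Lebesgue measure on the period interval `[0, T]`, `T = 2π / ω`. -/
abbrev periodMeasure (ω : ℝ) : Measure ℝ := volume.restrict (Icc 0 (2 * Real.pi / ω))

/-- The Hilbert space `L²([0, T], E)`, `T = 2π / ω`. -/
abbrev Space (E : Type*) [NormedAddCommGroup E] (ω : ℝ) : Type _ := Lp E 2 (periodMeasure ω)

namespace Hamiltonian

variable [CompleteSpace E] (H : Hamiltonian E)

/-- The eigenspace of the eigenvalue `h m`. -/
def level (m : ℕ) : Submodule ℂ E := eigenspace H.op (H.h m : ℂ)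

instance (m : ℕ) : FiniteDimensional ℂ (H.level m) := H.finiteDimensional m

/-- Multiplicity of the eigenvalue `h m`. -/
def mult (m : ℕ) : ℕ := Module.finrank ℂ (H.level m)

/-- `Δ_{mn} = h_m - h_n`. -/
def diff (m n : ℕ) : ℝ := H.h m - H.h n

/-- `Δ₀ = inf_{m ≠ n} |Δ_{mn}|`. -/
def gap : ℝ := ⨅ p : {p : ℕ × ℕ // p.1 ≠ p.2}, |H.diff p.1.1 p.1.2|

/-- `μ_{mn} = (min {M_m, M_n})^{1/2} M_m M_n`. -/
def mu (m n : ℕ) : ℝ := √(min (H.mult m : ℝ) (H.mult n)) * H.mult m * H.mult n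

open Classical in
/-- `Δ_σ(J) = J^σ ∑_{Δ_{mn} > J/2} μ_{mn} / Δ_{mn}^σ`, as an element of `[0, ∞]`. -/
def gapSum (σ J : ℝ) : ℝ≥0∞ :=
  ENNReal.ofReal (J ^ σ) * ∑' (m : ℕ) (n : ℕ),
    if J / 2 < H.diff m n then ENNReal.ofReal (H.mu m n / H.diff m n ^ σ) else 0

/-- The Fourier coefficient `V_{knm} = (2π)⁻¹ ∫₀^{2π} e^{-ikt} Q_n V(t) Q_m dt`, an operator
from the `m`-th to the `n`-th eigenspace. -/
def coeff (V : Potential E) (k : ℤ) (n m : ℕ) : H.level m →L[ℂ] H.level n :=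
  ((2 * Real.pi)⁻¹ : ℝ) • ∫ t in (0 : ℝ)..2 * Real.pi,
    Complex.exp (-(Complex.I * k * t)) •
      ((H.level n).orthogonalProjectionOnto ∘L V.toFun t ∘L (H.level m).subtypeL)

/-- `ε_V = sup_n ∑_k ∑_m ‖V_{knm}‖ max {|k|^r, 1}`, as an element of `[0, ∞]`. -/
def size (V : Potential E) (r : ℝ) : ℝ≥0∞ :=
  ⨆ n : ℕ, ∑' (k : ℤ) (m : ℕ), ENNReal.ofReal (‖H.coeff V k n m‖ * max (|(k : ℝ)| ^ r) 1)

/-- The pairs `(f ⊗ x, (-i f') ⊗ x + f ⊗ H x)` where `f` is a `T`-periodic `C¹` function and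
`x ∈ Dom H`; they span the graph of `-i∂ₜ ⊗ 1 + 1 ⊗ H` on the algebraic tensor product of the
periodic `C¹` functions and `Dom H`. -/
def freeGenerators (ω : ℝ) : Set (Space E ω × Space E ω) :=
  {p | ∃ (f : ℝ → ℂ) (x : H.op.domain), ContDiff ℝ 1 f ∧
    Function.Periodic f (2 * Real.pi / ω) ∧
    (p.1 =ᵐ[periodMeasure ω] fun t => f t • (x : E)) ∧
    (p.2 =ᵐ[periodMeasure ω] fun t => (-Complex.I * deriv f t) • (x : E) + f t • H.op x)}

/-- The self-adjoint operator `K = -i∂ₜ ⊗ 1 + 1 ⊗ H` in `L²([0, T], E)` with periodic boundary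
conditions: the closure of its restriction to the algebraic tensor product above. -/
def free (ω : ℝ) : Space E ω →ₗ.[ℂ] Space E ω :=
  (Submodule.span ℂ (H.freeGenerators ω)).topologicalClosure.toLinearPMap

end Hamiltonian

namespace Potential

variable [CompleteSpace E] [SecondCountableTopology E] (V : Potential E)

theorem aestronglyMeasurable_mul (ω : ℝ) {μ : Measure ℝ} {ψ : ℝ → E}
    (hψ : AEStronglyMeasurable ψ μ) :
    AEStronglyMeasurable (fun t => V.toFun (ω * t) (ψ t)) μ := by
  borelize E
  have h : StronglyMeasurable (Function.uncurry fun (x : E) (t : ℝ) => V.toFun (ω * t) x) :=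
    stronglyMeasurable_uncurry_of_continuous_of_stronglyMeasurable
      (fun t => (V.toFun (ω * t)).continuous)
      (fun x => (V.stronglyMeasurable x).comp_measurable (measurable_const_mul ω))
  exact ⟨fun t => V.toFun (ω * t) (hψ.mk ψ t),
    h.comp_measurable (hψ.stronglyMeasurable_mk.measurable.prodMk measurable_id),
    hψ.ae_eq_mk.mono fun t ht => by simp only [ht]⟩

theorem memLp_mul (ω : ℝ) {μ : Measure ℝ} {ψ : ℝ → E} (hψ : MemLp ψ 2 μ) :
    MemLp (fun t => V.toFun (ω * t) (ψ t)) 2 μ := by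
  obtain ⟨C, hC⟩ := V.bounded
  exact hψ.of_le_mul (V.aestronglyMeasurable_mul ω hψ.1)
    (.of_forall fun t => (V.toFun (ω * t)).le_of_opNorm_le (hC _) _)

/-- The multiplication operator `(Vψ)(t) = V(ωt) ψ(t)` in `L²([0, T], E)`. -/
def mulOp (ω : ℝ) : Space E ω →ₗ[ℂ] Space E ω where
  toFun ψ := (V.memLp_mul ω (Lp.memLp ψ)).toLp _
  map_add' ψ φ := by
    rw [← MemLp.toLp_add]
    refine MemLp.toLp_congr _ _ ?_
    filter_upwards [Lp.coeFn_add ψ φ] with t ht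
    simp only [ht, Pi.add_apply, map_add]
  map_smul' c ψ := by
    rw [RingHom.id_apply, ← MemLp.toLp_const_smul]
    refine MemLp.toLp_congr _ _ ?_
    filter_upwards [Lp.coeFn_smul c ψ] with t ht
    simp only [ht, Pi.smul_apply, map_smul]

end Potential

/-- The Floquet Hamiltonian `K + V` with domain `Dom K`. -/
def floquetOp [CompleteSpace E] [SecondCountableTopology E]
    (H : Hamiltonian E) (V : Potential E) (ω : ℝ) : Space E ω →ₗ.[ℂ] Space E ω :=
  V.mulOp ω +ᵥ H.free ω

/-- `Ω₀ = [8J/9, 9J/8]`. -/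
def frequencies (J : ℝ) : Set ℝ := Icc (8 / 9 * J) (9 / 8 * J)

/-- `ε_⋆ = min {4 Δ₀, J} / (270 e³)`, where `gap` stands for `Δ₀`. -/
def epsStar (gap J : ℝ) : ℝ := min (4 * gap) J / (270 * Real.exp 3)

/-- `δ_⋆ = 1440 e⁵ 2^σ ((2σ+1) / ((1 - e^{-2/r}) e))^{σ+1/2}
(∑_{s ≥ 1} s² e^{-(2/r)(r-σ-1/2)s}) Δ_σ(J)`, where `S` stands for `Δ_σ(J)`. -/
def deltaStar (σ r S : ℝ) : ℝ :=
  1440 * Real.exp 5 * 2 ^ σ *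
    ((2 * σ + 1) / ((1 - Real.exp (-(2 / r))) * Real.exp 1)) ^ (σ + 1 / 2) *
    (∑' s : ℕ, ((s : ℝ) + 1) ^ 2 * Real.exp (-(2 / r * (r - σ - 1 / 2) * ((s : ℝ) + 1)))) * S

end Floquet

end

noncomputable section

namespace Floquet

/-! ### Block matrices of operators on a Hilbert sum -/

/-! The proof is a progressive diagonalization of KAM type. Expansion in the Fourier modes
`e^{ikωt}` and in the eigenspaces of `H` identifies `L²([0,T],E)` with a Hilbert sum over `ℤ × ℕ` of
finite-dimensional spaces (`fourierIso`). There `K` is the maximal diagonal operator with entries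
`ωk + h_n` (`mem_graph_free`), and `V` is a self-adjoint block matrix that depends only on the
difference of the Fourier indices and not on `ω` (`block_fourierOp`). It suffices to find a unitary
`U` and a bounded self-adjoint block-diagonal `D` with `(K + D) U = U (K + V)`: the blocks of `D`
are Hermitian matrices, and `U*` carries their eigenvectors to a total set of eigenvectors of `K +
V` (`hasPurePointSpectrum_vadd`). To avoid domain questions, the intertwining is written blockwise
as `[K, U] = U V - D U` (`IsCommutator`).

`U` and `D` are norm limits. Stage `t` sees only the Fourier indices of `V` up to `e^{2(t+1)/r}`,
and its unitary conjugates `K` plus this truncation to `K + D + O` with `O` off-diagonal, of order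
`ε e^{-2t}`. A skew-adjoint `B` with `[K + D, B] = O/2` is found block by block
(`exists_homological_solution`). Its Cayley transform removes `O` up to terms of order `BO`
(`IsCommutator.cayley`), and the next slice of `V`, small by the `|k|^r` regularity, is then added
(`Stage.step`).

Each block of `B` solves a Sylvester equation with divisors `ωk + h_n - h_m` plus a difference of
eigenvalues of blocks of `D`. For `k = 0` the spectral gap bounds them below. For `k ≠ 0` the
eigenvalues of `D` vary in `ω` with Lipschitz constant at most `1/4` (Weyl's inequality), so a
divisor is small only on a short set of frequencies, which is discarded
(`exists_nonresonant_subset`). Divisors as small as `γ √|k| e^{-c|k|}` are tolerated: the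
exponential is paid for by lowering an exponential weight in `k - l`, and the root by the Lipschitz
estimate for `B`. This root produces the exponent `σ + 1/2`, and the discarded lengths are summable
exactly because `r > σ + 1/2` (`tsum_removedBound_le`). Since Lipschitz dependence on `ω` must
survive every step, the estimates run in weighted row sums of Lipschitz norms of blocks (`rowNorm`);
Schur's test turns them into operator norms. -/

theorem ennreal_tsum_mul_sq_le {α : Type*} (β t : α → ℝ≥0∞) :
    (∑' j, β j * t j) ^ 2 ≤ (∑' j, β j) * ∑' j, β j * t j ^ 2 := by
  have key : ∀ a b : ℝ≥0∞, 2 * (a * b) ≤ a ^ 2 + b ^ 2 := fun a b => by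
    rcases eq_or_ne a ⊤ with rfl | ha
    · simp
    rcases eq_or_ne b ⊤ with rfl | hb
    · simp
    lift a to NNReal using ha
    lift b to NNReal using hb
    exact_mod_cast (by simpa [mul_assoc] using two_mul_le_add_sq a b)
  have h1 : (∑' j, β j * t j) ^ 2 = ∑' j, ∑' k, β j * β k * (t j * t k) := by
    rw [sq, ← ENNReal.tsum_mul_right]
    refine tsum_congr fun j => ?_
    rw [← ENNReal.tsum_mul_left]
    exact tsum_congr fun k => by ring
  have h2 : (∑' j, β j) * ∑' j, β j * t j ^ 2 = ∑' j, ∑' k, β j * β k * t k ^ 2 := by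
    rw [← ENNReal.tsum_mul_right]
    refine tsum_congr fun j => ?_
    rw [← ENNReal.tsum_mul_left]
    exact tsum_congr fun k => by ring
  have h3 : (∑' j, β j) * ∑' j, β j * t j ^ 2 = ∑' j, ∑' k, β j * β k * t j ^ 2 := by
    rw [h2, ENNReal.tsum_comm]
    exact tsum_congr fun j => tsum_congr fun k => by ring
  -- Doubling avoids square roots and subtraction in `[0, ∞]`: the double sum of `2 t_j t_k ≤ t_j² +
  -- t_k²` gives two equal halves by symmetry.
  rw [← ENNReal.mul_le_mul_iff_right (a := 2) (by simp) (by simp)]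
  calc 2 * (∑' j, β j * t j) ^ 2 = ∑' j, ∑' k, β j * β k * (2 * (t j * t k)) := by
        rw [h1, ← ENNReal.tsum_mul_left]
        refine tsum_congr fun j => ?_
        rw [← ENNReal.tsum_mul_left]
        exact tsum_congr fun k => by ring
    _ ≤ ∑' j, ∑' k, (β j * β k * t j ^ 2 + β j * β k * t k ^ 2) := by
        refine ENNReal.tsum_le_tsum fun j => ENNReal.tsum_le_tsum fun k => ?_
        rw [← mul_add]
        gcongr
        exact key _ _
    _ = 2 * ((∑' j, β j) * ∑' j, β j * t j ^ 2) := by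
        rw [two_mul]
        nth_rw 1 [h3]
        rw [h2, ← ENNReal.tsum_add]
        exact tsum_congr fun j => ENNReal.tsum_add

section Lp

variable {I : Type*} {G : I → Type*} [∀ i, NormedAddCommGroup (G i)]

theorem lp_enorm_sq (x : lp G 2) : ‖x‖ₑ ^ 2 = ∑' i, ‖x i‖ₑ ^ 2 := by
  have h := lp.hasSum_norm (p := 2) (by simp) x
  simp only [ENNReal.toReal_ofNat, Real.rpow_ofNat] at h
  rw [← ofReal_norm, ← ENNReal.ofReal_pow (norm_nonneg _), ← h.tsum_eq,
    ENNReal.ofReal_tsum_of_nonneg (fun _ => by positivity) h.summable]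
  refine tsum_congr fun i => ?_
  rw [← ofReal_norm, ← ENNReal.ofReal_pow (norm_nonneg _)]

theorem memℓp_two_of_tsum_ne_top {y : ∀ i, G i} (h : ∑' i, ‖y i‖ₑ ^ 2 ≠ ⊤) : Memℓp y 2 := by
  refine memℓp_gen ?_
  have := ENNReal.summable_toReal h
  refine this.congr fun i => ?_
  simp

end Lp

section Block

variable {I : Type*} [DecidableEq I] {G : I → Type*} [∀ i, NormedAddCommGroup (G i)]
  [∀ i, InnerProductSpace ℂ (G i)]

/-- The `(i, j)` entry of an operator on the Hilbert sum of the spaces `G i`. -/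
def block (X : lp G 2 →L[ℂ] lp G 2) (i j : I) : G j →L[ℂ] G i :=
  lp.evalCLM ℂ G 2 i ∘L X ∘L lp.singleContinuousLinearMap ℂ G 2 j

theorem block_apply (X : lp G 2 →L[ℂ] lp G 2) (i j : I) (v : G j) :
    block X i j v = X (lp.single 2 j v) i := rfl

theorem hasSum_block (X : lp G 2 →L[ℂ] lp G 2) (i : I) (x : lp G 2) :
    HasSum (fun j => block X i j (x j)) (X x i) :=
  (lp.hasSum_single (p := 2) (by simp) x).mapL (lp.evalCLM ℂ G 2 i ∘L X)

theorem block_ext {X Y : lp G 2 →L[ℂ] lp G 2} (h : ∀ i j, block X i j = block Y i j) : X = Y := by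
  ext x i
  exact (hasSum_block X i x).unique (by simpa only [h] using hasSum_block Y i x)

@[simp] theorem block_zero (i j : I) : block (0 : lp G 2 →L[ℂ] lp G 2) i j = 0 := rfl

@[simp] theorem block_add (X Y : lp G 2 →L[ℂ] lp G 2) (i j : I) :
    block (X + Y) i j = block X i j + block Y i j := rfl

@[simp] theorem block_sub (X Y : lp G 2 →L[ℂ] lp G 2) (i j : I) :
    block (X - Y) i j = block X i j - block Y i j := rfl

@[simp] theorem block_neg (X : lp G 2 →L[ℂ] lp G 2) (i j : I) :
    block (-X) i j = -block X i j := rfl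

@[simp] theorem block_smul (c : ℂ) (X : lp G 2 →L[ℂ] lp G 2) (i j : I) :
    block (c • X) i j = c • block X i j := rfl

@[simp] theorem block_one_self (i : I) : block (1 : lp G 2 →L[ℂ] lp G 2) i i = 1 := by
  ext v; simp [block_apply]

theorem block_one_of_ne {i j : I} (h : i ≠ j) : block (1 : lp G 2 →L[ℂ] lp G 2) i j = 0 := by
  ext v; simp [block_apply, Pi.single_eq_of_ne h]

/-- `block` as a continuous linear map. -/
def blockL (i j : I) : (lp G 2 →L[ℂ] lp G 2) →L[ℂ] (G j →L[ℂ] G i) :=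
  ContinuousLinearMap.compL ℂ (G j) (lp G 2) (G i) (lp.evalCLM ℂ G 2 i) ∘L
    (ContinuousLinearMap.compL ℂ (G j) (lp G 2) (lp G 2)).flip
      (lp.singleContinuousLinearMap ℂ G 2 j)

theorem hasSum_block_mul (X Y : lp G 2 →L[ℂ] lp G 2) (i j : I) (v : G j) :
    HasSum (fun l => block X i l (block Y l j v)) (block (X * Y) i j v) :=
  hasSum_block X i (Y (lp.single 2 j v))

theorem enorm_block_mul_le (X Y : lp G 2 →L[ℂ] lp G 2) (i j : I) :
    ‖block (X * Y) i j‖ₑ ≤ ∑' l, ‖block X i l‖ₑ * ‖block Y l j‖ₑ := by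
  refine ContinuousLinearMap.opENorm_le_bound _ fun v => ?_
  rw [← (hasSum_block_mul X Y i j v).tsum_eq, ← ENNReal.tsum_mul_right]
  refine enorm_tsum_le_tsum_enorm.trans (ENNReal.tsum_le_tsum fun l => ?_)
  rw [mul_assoc]
  exact ((block X i l).le_opENorm _).trans (by gcongr; exact (block Y l j).le_opENorm _)

theorem block_mul_of_diag_left {D : lp G 2 →L[ℂ] lp G 2} (hD : ∀ i j, i ≠ j → block D i j = 0)
    (X : lp G 2 →L[ℂ] lp G 2) (i j : I) : block (D * X) i j = block D i i ∘L block X i j := by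
  ext v
  refine (hasSum_block_mul D X i j v).unique ?_
  exact hasSum_single i fun l hl => by simp [hD i l hl.symm]

theorem block_mul_of_diag_right {D : lp G 2 →L[ℂ] lp G 2} (hD : ∀ i j, i ≠ j → block D i j = 0)
    (X : lp G 2 →L[ℂ] lp G 2) (i j : I) : block (X * D) i j = block X i j ∘L block D j j := by
  ext v
  refine (hasSum_block_mul X D i j v).unique ?_
  exact hasSum_single j fun l hl => by simp [hD l j hl]

theorem block_star [∀ i, CompleteSpace (G i)] (X : lp G 2 →L[ℂ] lp G 2) (i j : I) :
    block (star X) i j = ContinuousLinearMap.adjoint (block X j i) := by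
  rw [ContinuousLinearMap.eq_adjoint_iff]
  intro x y
  rw [block_apply, block_apply, ContinuousLinearMap.star_eq_adjoint,
    ← lp.inner_single_right (𝕜 := ℂ), ContinuousLinearMap.adjoint_inner_left,
    lp.inner_single_left]

theorem enorm_block_star [∀ i, CompleteSpace (G i)] (X : lp G 2 →L[ℂ] lp G 2) (i j : I) :
    ‖block (star X) i j‖ₑ = ‖block X j i‖ₑ := by
  rw [block_star]
  exact (ContinuousLinearMap.adjoint (𝕜 := ℂ) (E := G i) (F := G j)).enorm_map (block X j i)

/-- Schur's test: a block matrix with bounded row and column sums defines a bounded operator. -/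
theorem exists_block_eq [∀ i, CompleteSpace (G i)] (b : ∀ i j, G j →L[ℂ] G i) (C : NNReal)
    (hr : ∀ i, ∑' j, ‖b i j‖ₑ ≤ C) (hc : ∀ j, ∑' i, ‖b i j‖ₑ ≤ C) :
    ∃ X : lp G 2 →L[ℂ] lp G 2, (∀ i j, block X i j = b i j) ∧ ‖X‖ ≤ C := by
  -- Cauchy–Schwarz with weights `‖b i j‖`: one factor is a row sum, and after exchanging the sums
  -- the other is a column sum.
  have hsq : ∀ (x : lp G 2), ∑' i, (∑' j, ‖b i j‖ₑ * ‖x j‖ₑ) ^ 2 ≤ C ^ 2 * ‖x‖ₑ ^ 2 := fun x =>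
    calc ∑' i, (∑' j, ‖b i j‖ₑ * ‖x j‖ₑ) ^ 2
        ≤ ∑' i, C * ∑' j, ‖b i j‖ₑ * ‖x j‖ₑ ^ 2 := by
          refine ENNReal.tsum_le_tsum fun i => (ennreal_tsum_mul_sq_le _ _).trans ?_
          gcongr; exact hr i
      _ = C * ∑' j, (∑' i, ‖b i j‖ₑ) * ‖x j‖ₑ ^ 2 := by
          rw [ENNReal.tsum_mul_left, ENNReal.tsum_comm]
          simp only [ENNReal.tsum_mul_right]
      _ ≤ C * ∑' j, C * ‖x j‖ₑ ^ 2 := by gcongr with j; exact hc j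
      _ = C ^ 2 * ‖x‖ₑ ^ 2 := by rw [ENNReal.tsum_mul_left, lp_enorm_sq]; ring
  have hfin : ∀ (x : lp G 2), ∑' i, (∑' j, ‖b i j‖ₑ * ‖x j‖ₑ) ^ 2 ≠ ⊤ := fun x =>
    ne_top_of_le_ne_top (by finiteness) (hsq x)
  have hle : ∀ (x : lp G 2) i, ∑' j, ‖b i j (x j)‖ₑ ≤ ∑' j, ‖b i j‖ₑ * ‖x j‖ₑ := fun x i =>
    ENNReal.tsum_le_tsum fun j => (b i j).le_opENorm _
  have hs : ∀ (x : lp G 2) i, Summable fun j => b i j (x j) := fun x i => by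
    have h1 : ∑' j, ‖b i j (x j)‖ₑ ≠ ⊤ := by
      refine ne_top_of_le_ne_top ?_ (hle x i)
      have := ENNReal.ne_top_of_tsum_ne_top (hfin x) i
      simpa using this
    refine Summable.of_norm ?_
    simpa using ENNReal.summable_toReal h1
  have hn : ∀ (x : lp G 2), ∑' i, ‖∑' j, b i j (x j)‖ₑ ^ 2 ≤ C ^ 2 * ‖x‖ₑ ^ 2 := fun x => by
    refine (ENNReal.tsum_le_tsum fun i => ?_).trans (hsq x)
    gcongr
    exact enorm_tsum_le_tsum_enorm.trans (hle x i)
  let L : lp G 2 →ₗ[ℂ] lp G 2 :=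
    { toFun := fun x => ⟨fun i => ∑' j, b i j (x j), memℓp_two_of_tsum_ne_top
        (ne_top_of_le_ne_top (by finiteness) (hn x))⟩
      map_add' := fun x y => by
        ext i
        simp only [lp.coeFn_add, Pi.add_apply, map_add]
        exact (hs x i).tsum_add (hs y i)
      map_smul' := fun c x => by
        ext i
        simp only [lp.coeFn_smul, Pi.smul_apply, map_smul, RingHom.id_apply]
        exact (hs x i).tsum_const_smul c }
  have hL : ∀ x, ‖L x‖ ≤ C * ‖x‖ := fun x => by
    have h1 : ‖L x‖ₑ ^ 2 ≤ (C * ‖x‖ₑ) ^ 2 := by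
      rw [lp_enorm_sq, mul_pow]; exact hn x
    have h2 : ‖L x‖ₑ ≤ C * ‖x‖ₑ := (ENNReal.pow_le_pow_left_iff (by simp)).1 h1
    simpa [enorm_eq_nnnorm, ← ENNReal.coe_mul, ← NNReal.coe_le_coe] using h2
  refine ⟨L.mkContinuous C hL, fun i j => ?_, L.mkContinuous_norm_le C.2 hL⟩
  ext v
  change ∑' l, b i l (lp.single 2 j v l) = _
  rw [tsum_eq_single j fun l hl => by simp [Pi.single_eq_of_ne hl]]
  simp

theorem norm_le_of_block [∀ i, CompleteSpace (G i)] (X : lp G 2 →L[ℂ] lp G 2) (C : NNReal)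
    (hr : ∀ i, ∑' j, ‖block X i j‖ₑ ≤ C) (hc : ∀ j, ∑' i, ‖block X i j‖ₑ ≤ C) : ‖X‖ ≤ C := by
  obtain ⟨Y, hY, hn⟩ := exists_block_eq (fun i j => block X i j) C hr hc
  rwa [block_ext hY] at hn

end Block

end Floquet
end

noncomputable section

namespace Floquet

/-! ### Weighted Lipschitz norms of families of block matrices -/

section Ell

variable {F : Type*} [NormedAddCommGroup F]

/-- Supremum over `Ω` of the norm of `f`. -/
def supNorm (Ω : Set ℝ) (f : ℝ → F) : ℝ≥0∞ := ⨆ ω ∈ Ω, ‖f ω‖ₑ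

/-- The Lipschitz constant of `f` on `Ω`. -/
def lipNorm (Ω : Set ℝ) (f : ℝ → F) : ℝ≥0∞ := ⨆ ω ∈ Ω, ⨆ ω' ∈ Ω, ‖f ω - f ω'‖ₑ / ‖ω - ω'‖ₑ

/-- The Lipschitz norm on `Ω`, with weight `φ` of the Lipschitz constant. -/
def ell (Ω : Set ℝ) (φ : ℝ≥0∞) (f : ℝ → F) : ℝ≥0∞ := supNorm Ω f + φ * lipNorm Ω f

variable {Ω Ω' : Set ℝ} {φ φ' : ℝ≥0∞} {f g : ℝ → F}

theorem enorm_le_supNorm {ω : ℝ} (hω : ω ∈ Ω) : ‖f ω‖ₑ ≤ supNorm Ω f :=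
  le_iSup₂ (f := fun ω (_ : ω ∈ Ω) => ‖f ω‖ₑ) ω hω

theorem supNorm_le {a : ℝ≥0∞} (h : ∀ ω ∈ Ω, ‖f ω‖ₑ ≤ a) : supNorm Ω f ≤ a := iSup₂_le h

theorem enorm_sub_le_lipNorm {ω ω' : ℝ} (hω : ω ∈ Ω) (hω' : ω' ∈ Ω) :
    ‖f ω - f ω'‖ₑ ≤ lipNorm Ω f * ‖ω - ω'‖ₑ := by
  rcases eq_or_ne ω ω' with rfl | hne
  · simp
  · rw [← ENNReal.div_le_iff (by simpa [sub_eq_zero] using hne) (by simp)]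
    exact (le_iSup₂ (f := fun ω' (_ : ω' ∈ Ω) => ‖f ω - f ω'‖ₑ / ‖ω - ω'‖ₑ) ω' hω').trans
      (le_iSup₂ (f := fun ω (_ : ω ∈ Ω) => ⨆ ω' ∈ Ω, ‖f ω - f ω'‖ₑ / ‖ω - ω'‖ₑ) ω hω)

theorem lipNorm_le {b : ℝ≥0∞} (h : ∀ ω ∈ Ω, ∀ ω' ∈ Ω, ‖f ω - f ω'‖ₑ ≤ b * ‖ω - ω'‖ₑ) :
    lipNorm Ω f ≤ b :=
  iSup₂_le fun ω hω => iSup₂_le fun ω' hω' => ENNReal.div_le_of_le_mul (h ω hω ω' hω')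

theorem supNorm_le_ell : supNorm Ω f ≤ ell Ω φ f := le_self_add

theorem mul_lipNorm_le_ell : φ * lipNorm Ω f ≤ ell Ω φ f := le_add_self

theorem ell_mono (hΩ : Ω' ⊆ Ω) (hφ : φ' ≤ φ) : ell Ω' φ' f ≤ ell Ω φ f := by
  refine add_le_add (supNorm_le fun ω hω => enorm_le_supNorm (hΩ hω)) (mul_le_mul' hφ ?_)
  exact lipNorm_le fun ω hω ω' hω' => enorm_sub_le_lipNorm (hΩ hω) (hΩ hω')

theorem ell_le {a b : ℝ≥0∞} (h : ∀ ω ∈ Ω, ‖f ω‖ₑ ≤ a)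
    (h' : ∀ ω ∈ Ω, ∀ ω' ∈ Ω, ‖f ω - f ω'‖ₑ ≤ b * ‖ω - ω'‖ₑ) : ell Ω φ f ≤ a + φ * b := by
  unfold ell
  gcongr
  exacts [supNorm_le h, lipNorm_le h']

theorem ell_le_of_const {c : F} (h : ∀ ω ∈ Ω, f ω = c) : ell Ω φ f ≤ ‖c‖ₑ := by
  have := ell_le (Ω := Ω) (φ := φ) (f := f) (a := ‖c‖ₑ) (b := 0) (fun ω hω => by rw [h ω hω])
    (fun ω hω ω' hω' => by simp [h ω hω, h ω' hω'])
  simpa using this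

theorem ell_congr (h : ∀ ω ∈ Ω, f ω = g ω) : ell Ω φ f = ell Ω φ g := by
  unfold ell supNorm lipNorm
  congr 1
  · exact iSup_congr fun ω => iSup_congr fun hω => by rw [h ω hω]
  · congr 1
    exact iSup_congr fun ω => iSup_congr fun hω => iSup_congr fun ω' => iSup_congr fun hω' => by
      rw [h ω hω, h ω' hω']

theorem ell_neg : ell Ω φ (fun ω => -f ω) = ell Ω φ f := by
  have h : ∀ x y : F, ‖-x - -y‖ₑ = ‖x - y‖ₑ := fun x y => by rw [neg_sub_neg, enorm_sub_rev]
  simp only [ell, supNorm, lipNorm, enorm_neg, h]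

theorem ell_le_tsum {α : Type*} {f : α → ℝ → F} {s : ℝ → F}
    (h : ∀ ω ∈ Ω, HasSum (fun n => f n ω) (s ω)) : ell Ω φ s ≤ ∑' n, ell Ω φ (f n) := by
  refine (ell_le (a := ∑' n, supNorm Ω (f n)) (b := ∑' n, lipNorm Ω (f n)) ?_ ?_).trans ?_
  · intro ω hω
    rw [← (h ω hω).tsum_eq]
    exact enorm_tsum_le_tsum_enorm.trans (ENNReal.tsum_le_tsum fun n => enorm_le_supNorm hω)
  · intro ω hω ω' hω'
    rw [← ((h ω hω).sub (h ω' hω')).tsum_eq, ← ENNReal.tsum_mul_right]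
    exact enorm_tsum_le_tsum_enorm.trans
      (ENNReal.tsum_le_tsum fun n => enorm_sub_le_lipNorm hω hω')
  · rw [← ENNReal.tsum_mul_left, ← ENNReal.tsum_add]
    rfl

theorem ell_add_le : ell Ω φ (fun ω => f ω + g ω) ≤ ell Ω φ f + ell Ω φ g := by
  have := ell_le_tsum (Ω := Ω) (φ := φ) (f := fun b : Bool => if b then f else g)
    (s := fun ω => f ω + g ω) fun ω _ => by
      have := hasSum_fintype (fun b : Bool => (if b then f else g) ω)
      simpa using this
  simpa [tsum_bool, add_comm] using this

end Ell

/-! ### Weighted row sums form a submultiplicative norm -/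

section RowNorm

variable {I : Type*} [DecidableEq I] {G : I → Type*} [∀ i, NormedAddCommGroup (G i)]
  [∀ i, InnerProductSpace ℂ (G i)]
  {Ω Ω' : Set ℝ} {φ φ' : ℝ≥0∞} {w w' : I → I → ℝ≥0∞} {X Y : ℝ → lp G 2 →L[ℂ] lp G 2}

/-- The largest weighted row sum of the Lipschitz norms of the blocks of `X`. -/
def rowNorm (Ω : Set ℝ) (φ : ℝ≥0∞) (w : I → I → ℝ≥0∞) (X : ℝ → lp G 2 →L[ℂ] lp G 2) : ℝ≥0∞ :=
  ⨆ i, ∑' j, ell Ω φ (fun ω => block (X ω) i j) * w i j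

theorem tsum_le_rowNorm (i : I) :
    ∑' j, ell Ω φ (fun ω => block (X ω) i j) * w i j ≤ rowNorm Ω φ w X :=
  le_iSup (fun i => ∑' j, ell Ω φ (fun ω => block (X ω) i j) * w i j) i

theorem ell_mul_le_rowNorm (i j : I) :
    ell Ω φ (fun ω => block (X ω) i j) * w i j ≤ rowNorm Ω φ w X :=
  (ENNReal.le_tsum (f := fun j => ell Ω φ (fun ω => block (X ω) i j) * w i j) j).trans
    (tsum_le_rowNorm i)

theorem rowNorm_le_of_ell_le (c : ℝ≥0∞) (h : ∀ i j, ell Ω φ (fun ω => block (X ω) i j) * w i j ≤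
    c * (ell Ω' φ' (fun ω => block (Y ω) i j) * w' i j)) :
    rowNorm Ω φ w X ≤ c * rowNorm Ω' φ' w' Y := by
  refine iSup_le fun i => (ENNReal.tsum_le_tsum (h i)).trans ?_
  rw [ENNReal.tsum_mul_left]
  gcongr
  exact tsum_le_rowNorm i

theorem rowNorm_mono (hΩ : Ω' ⊆ Ω) (hφ : φ' ≤ φ) (hw : ∀ i j, w' i j ≤ w i j) :
    rowNorm Ω' φ' w' X ≤ rowNorm Ω φ w X := by
  simpa using rowNorm_le_of_ell_le (X := X) (Y := X) 1 fun i j => by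
    rw [one_mul]; exact mul_le_mul' (ell_mono hΩ hφ) (hw i j)

theorem rowNorm_congr (h : ∀ ω ∈ Ω, X ω = Y ω) : rowNorm Ω φ w X = rowNorm Ω φ w Y := by
  unfold rowNorm
  congr! 5 with i j
  exact ell_congr fun ω hω => by rw [h ω hω]

theorem rowNorm_neg : rowNorm Ω φ w (fun ω => -X ω) = rowNorm Ω φ w X := by
  simp only [rowNorm, block_neg, ell_neg]

theorem rowNorm_le_tsum {α : Type*} {X : α → ℝ → lp G 2 →L[ℂ] lp G 2}
    (h : ∀ ω ∈ Ω, HasSum (fun n => X n ω) (Y ω)) :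
    rowNorm Ω φ w Y ≤ ∑' n, rowNorm Ω φ w (X n) := by
  refine iSup_le fun i => ?_
  calc ∑' j, ell Ω φ (fun ω => block (Y ω) i j) * w i j
      ≤ ∑' j, (∑' n, ell Ω φ (fun ω => block (X n ω) i j)) * w i j := by
        gcongr with j
        exact ell_le_tsum fun ω hω => (h ω hω).mapL (blockL i j)
    _ = ∑' n, ∑' j, ell Ω φ (fun ω => block (X n ω) i j) * w i j := by
        simp only [← ENNReal.tsum_mul_right]
        rw [ENNReal.tsum_comm]
    _ ≤ _ := ENNReal.tsum_le_tsum fun n => tsum_le_rowNorm i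

theorem rowNorm_add_le :
    rowNorm Ω φ w (fun ω => X ω + Y ω) ≤ rowNorm Ω φ w X + rowNorm Ω φ w Y := by
  refine iSup_le fun i => le_trans ?_ (add_le_add (tsum_le_rowNorm i) (tsum_le_rowNorm i))
  rw [← ENNReal.tsum_add]
  refine ENNReal.tsum_le_tsum fun j => ?_
  rw [← add_mul]
  exact mul_le_mul_left (ell_add_le (f := fun ω => block (X ω) i j)
    (g := fun ω => block (Y ω) i j)) _

theorem rowNorm_sub_le :
    rowNorm Ω φ w (fun ω => X ω - Y ω) ≤ rowNorm Ω φ w X + rowNorm Ω φ w Y := by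
  have := rowNorm_add_le (Ω := Ω) (φ := φ) (w := w) (X := X) (Y := fun ω => -Y ω)
  rw [rowNorm_neg] at this
  simpa only [sub_eq_add_neg] using this

theorem rowNorm_one_le (hw : ∀ i, w i i ≤ 1) :
    rowNorm Ω φ w (fun _ => (1 : lp G 2 →L[ℂ] lp G 2)) ≤ 1 := by
  refine iSup_le fun i => ?_
  rw [tsum_eq_single i]
  · refine (mul_le_mul' (ell_le_of_const fun _ _ => rfl) (hw i)).trans ?_
    rw [block_one_self, mul_one]
    exact ContinuousLinearMap.opENorm_le_bound _ fun v => by simp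
  · intro j hj
    have : ell Ω φ (fun _ => block (1 : lp G 2 →L[ℂ] lp G 2) i j) ≤ 0 :=
      (ell_le_of_const fun _ _ => rfl).trans (by simp [block_one_of_ne hj.symm])
    rw [nonpos_iff_eq_zero.1 this, zero_mul]

/-- The Leibniz rule for Lipschitz constants. In `(s + φ l)(s' + φ l')` the extra term `φ² l l'` is
nonnegative and is simply added. -/
theorem ell_block_mul_le (i j : I) : ell Ω φ (fun ω => block (X ω * Y ω) i j) ≤
    ∑' l, ell Ω φ (fun ω => block (X ω) i l) * ell Ω φ (fun ω => block (Y ω) l j) := by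
  let sX := fun l => supNorm Ω (fun ω => block (X ω) i l)
  let sY := fun l => supNorm Ω (fun ω => block (Y ω) l j)
  let lX := fun l => lipNorm Ω (fun ω => block (X ω) i l)
  let lY := fun l => lipNorm Ω (fun ω => block (Y ω) l j)
  refine (ell_le (a := ∑' l, sX l * sY l) (b := ∑' l, (lX l * sY l + sX l * lY l)) ?_ ?_).trans ?_
  · intro ω hω
    refine (enorm_block_mul_le _ _ _ _).trans (ENNReal.tsum_le_tsum fun l => ?_)
    exact mul_le_mul' (enorm_le_supNorm (f := fun ω => block (X ω) i l) hω)
      (enorm_le_supNorm (f := fun ω => block (Y ω) l j) hω)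
  · intro ω hω ω' hω'
    have e : block (X ω * Y ω) i j - block (X ω' * Y ω') i j =
        block ((X ω - X ω') * Y ω) i j + block (X ω' * (Y ω - Y ω')) i j := by
      rw [← block_sub, ← block_add]; congr 1; noncomm_ring
    rw [e, ENNReal.tsum_add, add_mul, ← ENNReal.tsum_mul_right, ← ENNReal.tsum_mul_right]
    refine (enorm_add_le (block ((X ω - X ω') * Y ω) i j) (block (X ω' * (Y ω - Y ω')) i j)).trans
      (add_le_add ?_ ?_) <;>
      refine (enorm_block_mul_le _ _ _ _).trans (ENNReal.tsum_le_tsum fun l => ?_)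
    · rw [mul_right_comm]
      exact mul_le_mul' (enorm_sub_le_lipNorm (f := fun ω => block (X ω) i l) hω hω')
        (enorm_le_supNorm (f := fun ω => block (Y ω) l j) hω)
    · rw [mul_assoc]
      exact mul_le_mul' (enorm_le_supNorm (f := fun ω => block (X ω) i l) hω')
        (enorm_sub_le_lipNorm (f := fun ω => block (Y ω) l j) hω hω')
  · rw [← ENNReal.tsum_mul_left, ← ENNReal.tsum_add]
    refine ENNReal.tsum_le_tsum fun l => ?_
    change sX l * sY l + φ * (lX l * sY l + sX l * lY l) ≤ (sX l + φ * lX l) * (sY l + φ * lY l)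
    calc _ ≤ sX l * sY l + φ * (lX l * sY l + sX l * lY l) + φ * lX l * (φ * lY l) := le_self_add
      _ = _ := by ring

theorem rowNorm_mul_le (hw : ∀ i l j, w i j ≤ w i l * w l j) :
    rowNorm Ω φ w (fun ω => X ω * Y ω) ≤ rowNorm Ω φ w X * rowNorm Ω φ w Y := by
  refine iSup_le fun i => ?_
  calc ∑' j, ell Ω φ (fun ω => block (X ω * Y ω) i j) * w i j
      ≤ ∑' j, ∑' l, (ell Ω φ (fun ω => block (X ω) i l) * w i l) *
          (ell Ω φ (fun ω => block (Y ω) l j) * w l j) := by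
        gcongr with j
        refine (mul_le_mul_left (ell_block_mul_le i j) _).trans ?_
        rw [← ENNReal.tsum_mul_right]
        refine ENNReal.tsum_le_tsum fun l => ?_
        rw [mul_mul_mul_comm]
        exact mul_le_mul_right (hw i l j) _
    _ = ∑' l, (ell Ω φ (fun ω => block (X ω) i l) * w i l) *
          ∑' j, (ell Ω φ (fun ω => block (Y ω) l j) * w l j) := by
        rw [ENNReal.tsum_comm]
        simp only [ENNReal.tsum_mul_left]
    _ ≤ ∑' l, (ell Ω φ (fun ω => block (X ω) i l) * w i l) * rowNorm Ω φ w Y := by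
        gcongr with l
        exact tsum_le_rowNorm l
    _ ≤ _ := by
        rw [ENNReal.tsum_mul_right]
        gcongr
        exact tsum_le_rowNorm i

theorem rowNorm_pow_le (hw : ∀ i l j, w i j ≤ w i l * w l j) (hw1 : ∀ i, w i i ≤ 1) (n : ℕ) :
    rowNorm Ω φ w (fun ω => X ω ^ n) ≤ rowNorm Ω φ w X ^ n := by
  induction n with
  | zero => simpa using rowNorm_one_le hw1
  | succ n ih =>
    simp only [pow_succ]
    exact (rowNorm_mul_le hw).trans (by gcongr)

theorem rowNorm_geom_le (hw : ∀ i l j, w i j ≤ w i l * w l j) (hw1 : ∀ i, w i i ≤ 1)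
    (h : ∀ ω ∈ Ω, ‖X ω‖ < 1) [∀ i, CompleteSpace (G i)] :
    rowNorm Ω φ w (fun ω => ∑' n : ℕ, X ω ^ n) ≤ (1 - rowNorm Ω φ w X)⁻¹ := by
  rw [← ENNReal.tsum_geometric]
  refine (rowNorm_le_tsum (X := fun n ω => X ω ^ n) fun ω hω => ?_).trans
    (ENNReal.tsum_le_tsum fun n => rowNorm_pow_le hw hw1 n)
  exact (summable_geometric_of_norm_lt_one (h ω hω)).hasSum

theorem tsum_enorm_block_le_rowNorm (hw : ∀ i j, 1 ≤ w i j) {ω : ℝ} (hω : ω ∈ Ω) (i : I) :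
    ∑' j, ‖block (X ω) i j‖ₑ ≤ rowNorm Ω φ w X := by
  refine (ENNReal.tsum_le_tsum fun j => ?_).trans (tsum_le_rowNorm i)
  calc ‖block (X ω) i j‖ₑ ≤ ell Ω φ (fun ω => block (X ω) i j) * 1 := by
        rw [mul_one]
        exact (enorm_le_supNorm (f := fun ω => block (X ω) i j) hω).trans supNorm_le_ell
    _ ≤ _ := by gcongr; exact hw i j

/-- Schur's test needs column sums too; for self-adjoint or skew-adjoint values the symmetry of
block norms makes them equal to row sums, so `rowNorm` alone controls the operator norm. -/
theorem norm_le_of_rowNorm_le [∀ i, CompleteSpace (G i)] (hw : ∀ i j, 1 ≤ w i j) {ω : ℝ}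
    (hω : ω ∈ Ω) (hX : ∀ i j, ‖block (X ω) i j‖ₑ = ‖block (X ω) j i‖ₑ) {C : ℝ} (hC : 0 ≤ C)
    (h : rowNorm Ω φ w X ≤ ENNReal.ofReal C) : ‖X ω‖ ≤ C := by
  lift C to NNReal using hC
  rw [ENNReal.ofReal_coe_nnreal] at h
  have h1 : ∀ i, ∑' j, ‖block (X ω) i j‖ₑ ≤ C := fun i =>
    (tsum_enorm_block_le_rowNorm hw hω i).trans h
  exact norm_le_of_block (X ω) C h1 fun j => by simpa only [hX _ j] using h1 j

end RowNorm

end Floquet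
end

noncomputable section

namespace Floquet

open Filter Topology

/-! ### Commutators with a diagonal operator -/

section Rel

variable {I : Type*} [DecidableEq I] {G : I → Type*} [∀ i, NormedAddCommGroup (G i)]
  [∀ i, InnerProductSpace ℂ (G i)] {lam : I → ℝ} {X Y X' Y' : lp G 2 →L[ℂ] lp G 2}

/-- `Y` is the commutator `[K, X]`, where `K` is diagonal with entries `lam i`. -/
def IsCommutator (lam : I → ℝ) (X Y : lp G 2 →L[ℂ] lp G 2) : Prop :=
  ∀ i j, block Y i j = ((lam i - lam j : ℝ) : ℂ) • block X i j

namespace IsCommutator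

theorem one : IsCommutator lam (1 : lp G 2 →L[ℂ] lp G 2) 0 := fun i j => by
  rcases eq_or_ne i j with rfl | h
  · simp
  · simp [block_one_of_ne h]

theorem zero : IsCommutator lam (0 : lp G 2 →L[ℂ] lp G 2) 0 := fun i j => by simp

theorem add (h : IsCommutator lam X Y) (h' : IsCommutator lam X' Y') :
    IsCommutator lam (X + X') (Y + Y') := fun i j => by
  rw [block_add, block_add, h i j, h' i j, smul_add]

theorem sub (h : IsCommutator lam X Y) (h' : IsCommutator lam X' Y') :
    IsCommutator lam (X - X') (Y - Y') := fun i j => by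
  rw [block_sub, block_sub, h i j, h' i j, smul_sub]

theorem mul (h : IsCommutator lam X Y) (h' : IsCommutator lam X' Y') :
    IsCommutator lam (X * X') (Y * X' + X * Y') := fun i j => by
  ext v
  rw [block_add]
  refine ((hasSum_block_mul Y X' i j v).add (hasSum_block_mul X Y' i j v)).unique ?_
  refine ((hasSum_block_mul X X' i j v).const_smul ((lam i - lam j : ℝ) : ℂ)).congr_fun fun l => ?_
  rw [h i l, h' l j]
  simp only [smul_apply, map_smul, ← add_smul]
  push_cast
  ring_nf

theorem star [∀ i, CompleteSpace (G i)] (h : IsCommutator lam X Y) :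
    IsCommutator lam (star X) (-star Y) := fun i j => by
  rw [block_neg, block_star, block_star, h j i, map_smulₛₗ, ← neg_smul]
  congr 1
  simp

theorem of_tendsto {X Y : ℕ → lp G 2 →L[ℂ] lp G 2} {X' Y' : lp G 2 →L[ℂ] lp G 2}
    (h : ∀ n, IsCommutator lam (X n) (Y n)) (hX : Tendsto X atTop (𝓝 X'))
    (hY : Tendsto Y atTop (𝓝 Y')) : IsCommutator lam X' Y' := fun i j => by
  have h1 := ((blockL i j).continuous.tendsto _).comp hY
  have h2 := (((blockL i j).continuous.tendsto _).comp hX).const_smul ((lam i - lam j : ℝ) : ℂ)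
  exact tendsto_nhds_unique h1 (h2.congr fun n => (h n i j).symm)

theorem unique (h : IsCommutator lam X Y) (h' : IsCommutator lam X Y') : Y = Y' :=
  block_ext fun i j => by rw [h i j, h' i j]

/-- The derivation rule `[K, (1 - B)⁻¹] = (1 - B)⁻¹ [K, B] (1 - B)⁻¹`. As `K` is not a bounded
operator, it is obtained as a limit over partial sums of the Neumann series. -/
theorem geom [∀ i, CompleteSpace (G i)] {B B' : lp G 2 →L[ℂ] lp G 2}
    (h : IsCommutator lam B B') (hB : ‖B‖ < 1) :
    IsCommutator lam (∑' n : ℕ, B ^ n) ((∑' n : ℕ, B ^ n) * B' * ∑' n : ℕ, B ^ n) := by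
  set S := ∑' n : ℕ, B ^ n with hS
  -- A rate `q > 0` is needed because `‖B‖` may vanish. The bound for `[K, B^n]`, of order `n
  -- q^(n-1)`, is kept multiplied by `q` to avoid the exponent `n - 1`.
  obtain ⟨q, hq1, hq2⟩ := exists_between hB
  have hq0 : 0 < q := (norm_nonneg B).trans_lt hq1
  have hpow : ∀ n : ℕ, ∃ P, IsCommutator lam (B ^ n) P ∧ ‖P‖ * q ≤ n * q ^ n * ‖B'‖ := fun n => by
    induction n with
    | zero => exact ⟨0, by simpa using one, by simp⟩
    | succ n ih =>
      obtain ⟨P, hP, hPn⟩ := ih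
      refine ⟨P * B + B ^ n * B', by rw [pow_succ]; exact hP.mul h, ?_⟩
      have h1 : ‖B ^ n‖ ≤ q ^ n := by
        rcases n.eq_zero_or_pos with rfl | hn
        · exact (ContinuousLinearMap.norm_id_le (𝕜 := ℂ) (E := lp G 2)).trans (by simp)
        · exact (norm_pow_le' B hn).trans (by gcongr)
      calc ‖P * B + B ^ n * B'‖ * q ≤ (‖P‖ * ‖B‖ + ‖B ^ n‖ * ‖B'‖) * q := by
            gcongr
            exact (norm_add_le _ _).trans (add_le_add (norm_mul_le _ _) (norm_mul_le _ _))
        _ ≤ (‖P‖ * q + q ^ n * ‖B'‖) * q := by gcongr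
        _ ≤ (n * q ^ n * ‖B'‖ + q ^ n * ‖B'‖) * q := by gcongr
        _ = (n + 1 : ℕ) * q ^ (n + 1) * ‖B'‖ := by push_cast; ring
  choose P hP hPn using hpow
  have hlim : Tendsto (fun n : ℕ => ∑ k ∈ Finset.range n, B ^ k) atTop (𝓝 S) :=
    (summable_geometric_of_norm_lt_one hB).hasSum.tendsto_sum_nat
  have hP0 : Tendsto P atTop (𝓝 0) := by
    rw [tendsto_zero_iff_norm_tendsto_zero]
    have h1 := (tendsto_self_mul_const_pow_of_lt_one hq0.le hq2).mul_const (‖B'‖ / q)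
    rw [zero_mul] at h1
    refine squeeze_zero (fun _ => norm_nonneg _) (fun n => ?_) h1
    rw [mul_div_assoc', le_div_iff₀ hq0]
    exact hPn n
  have hZ : ∀ n : ℕ, IsCommutator lam (∑ k ∈ Finset.range n, B ^ k)
      (∑ k ∈ Finset.range n, P k) := fun n => by
    induction n with
    | zero => simpa using zero
    | succ n ih => rw [Finset.sum_range_succ, Finset.sum_range_succ]; exact ih.add (hP n)
  -- Taking commutators in `(1 - B) Z_n = 1 - B^n` and solving for `[K, Z_n]` expresses it through
  -- convergent quantities.
  have hZ' : ∀ n : ℕ, ∑ k ∈ Finset.range n, P k =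
      S * (B' * (∑ k ∈ Finset.range n, B ^ k) - P n) := fun n => by
    have h1 := (one.sub h).mul (hZ n)
    have h2 : (1 - B) * ∑ k ∈ Finset.range n, B ^ k = 1 - B ^ n := mul_neg_geom_sum B n
    rw [h2] at h1
    have h3 := h1.unique (one.sub (hP n))
    have h4 : (1 - B) * ∑ k ∈ Finset.range n, P k =
        B' * (∑ k ∈ Finset.range n, B ^ k) - P n := by
      rw [zero_sub, zero_sub] at h3
      rw [sub_eq_add_neg (B' * _), ← h3]; noncomm_ring
    rw [← h4, ← mul_assoc, geom_series_mul_neg B hB, one_mul]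
  refine of_tendsto hZ hlim ?_
  simp only [hZ', mul_assoc]
  simpa using ((hlim.const_mul B').sub hP0).const_mul S

end IsCommutator

/-- The Cayley transform of a skew-adjoint solution of `[K + D, B] = O / 2` conjugates
`K + D + O` to `K + D` up to a quadratic remainder. -/
theorem IsCommutator.cayley [∀ i, CompleteSpace (G i)] {B D O : lp G 2 →L[ℂ] lp G 2}
    (h : IsCommutator lam B ((1 / 2 : ℂ) • O - (D * B - B * D))) (hB : ‖B‖ < 1) :
    IsCommutator lam ((∑' n : ℕ, B ^ n) * (1 + B))
      (((∑' n : ℕ, B ^ n) * (1 + B)) * (D + O) -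
        (D + (∑' n : ℕ, B ^ n) * (B * O - O * B - B * O * B) * ∑' n : ℕ, (-B) ^ n) *
          ((∑' n : ℕ, B ^ n) * (1 + B))) := by
  have hB' : ‖-B‖ < 1 := by rwa [norm_neg]
  have e1 := mul_neg_geom_series B hB
  have e2 := geom_series_mul_neg B hB
  have e3 := mul_neg_geom_series (-B) hB'
  have e4 := geom_series_mul_neg (-B) hB'
  have h1 := (h.geom hB).mul (one.add h)
  set S := ∑' n : ℕ, B ^ n
  set S' := ∑' n : ℕ, (-B) ^ n
  rw [sub_neg_eq_add] at e3 e4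
  have hc : S * (1 + B) = (1 + B) * S := by
    have : (1 - B) * (1 + B) = (1 + B) * (1 - B) := by noncomm_ring
    calc S * (1 + B) = S * ((1 + B) * (1 - B)) * S := by
          rw [mul_assoc, mul_assoc, e1, mul_one]
      _ = S * (1 - B) * (1 + B) * S := by rw [← this]; noncomm_ring
      _ = _ := by rw [e2, one_mul]
  -- This collapses the commutator of the Cayley transform to `S (2 B1) S`, where `2 B1 = O - 2 [D,
  -- B]`.
  have h2 : S * (1 + B) + 1 = (2 : ℂ) • S := by
    nth_rw 2 [← e2]
    rw [two_smul]; noncomm_ring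
  convert h1 using 1
  set B1 := (1 / 2 : ℂ) • O - (D * B - B * D)
  have h3 : S * B1 * S * (1 + B) + S * (0 + B1) = S * ((2 : ℂ) • B1) * S := by
    calc _ = S * B1 * (S * (1 + B) + 1) := by noncomm_ring
      _ = _ := by rw [h2]; simp [mul_assoc]
  rw [h3]
  have h4 : (2 : ℂ) • B1 = O - (2 : ℂ) • (D * B - B * D) := by
    rw [smul_sub, smul_smul]; norm_num
  rw [h4]
  -- Since `1 - B` is invertible, the identity may be checked between two factors `1 - B`. There it
  -- is polynomial: `(1 + B) O (1 - B) - O` is exactly the remainder `Q`, and the `D` terms leave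
  -- `-2 [D, B]`.
  have h5 : ∀ Z Z' : lp G 2 →L[ℂ] lp G 2, (1 - B) * Z * (1 - B) = (1 - B) * Z' * (1 - B) →
      Z = Z' := fun Z Z' h => by
    calc Z = S * ((1 - B) * Z * (1 - B)) * S := by
          rw [mul_assoc (1 - B), ← mul_assoc S, e2, one_mul, mul_assoc, e1, mul_one]
      _ = S * ((1 - B) * Z' * (1 - B)) * S := by rw [h]
      _ = Z' := by rw [mul_assoc (1 - B), ← mul_assoc S, e2, one_mul, mul_assoc, e1, mul_one]
  apply h5
  have h6 : (1 - B) * (S * (1 + B)) = 1 + B := by rw [← mul_assoc, e1, one_mul]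
  have h7 : S * (1 + B) * (1 - B) = 1 + B := by rw [hc, mul_assoc, e2, mul_one]
  set Q := B * O - O * B - B * O * B
  calc (1 - B) * (S * (1 + B) * (D + O) - (D + S * Q * S') * (S * (1 + B))) * (1 - B)
      = ((1 - B) * (S * (1 + B))) * (D + O) * (1 - B) -
        ((1 - B) * D + ((1 - B) * S) * Q * S') * (S * (1 + B) * (1 - B)) := by noncomm_ring
    _ = (1 + B) * (D + O) * (1 - B) - ((1 - B) * D * (1 + B) + Q * (S' * (1 + B))) := by
        rw [h6, h7, e1]; noncomm_ring
    _ = (1 + B) * (D + O) * (1 - B) - ((1 - B) * D * (1 + B) + Q) := by rw [e4, mul_one]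
    _ = O - (2 : ℂ) • (D * B - B * D) := by rw [two_smul]; simp only [Q]; noncomm_ring
    _ = ((1 - B) * S) * (O - (2 : ℂ) • (D * B - B * D)) * (S * (1 - B)) := by
        rw [e1, e2, one_mul, mul_one]
    _ = _ := by noncomm_ring

end Rel

/-! ### Cayley transform of a skew-adjoint operator -/

section Cayley

variable {A : Type*} [NormedRing A] [StarRing A] [NormedStarGroup A] [CompleteSpace A]

theorem star_geom {B : A} (hB : ‖B‖ < 1) (hs : star B = -B) :
    star (∑' n : ℕ, B ^ n) = ∑' n : ℕ, (-B) ^ n := by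
  have h := (summable_geometric_of_norm_lt_one hB).hasSum.star
  rw [← h.tsum_eq]
  exact tsum_congr fun n => by rw [star_pow, hs]

/-- For skew-adjoint `B` the adjoint of `(1 - B)⁻¹ (1 + B)` is `(1 - B) (1 + B)⁻¹`, its inverse
because all factors commute. -/
theorem star_cayley_mul_self {B : A} (hB : ‖B‖ < 1) (hs : star B = -B) :
    star ((∑' n : ℕ, B ^ n) * (1 + B)) * ((∑' n : ℕ, B ^ n) * (1 + B)) = 1 ∧
    ((∑' n : ℕ, B ^ n) * (1 + B)) * star ((∑' n : ℕ, B ^ n) * (1 + B)) = 1 := by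
  have hB' : ‖-B‖ < 1 := by rwa [norm_neg]
  rw [star_mul, star_geom hB hs, star_add, star_one, hs, ← sub_eq_add_neg]
  have e1 := mul_neg_geom_series B hB
  have e2 := geom_series_mul_neg B hB
  have e3 := mul_neg_geom_series (-B) hB'
  have e4 := geom_series_mul_neg (-B) hB'
  set S := ∑' n : ℕ, B ^ n
  set S' := ∑' n : ℕ, (-B) ^ n
  rw [sub_neg_eq_add] at e3 e4
  have hc : S * (1 + B) = (1 + B) * S := by
    have : (1 - B) * (1 + B) = (1 + B) * (1 - B) := by noncomm_ring
    calc S * (1 + B) = S * ((1 + B) * (1 - B)) * S := by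
          rw [mul_assoc, mul_assoc, e1, mul_one]
      _ = S * (1 - B) * (1 + B) * S := by rw [← this]; noncomm_ring
      _ = _ := by rw [e2, one_mul]
  constructor
  · calc (1 - B) * S' * (S * (1 + B)) = (1 - B) * (S' * (1 + B)) * S := by
          rw [hc]; noncomm_ring
      _ = 1 := by rw [e4, mul_one, e1]
  · calc S * (1 + B) * ((1 - B) * S') = S * ((1 + B) * (1 - B)) * S' := by noncomm_ring
      _ = S * ((1 - B) * (1 + B)) * S' := by congr 2; noncomm_ring
      _ = (S * (1 - B)) * ((1 + B) * S') := by noncomm_ring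
      _ = 1 := by rw [e2, e3, one_mul]

end Cayley

/-! ### Shift-invariant block matrices -/

section Toeplitz

variable {G : ℕ → Type*} [∀ n, NormedAddCommGroup (G n)] [∀ n, InnerProductSpace ℂ (G n)]

/-- The Hilbert sum of copies of the spaces `G n`, indexed by `ℤ × ℕ`. -/
abbrev SeqSpace (G : ℕ → Type*) [∀ n, NormedAddCommGroup (G n)] : Type _ :=
  lp (fun i : ℤ × ℕ => G i.2) 2

variable {X Y : SeqSpace G →L[ℂ] SeqSpace G}

/-- Operators whose blocks depend only on the difference of the integer indices. -/
def IsToeplitz (X : SeqSpace G →L[ℂ] SeqSpace G) : Prop :=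
  ∀ (k l : ℤ) (n m : ℕ), block X (k + 1, n) (l + 1, m) = block X (k, n) (l, m)

namespace IsToeplitz

theorem block_eq (h : IsToeplitz X) (n m : ℕ) (a : ℤ) :
    ∀ {k l k' l' : ℤ}, k' = k + a → l' = l + a →
      block X (k', n) (l', m) = block X (k, n) (l, m) := by
  induction a with
  | zero => rintro k l _ _ rfl rfl; congr! 1 <;> simp
  | succ a ih =>
    rintro k l _ _ rfl rfl
    refine .trans ?_ ((h (k + a) (l + a) n m).trans (ih rfl rfl))
    congr! 1 <;> ring_nf
  | pred a ih =>
    rintro k l _ _ rfl rfl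
    refine .trans (h _ _ n m).symm (ih ?_ ?_) <;> ring

theorem block_diag (h : IsToeplitz X) (k : ℤ) (n : ℕ) :
    block X (k, n) (k, n) = block X (0, n) (0, n) :=
  h.block_eq n n k (zero_add k).symm (zero_add k).symm

theorem one : IsToeplitz (1 : SeqSpace G →L[ℂ] SeqSpace G) := fun k l n m => by
  by_cases h : ((k, n) : ℤ × ℕ) = (l, m)
  · obtain ⟨rfl, rfl⟩ := Prod.mk.inj h
    rw [block_one_self, block_one_self]
  · have h' : ((k + 1, n) : ℤ × ℕ) ≠ (l + 1, m) := fun e => h (by simpa using e)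
    rw [block_one_of_ne h, block_one_of_ne h']

theorem add (h : IsToeplitz X) (h' : IsToeplitz Y) : IsToeplitz (X + Y) := fun k l n m => by
  rw [block_add, block_add, h, h']

theorem neg (h : IsToeplitz X) : IsToeplitz (-X) := fun k l n m => by
  rw [block_neg, block_neg, h]

theorem sub (h : IsToeplitz X) (h' : IsToeplitz Y) : IsToeplitz (X - Y) := fun k l n m => by
  rw [block_sub, block_sub, h, h']

theorem mul (h : IsToeplitz X) (h' : IsToeplitz Y) : IsToeplitz (X * Y) := fun k l n m => by
  ext v
  refine (hasSum_block_mul X Y (k + 1, n) (l + 1, m) v).unique ?_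
  let e : ℤ × ℕ ≃ ℤ × ℕ := (Equiv.addRight (1 : ℤ)).prodCongr (Equiv.refl ℕ)
  refine (e.hasSum_iff (f := fun i => block X (k + 1, n) i (block Y i (l + 1, m) v))).1 ?_
  refine (hasSum_block_mul X Y (k, n) (l, m) v).congr_fun fun i => ?_
  obtain ⟨a, p⟩ := i
  change block X (k + 1, n) (a + 1, p) (block Y (a + 1, p) (l + 1, m) v) = _
  rw [h, h']

theorem pow (h : IsToeplitz X) (a : ℕ) : IsToeplitz (X ^ a) := by
  induction a with
  | zero => simpa using one
  | succ a ih => rw [pow_succ]; exact ih.mul h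

theorem geom [∀ n, CompleteSpace (G n)] (h : IsToeplitz X) (hX : ‖X‖ < 1) :
    IsToeplitz (∑' a : ℕ, X ^ a) := fun k l n m => by
  have hs := (summable_geometric_of_norm_lt_one hX).hasSum
  have h1 := hs.mapL (blockL (k + 1, n) (l + 1, m))
  have h2 := hs.mapL (blockL (k, n) (l, m))
  refine h1.unique (h2.congr_fun fun a => ?_)
  exact h.pow a k l n m

theorem star [∀ n, CompleteSpace (G n)] (h : IsToeplitz X) : IsToeplitz (star X) :=
  fun k l n m => by rw [block_star, block_star, h]

end IsToeplitz

end Toeplitz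

end Floquet
end

noncomputable section

namespace Floquet

/-! ### Eigenvalues of Hermitian operators and Sylvester equations in finite dimensions -/

section FiniteDim

open ContinuousLinearMap Module

variable {F G : Type*} [NormedAddCommGroup F] [InnerProductSpace ℂ F] [NormedAddCommGroup G]
  [InnerProductSpace ℂ G]

theorem sum_norm_sq_apply_eq {m n : ℕ} (u : OrthonormalBasis (Fin n) ℂ F)
    (v : OrthonormalBasis (Fin m) ℂ G) (X : G →L[ℂ] F) :
    ∑ j, ∑ i, ‖inner ℂ (u i) (X (v j))‖ ^ 2 = ∑ j, ‖X (v j)‖ ^ 2 :=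
  Finset.sum_congr rfl fun _ _ => u.sum_sq_norm_inner_right _

theorem sum_norm_sq_apply_le {m : ℕ} (v : OrthonormalBasis (Fin m) ℂ G) (X : G →L[ℂ] F) :
    ∑ j, ‖X (v j)‖ ^ 2 ≤ m * ‖X‖ ^ 2 := by
  calc ∑ j, ‖X (v j)‖ ^ 2 ≤ ∑ _j : Fin m, ‖X‖ ^ 2 := by
        gcongr with j
        simpa using X.le_opNorm (v j)
    _ = _ := by simp

/-- The Hilbert–Schmidt norm dominates the operator norm, by Cauchy–Schwarz over the coordinates of
`x`. -/
theorem norm_sq_le_sum {m : ℕ} (v : OrthonormalBasis (Fin m) ℂ G) (X : G →L[ℂ] F) :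
    ‖X‖ ^ 2 ≤ ∑ j, ‖X (v j)‖ ^ 2 := by
  refine (Real.le_sqrt (norm_nonneg _) (by positivity)).1 (X.opNorm_le_bound (by positivity) ?_)
  intro x
  have h1 : X x = ∑ j, inner ℂ (v j) x • X (v j) := by
    conv_lhs => rw [← v.sum_repr' x]
    simp
  have h2 : ‖X x‖ ≤ ∑ j, ‖inner ℂ (v j) x‖ * ‖X (v j)‖ := by
    rw [h1]
    exact (norm_sum_le _ _).trans (by simp [norm_smul])
  refine h2.trans ?_
  refine (Real.sum_mul_le_sqrt_mul_sqrt _ _ _).trans ?_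
  rw [v.sum_sq_norm_inner_right, Real.sqrt_sq (norm_nonneg _), mul_comm]

/-- The crude bound used far from resonance, where `|c|` dominates both matrices and no dimension
factor is lost. -/
theorem le_norm_sylvester_of_norm (A : F →L[ℂ] F) (B : G →L[ℂ] G) (c : ℝ) (X : G →L[ℂ] F) :
    (|c| - ‖A‖ - ‖B‖) * ‖X‖ ≤ ‖(c : ℂ) • X + A ∘L X - X ∘L B‖ := by
  have h1 : ‖(c : ℂ) • X‖ = |c| * ‖X‖ := by simp [norm_smul]
  have h2 : (c : ℂ) • X = ((c : ℂ) • X + A ∘L X - X ∘L B) - A ∘L X + X ∘L B := by abel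
  have h3 : ‖(c : ℂ) • X‖ ≤ ‖(c : ℂ) • X + A ∘L X - X ∘L B‖ + ‖A‖ * ‖X‖ + ‖X‖ * ‖B‖ := by
    conv_lhs => rw [h2]
    refine (norm_add_le _ _).trans (add_le_add ((norm_sub_le _ _).trans ?_) (opNorm_comp_le _ _))
    gcongr
    exact opNorm_comp_le _ _
  rw [h1] at h3
  linarith

/-- The linear map `X ↦ c X + A X - X B`. -/
def sylvester (c : ℝ) (A : F →L[ℂ] F) (B : G →L[ℂ] G) : (G →L[ℂ] F) →ₗ[ℂ] (G →L[ℂ] F) where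
  toFun X := (c : ℂ) • X + A ∘L X - X ∘L B
  map_add' X Y := by simp only [smul_add, comp_add, add_comp]; abel
  map_smul' z X := by
    simp only [comp_smul, smul_comp, RingHom.id_apply, smul_sub, smul_add, smul_comm z (c : ℂ)]

theorem sylvester_apply (c : ℝ) (A : F →L[ℂ] F) (B : G →L[ℂ] G) (X : G →L[ℂ] F) :
    sylvester c A B X = (c : ℂ) • X + A ∘L X - X ∘L B := rfl

variable [FiniteDimensional ℂ F] [FiniteDimensional ℂ G]

theorem sylvester_bijective {c ψ : ℝ} {A : F →L[ℂ] F} {B : G →L[ℂ] G} (hψ : 0 < ψ)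
    (h : ∀ X, ψ * ‖X‖ ≤ ‖sylvester c A B X‖) : Function.Bijective (sylvester c A B) := by
  have hinj : Function.Injective (sylvester c A B) := by
    rw [injective_iff_map_eq_zero]
    intro X hX
    have := h X
    rw [hX, norm_zero] at this
    have h0 : ‖X‖ ≤ 0 := by
      by_contra! h0
      exact absurd (mul_pos hψ h0) (not_lt.2 this)
    exact norm_le_zero_iff.1 h0
  exact ⟨hinj, LinearMap.injective_iff_surjective.1 hinj⟩

variable [CompleteSpace F] [CompleteSpace G]

open Classical in
/-- The decreasing sequence of eigenvalues of a Hermitian operator, counted with multiplicity. -/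
def eig (A : F →L[ℂ] F) (i : Fin (finrank ℂ F)) : ℝ :=
  if h : IsSelfAdjoint A then h.isSymmetric.eigenvalues rfl i else 0

theorem exists_eigenbasis {A : F →L[ℂ] F} (hA : IsSelfAdjoint A) :
    ∃ u : OrthonormalBasis (Fin (finrank ℂ F)) ℂ F, ∀ i, A (u i) = (eig A i : ℂ) • u i := by
  refine ⟨hA.isSymmetric.eigenvectorBasis rfl, fun i => ?_⟩
  rw [eig, dif_pos hA]
  exact hA.isSymmetric.apply_eigenvectorBasis rfl i

theorem eig_antitone {A : F →L[ℂ] F} (hA : IsSelfAdjoint A) : Antitone (eig A) := by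
  intro i j hij
  rw [eig, eig, dif_pos hA, dif_pos hA]
  exact hA.isSymmetric.eigenvalues_antitone rfl hij

theorem inner_apply_eq_sum {A : F →L[ℂ] F} (hA : IsSelfAdjoint A)
    {u : OrthonormalBasis (Fin (finrank ℂ F)) ℂ F} (hu : ∀ i, A (u i) = (eig A i : ℂ) • u i)
    (x : F) : (inner ℂ x (A x)).re = ∑ i, eig A i * ‖inner ℂ (u i) x‖ ^ 2 := by
  rw [← u.sum_inner_mul_inner x (A x), Complex.re_sum]
  refine Finset.sum_congr rfl fun i _ => ?_
  have h1 : inner ℂ (u i) (A x) = (eig A i : ℂ) * inner ℂ (u i) x := by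
    rw [← ContinuousLinearMap.coe_coe, ← hA.isSymmetric (u i) x, ContinuousLinearMap.coe_coe, hu i,
      inner_smul_left, Complex.conj_ofReal]
  rw [h1, ← inner_conj_symm x, ← Complex.normSq_eq_norm_sq, mul_left_comm, mul_comm (starRingEnd ℂ _),
    Complex.mul_conj, ← Complex.ofReal_mul, Complex.ofReal_re]

/-- The Courant–Fischer dimension count: orthogonality to the eigenvectors of `A` after `i` and to
those of `B` before `i` imposes one condition fewer than the dimension. On a nonzero `x` satisfying
them, the form of `A` is at least `eig A i` and that of `B` at most `eig B i`. -/
theorem eig_le_eig_add {A B : F →L[ℂ] F} (hA : IsSelfAdjoint A) (hB : IsSelfAdjoint B)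
    (i : Fin (finrank ℂ F)) : eig A i ≤ eig B i + ‖A - B‖ := by
  obtain ⟨u, hu⟩ := exists_eigenbasis hA
  obtain ⟨v, hv⟩ := exists_eigenbasis hB
  let T : F →ₗ[ℂ] ({j : Fin (finrank ℂ F) // j ≠ i} → ℂ) :=
    LinearMap.pi fun j => if i < j.1 then (innerSL ℂ (u j.1)).toLinearMap
      else (innerSL ℂ (v j.1)).toLinearMap
  have hlt : finrank ℂ ({j : Fin (finrank ℂ F) // j ≠ i} → ℂ) < finrank ℂ F := by
    have := i.pos
    simp
    omega
  obtain ⟨x, hx, hx0⟩ := (Submodule.ne_bot_iff _).1 (LinearMap.ker_ne_bot_of_finrank_lt (f := T) hlt)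
  have hTx : ∀ j (hj : j ≠ i), T x ⟨j, hj⟩ = 0 := fun j hj => by
    rw [LinearMap.mem_ker.1 hx]; rfl
  have hgt : ∀ j, i < j → inner ℂ (u j) x = 0 := fun j hj => by
    have := hTx j hj.ne'
    simpa [T, hj] using this
  have hlt' : ∀ j, j < i → inner ℂ (v j) x = 0 := fun j hj => by
    have := hTx j hj.ne
    simpa [T, hj.not_gt] using this
  have h1 : eig A i * ‖x‖ ^ 2 ≤ (inner ℂ x (A x)).re := by
    rw [inner_apply_eq_sum hA hu, ← u.sum_sq_norm_inner_right x, Finset.mul_sum]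
    refine Finset.sum_le_sum fun j _ => ?_
    rcases lt_or_ge i j with hj | hj
    · simp [hgt j hj]
    · exact mul_le_mul_of_nonneg_right (eig_antitone hA hj) (by positivity)
  have h2 : (inner ℂ x (B x)).re ≤ eig B i * ‖x‖ ^ 2 := by
    rw [inner_apply_eq_sum hB hv, ← v.sum_sq_norm_inner_right x, Finset.mul_sum]
    refine Finset.sum_le_sum fun j _ => ?_
    rcases lt_or_ge j i with hj | hj
    · simp [hlt' j hj]
    · exact mul_le_mul_of_nonneg_right (eig_antitone hB hj) (by positivity)
  have h3 : (inner ℂ x ((A - B) x)).re ≤ ‖A - B‖ * ‖x‖ ^ 2 := by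
    calc (inner ℂ x ((A - B) x)).re ≤ ‖x‖ * ‖(A - B) x‖ :=
          (Complex.re_le_norm _).trans (norm_inner_le_norm _ _)
      _ ≤ ‖x‖ * (‖A - B‖ * ‖x‖) := by gcongr; exact (A - B).le_opNorm x
      _ = _ := by ring
  have h4 : (inner ℂ x (A x)).re = (inner ℂ x (B x)).re + (inner ℂ x ((A - B) x)).re := by
    rw [← Complex.add_re, ← inner_add_right]; simp
  have hpos : 0 < ‖x‖ ^ 2 := by positivity
  exact le_of_mul_le_mul_right (by linarith) hpos

/-- Weyl's inequality. -/
theorem abs_eig_sub_eig_le {A B : F →L[ℂ] F} (hA : IsSelfAdjoint A) (hB : IsSelfAdjoint B)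
    (i : Fin (finrank ℂ F)) : |eig A i - eig B i| ≤ ‖A - B‖ := by
  have h1 := eig_le_eig_add hA hB i
  have h2 := eig_le_eig_add hB hA i
  rw [norm_sub_rev] at h2
  exact abs_sub_le_iff.2 ⟨by linarith, by linarith⟩

/-- A lower bound for the Sylvester operator in terms of the spectral gap. -/
theorem le_norm_sylvester {A : F →L[ℂ] F} {B : G →L[ℂ] G} (hA : IsSelfAdjoint A)
    (hB : IsSelfAdjoint B) {c ψ : ℝ} (hψ : 0 ≤ ψ)
    (h : ∀ i j, √(min (finrank ℂ F : ℝ) (finrank ℂ G)) * ψ ≤ |c + eig A i - eig B j|)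
    (X : G →L[ℂ] F) : ψ * ‖X‖ ≤ ‖(c : ℂ) • X + A ∘L X - X ∘L B‖ := by
  obtain ⟨u, hu⟩ := exists_eigenbasis hA
  obtain ⟨v, hv⟩ := exists_eigenbasis hB
  set Y := (c : ℂ) • X + A ∘L X - X ∘L B with hY
  rcases Nat.eq_zero_or_pos (finrank ℂ F) with hF | hF
  · have := finrank_zero_iff.1 hF
    have : X = 0 := by ext x; exact Subsingleton.elim _ _
    simp [this]
  rcases Nat.eq_zero_or_pos (finrank ℂ G) with hG | hG
  · have := finrank_zero_iff.1 hG
    have : X = 0 := by ext x; rw [Subsingleton.elim x 0]; simp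
    simp [this]
  have hmin : 0 < min (finrank ℂ F : ℝ) (finrank ℂ G) := by simp [hF, hG]
  -- In eigenbases the Sylvester operator multiplies each matrix entry by its divisor, so the bound
  -- is immediate in the Hilbert–Schmidt norm.
  have hentry : ∀ i j, inner ℂ (u i) (Y (v j)) =
      ((c + eig A i - eig B j : ℝ) : ℂ) * inner ℂ (u i) (X (v j)) := fun i j => by
    have h1 : inner ℂ (u i) (A (X (v j))) = (eig A i : ℂ) * inner ℂ (u i) (X (v j)) := by
      rw [← ContinuousLinearMap.coe_coe A, ← hA.isSymmetric (u i) (X (v j)),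
        ContinuousLinearMap.coe_coe, hu i, inner_smul_left, Complex.conj_ofReal]
    simp only [hY, sub_apply, add_apply, smul_apply, comp_apply, hv, map_smul, inner_sub_right,
      inner_add_right, inner_smul_right, h1]
    push_cast
    ring
  -- Returning to the operator norm costs the square root of a dimension. Counting over a basis of
  -- `G`, or over one of `F` through the adjoint, makes it the smaller one.
  have hYle : ∑ j, ∑ i, ‖inner ℂ (u i) (Y (v j))‖ ^ 2 ≤
      min (finrank ℂ F : ℝ) (finrank ℂ G) * ‖Y‖ ^ 2 := by
    rw [min_mul_of_nonneg _ _ (by positivity)]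
    refine le_min ?_ ?_
    · have h1 : ∑ j, ∑ i, ‖inner ℂ (u i) (Y (v j))‖ ^ 2 =
          ∑ i, ∑ j, ‖inner ℂ (v j) (adjoint Y (u i))‖ ^ 2 := by
        rw [Finset.sum_comm]
        refine Finset.sum_congr rfl fun i _ => Finset.sum_congr rfl fun j _ => ?_
        rw [adjoint_inner_right, ← inner_conj_symm, RCLike.norm_conj]
      rw [h1, sum_norm_sq_apply_eq]
      refine (sum_norm_sq_apply_le u _).trans ?_
      rw [LinearIsometryEquiv.norm_map]
    · rw [sum_norm_sq_apply_eq]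
      exact sum_norm_sq_apply_le v _
  have hXle : min (finrank ℂ F : ℝ) (finrank ℂ G) * ψ ^ 2 * ‖X‖ ^ 2 ≤
      ∑ j, ∑ i, ‖inner ℂ (u i) (Y (v j))‖ ^ 2 := by
    refine (mul_le_mul_of_nonneg_left (norm_sq_le_sum v X) (by positivity)).trans ?_
    rw [← sum_norm_sq_apply_eq u, Finset.mul_sum]
    refine Finset.sum_le_sum fun j _ => ?_
    rw [Finset.mul_sum]
    refine Finset.sum_le_sum fun i _ => ?_
    rw [hentry, norm_mul, mul_pow]
    gcongr
    rw [Complex.norm_real, Real.norm_eq_abs]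
    have := pow_le_pow_left₀ (by positivity) (h i j) 2
    rwa [mul_pow, Real.sq_sqrt hmin.le] at this
  have h1 := hXle.trans hYle
  rw [mul_assoc, mul_le_mul_iff_right₀ hmin, ← mul_pow] at h1
  exact (pow_le_pow_iff_left₀ (by positivity) (by positivity) two_ne_zero).1 h1

end FiniteDim

end Floquet
end

noncomputable section

namespace Floquet

/-! ### Removal of resonant frequencies -/

section Resonance

open Module

variable {E : Type*} [NormedAddCommGroup E] [InnerProductSpace ℂ E] [CompleteSpace E]

instance (H : Hamiltonian E) (m : ℕ) : CompleteSpace (H.level m) := FiniteDimensional.complete ℂ _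

/-- An expanding function with values in `[-δ, δ]` forces the diameter of its domain to be at most
`2δ/a`. The measurable hull is taken because no measurability in `ω` is known. -/
theorem exists_measurableSet_superset_of_expanding {S : Set ℝ} {f : ℝ → ℝ} {a δ : ℝ} (ha : 0 < a)
    (hf : ∀ x ∈ S, ∀ y ∈ S, a * |x - y| ≤ |f x - f y|) (hS : ∀ x ∈ S, |f x| ≤ δ) :
    ∃ T, S ⊆ T ∧ MeasurableSet T ∧ volume T ≤ ENNReal.ofReal (2 * δ / a) := by
  refine ⟨toMeasurable volume S, subset_toMeasurable _ _, measurableSet_toMeasurable _ _, ?_⟩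
  rw [measure_toMeasurable]
  refine (Real.volume_le_diam S).trans (Metric.ediam_le fun x hx y hy => ?_)
  rw [edist_dist]
  refine ENNReal.ofReal_le_ofReal ?_
  rw [Real.dist_eq, le_div_iff₀ ha, mul_comm]
  refine (hf x hx y hy).trans ((abs_sub _ _).trans ?_)
  linarith [hS x hx, hS y hy]

-- With `N = ⌈a⌉` the sum runs over at most `3N + 1 ≤ 4N` integers, each contributing at most `c/N`.
open Classical in
theorem tsum_inv_le_four {a : ℝ} (ha : 0 < a) (c : ℝ≥0∞) :
    ∑' k : ℕ, (if 1 ≤ k ∧ a ≤ k ∧ k ≤ 4 * a then c * ENNReal.ofReal (1 / k) else 0) ≤ 4 * c := by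
  set N := ⌈a⌉₊ with hN
  have hN1 : 1 ≤ N := Nat.one_le_iff_ne_zero.2 (Nat.ceil_pos.2 ha).ne'
  have hsupp : ∀ k ∉ Finset.Icc N (4 * N), (if 1 ≤ k ∧ a ≤ k ∧ (k : ℝ) ≤ 4 * a then
      c * ENNReal.ofReal (1 / k) else 0) = 0 := fun k hk => by
    rw [if_neg]
    rintro ⟨-, h2, h3⟩
    refine hk (Finset.mem_Icc.2 ⟨Nat.ceil_le.2 h2, ?_⟩)
    have : (k : ℝ) ≤ 4 * N := h3.trans (by have := Nat.le_ceil a; linarith)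
    exact_mod_cast this
  rw [tsum_eq_sum hsupp]
  calc _ ≤ ∑ k ∈ Finset.Icc N (4 * N), c * ENNReal.ofReal (1 / N) := by
        refine Finset.sum_le_sum fun k hk => ?_
        split_ifs
        · gcongr
          exact (Finset.mem_Icc.1 hk).1
        · simp
    _ = (4 * N + 1 - N : ℕ) * (c * ENNReal.ofReal (1 / N)) := by
        simp [Finset.sum_const, Nat.card_Icc]
    _ ≤ (4 * N : ℕ) * (c * ENNReal.ofReal (1 / N)) := by
        gcongr
        omega
    _ = 4 * c := by
        have hN0 : (N : ℝ≥0∞) ≠ 0 := by exact_mod_cast (by omega : N ≠ 0)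
        rw [one_div, ENNReal.ofReal_inv_of_pos (by exact_mod_cast hN1), ENNReal.ofReal_natCast]
        push_cast
        rw [mul_mul_mul_comm, ENNReal.mul_inv_cancel hN0 (by simp), mul_one]

/-- On the frequency window `ωK` lies between `(8/9) JK` and `(9/8) JK`. If `Δ` is at most `J/2` or
below `JK/2`, the distance is at least `8/9 - 1/2 = 7/18` of `JK`; if `Δ` exceeds `2JK`, it is even
larger. -/
theorem le_abs_of_nonresonant {J ω K Δ : ℝ} (hω : ω ∈ frequencies J) (hJ : 0 < J) (hK : 1 ≤ K)
    (h : ¬(J / 2 < Δ ∧ Δ ≤ 2 * J * K ∧ J * K ≤ 2 * Δ)) : 7 / 18 * J * K ≤ |ω * K - Δ| := by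
  obtain ⟨h1, h2⟩ := hω
  have h3 : 8 / 9 * J * K ≤ ω * K := by gcongr
  have h4 : ω * K ≤ 9 / 8 * J * K := by gcongr
  have h5 : J ≤ J * K := le_mul_of_one_le_right hJ.le hK
  have h6 : 0 < J * K := by positivity
  rw [le_abs]
  by_cases c1 : J / 2 < Δ
  · by_cases c2 : Δ ≤ 2 * J * K
    · left
      have : ¬ J * K ≤ 2 * Δ := fun c3 => h ⟨c1, c2, c3⟩
      linarith
    · right; linarith
  · left; linarith

variable (H : Hamiltonian E)

theorem gap_le_abs_diff {n m : ℕ} (h : n ≠ m) : H.gap ≤ |H.h n - H.h m| :=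
  ciInf_le (f := fun p : {p : ℕ × ℕ // p.1 ≠ p.2} => |H.diff p.1.1 p.1.2|)
    ⟨0, by rintro _ ⟨p, rfl⟩; positivity⟩ ⟨(n, m), h⟩

/-- After removal of a set of small measure, all Sylvester operators
`X ↦ (ω k + h n - h m) X + D n X - X D m` satisfy a lower bound. -/
theorem exists_nonresonant_subset {J σ d A : ℝ} (hJ : 0 < J) (hA : 0 ≤ A) (hσ : 0 < σ) {Ω : Set ℝ}
    (hΩ : Ω ⊆ frequencies J) (hΩm : MeasurableSet Ω)
    (D : ℝ → ∀ n, H.level n →L[ℂ] H.level n) (hD : ∀ ω ∈ Ω, ∀ n, IsSelfAdjoint (D ω n))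
    (hd : ∀ ω ∈ Ω, ∀ n, ‖D ω n‖ ≤ d)
    (hL : ∀ ω ∈ Ω, ∀ ω' ∈ Ω, ∀ n, ‖D ω n - D ω' n‖ ≤ 1 / 4 * |ω - ω'|)
    {g : ℕ → ℝ} (hg : ∀ k, 0 ≤ g k) (hg0 : 2 * d + g 0 ≤ H.gap)
    (hg1 : ∀ k : ℕ, 1 ≤ k → 2 * d + g k ≤ 7 / 18 * J * k)
    (hg2 : ∀ k : ℕ, 1 ≤ k → g k ≤ A * (k : ℝ) ^ (-σ)) :
    ∃ Ω' ⊆ Ω, MeasurableSet Ω' ∧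
      volume (Ω \ Ω') ≤ ENNReal.ofReal (16 * A * 2 ^ σ) * H.gapSum σ J ∧
      ∀ ω ∈ Ω', ∀ (k : ℤ) (n m : ℕ), (k ≠ 0 ∨ n ≠ m) → ∀ X : H.level m →L[ℂ] H.level n,
        g k.natAbs * ‖X‖ ≤ ‖sylvester (ω * k + H.h n - H.h m) (D ω n) (D ω m) X‖ := by
  classical
  -- Only these triples can resonate. For a given `Δ` they confine `k` to `[Δ/(2J), 2Δ/J]`, which
  -- makes the sum over `k` bounded.
  let res : ℕ → ℕ → ℕ → Prop := fun n m k =>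
    J / 2 < H.diff n m ∧ 1 ≤ k ∧ H.diff n m ≤ 2 * J * k ∧ J * k ≤ 2 * H.diff n m
  let δ : ℕ → ℕ → ℕ → ℝ := fun n m k => √(min (H.mult n : ℝ) (H.mult m)) * g k
  let f : ∀ n m : ℕ, ℕ → Fin (finrank ℂ (H.level n)) → Fin (finrank ℂ (H.level m)) → ℝ → ℝ :=
    fun n m k p q ω => H.diff n m - ω * k + eig (D ω n) p - eig (D ω m) q
  have hT : ∀ n m k p q, ∃ T : Set ℝ, (res n m k → {ω ∈ Ω | |f n m k p q ω| ≤ δ n m k} ⊆ T) ∧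
      MeasurableSet T ∧ volume T ≤ if res n m k then ENNReal.ofReal (4 * δ n m k / k) else 0 := by
    intro n m k p q
    by_cases hr : res n m k
    · have hk : (1 : ℝ) ≤ k := by exact_mod_cast hr.2.1
      -- The slope in `ω` is `-k` up to two eigenvalue terms of Lipschitz constant `1/4` each, so `k
      -- ≥ 1` leaves expansion at least `k/2`.
      have hexp : ∀ x ∈ {ω ∈ Ω | |f n m k p q ω| ≤ δ n m k},
          ∀ y ∈ {ω ∈ Ω | |f n m k p q ω| ≤ δ n m k},
          (k / 2 : ℝ) * |x - y| ≤ |f n m k p q x - f n m k p q y| := fun x hx y hy => by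
        have e1 := (abs_eig_sub_eig_le (hD x hx.1 n) (hD y hy.1 n) p).trans (hL x hx.1 y hy.1 n)
        have e2 := (abs_eig_sub_eig_le (hD x hx.1 m) (hD y hy.1 m) q).trans (hL x hx.1 y hy.1 m)
        have e3 : (x - y) * k = (eig (D x n) p - eig (D y n) p) - (eig (D x m) q - eig (D y m) q)
            - (f n m k p q x - f n m k p q y) := by simp only [f]; ring
        have e4 : |x - y| * k ≤ 1 / 4 * |x - y| + 1 / 4 * |x - y| +
            |f n m k p q x - f n m k p q y| := by
          rw [← abs_of_pos (zero_lt_one.trans_le hk), ← abs_mul, e3]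
          exact (abs_sub _ _).trans (by gcongr; exact (abs_sub _ _).trans (by gcongr))
        have e5 : |x - y| ≤ |x - y| * k := le_mul_of_one_le_right (abs_nonneg _) hk
        linarith
      obtain ⟨T, h1, h2, h3⟩ := exists_measurableSet_superset_of_expanding
        (δ := δ n m k) (by positivity) hexp (fun x hx => hx.2)
      refine ⟨T, fun _ => h1, h2, h3.trans ?_⟩
      rw [if_pos hr]
      refine ENNReal.ofReal_le_ofReal (le_of_eq ?_)
      field_simp
      ring
    · exact ⟨∅, fun h => absurd h hr, MeasurableSet.empty, by simp⟩
  choose T hT1 hT2 hT3 using hT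
  set B : Set ℝ := ⋃ n, ⋃ m, ⋃ k, ⋃ p, ⋃ q, T n m k p q with hB
  refine ⟨Ω \ B, sdiff_subset, hΩm.diff ?_, ?_, ?_⟩
  · exact .iUnion fun n => .iUnion fun m => .iUnion fun k => .iUnion fun p => .iUnion fun q =>
      hT2 n m k p q
  · have hle : volume (Ω \ (Ω \ B)) ≤ ∑' n, ∑' m, ∑' k : ℕ,
        if res n m k then ENNReal.ofReal (4 * H.mu n m * g k / k) else 0 := by
      refine (measure_mono (show Ω \ (Ω \ B) ⊆ B from fun x hx => by
        by_contra h; exact hx.2 ⟨hx.1, h⟩)).trans ?_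
      refine (measure_iUnion_le _).trans (ENNReal.tsum_le_tsum fun n => ?_)
      refine (measure_iUnion_le _).trans (ENNReal.tsum_le_tsum fun m => ?_)
      refine (measure_iUnion_le _).trans (ENNReal.tsum_le_tsum fun k => ?_)
      refine (measure_iUnion_le _).trans ((ENNReal.tsum_le_tsum fun p =>
        (measure_iUnion_le _).trans (ENNReal.tsum_le_tsum fun q => hT3 n m k p q)).trans ?_)
      -- Each pair of eigenvalues costs `4 √min(M_n, M_m) g_k / k`; the `M_n M_m` pairs together
      -- produce the factor `μ_{nm}`.
      split_ifs with hr
      · rw [tsum_fintype, tsum_fintype]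
        simp only [Finset.sum_const, Finset.card_univ, Fintype.card_fin, nsmul_eq_mul]
        rw [← ENNReal.ofReal_natCast, ← ENNReal.ofReal_natCast,
          ← ENNReal.ofReal_mul (by positivity), ← ENNReal.ofReal_mul (by positivity)]
        refine ENNReal.ofReal_le_ofReal (le_of_eq ?_)
        simp only [δ, Hamiltonian.mu, Hamiltonian.mult]
        ring
      · simp
    refine hle.trans ?_
    rw [Hamiltonian.gapSum, ← mul_assoc, ← ENNReal.tsum_mul_left]
    refine ENNReal.tsum_le_tsum fun n => ?_
    rw [← ENNReal.tsum_mul_left]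
    refine ENNReal.tsum_le_tsum fun m => ?_
    by_cases hΔ : J / 2 < H.diff n m
    · rw [if_pos hΔ]
      set Δ := H.diff n m
      have hΔ0 : 0 < Δ := by linarith
      have hmu : 0 ≤ H.mu n m := by unfold Hamiltonian.mu; positivity
      have ha : 0 < Δ / (2 * J) := by positivity
      -- As `k ≥ Δ/(2J)` on the support, `k^{-σ}` is at most `(Δ/(2J))^{-σ}`. The sum of `1/k` over
      -- the support costs a factor `4`, hence `16 · 2^σ` in total.
      set c := 4 * H.mu n m * A * (Δ / (2 * J)) ^ (-σ) with hc
      calc _ ≤ ∑' k : ℕ, (if 1 ≤ k ∧ Δ / (2 * J) ≤ k ∧ k ≤ 4 * (Δ / (2 * J)) then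
            ENNReal.ofReal c * ENNReal.ofReal (1 / k) else 0) := by
            refine ENNReal.tsum_le_tsum fun k => ?_
            split_ifs with h1 h2 h2
            · rw [← ENNReal.ofReal_mul (by positivity)]
              refine ENNReal.ofReal_le_ofReal ?_
              have hk : (0 : ℝ) < k := by exact_mod_cast h2.1
              have h3 : g k ≤ A * (Δ / (2 * J)) ^ (-σ) := (hg2 k h2.1).trans (by
                gcongr ?_ * ?_
                exact Real.rpow_le_rpow_of_nonpos ha h2.2.1 (by linarith))
              rw [mul_one_div]
              gcongr
              rw [hc, mul_assoc (4 * H.mu n m)]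
              gcongr
            · refine absurd ⟨h1.2.1, ?_, ?_⟩ h2
              · rw [div_le_iff₀ (by positivity)]; linarith [h1.2.2.1]
              · rw [mul_div_assoc', le_div_iff₀ (by positivity)]; linarith [h1.2.2.2]
            · simp
            · simp
        _ ≤ 4 * ENNReal.ofReal c := tsum_inv_le_four ha _
        _ = _ := by
            rw [← ENNReal.ofReal_ofNat 4, ← ENNReal.ofReal_mul (by positivity),
              ← ENNReal.ofReal_mul (by positivity), ← ENNReal.ofReal_mul (by positivity)]
            congr 1
            rw [hc, Real.rpow_neg ha.le, Real.div_rpow hΔ0.le (by positivity),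
              Real.mul_rpow (by positivity) hJ.le]
            have : H.diff n m ^ σ ≠ 0 := (Real.rpow_pos_of_pos hΔ0 σ).ne'
            simp only [Δ]
            field_simp
            ring
    · simp [res, hΔ]
  · rintro ω ⟨hω, hωB⟩ k n m hne X
    have hmem : ∀ n m k p q, res n m k → δ n m k ≤ |f n m k p q ω| := fun n m k p q hr => by
      by_contra! h
      refine hωB ?_
      simp only [hB, mem_iUnion]
      exact ⟨n, m, k, p, q, hT1 n m k p q hr ⟨hω, h.le⟩⟩
    have htriv : ∀ x : ℝ, 2 * d + x ≤ |ω * k + H.h n - H.h m| →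
        x * ‖X‖ ≤ ‖sylvester (ω * k + H.h n - H.h m) (D ω n) (D ω m) X‖ := fun x hx => by
      refine le_trans ?_ (le_norm_sylvester_of_norm _ _ _ _)
      gcongr
      linarith [hd ω hω n, hd ω hω m]
    -- A negative `k` resonates with the pair `(n, m)` and a positive one with `(m, n)`, up to an
    -- overall sign. For `k = 0` the gap of `H` suffices.
    rcases lt_trichotomy k 0 with hk | rfl | hk
    · have hK : 1 ≤ k.natAbs := by omega
      have hK' : (k : ℝ) = -(k.natAbs : ℝ) := by
        rw [Nat.cast_natAbs, abs_of_neg hk]; push_cast; ring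
      by_cases hr : res n m k.natAbs
      · refine le_norm_sylvester (hD ω hω n) (hD ω hω m) (hg _) (fun p q => ?_) X
        refine (hmem n m _ p q hr).trans (le_of_eq ?_)
        simp only [f, Hamiltonian.diff]
        congr 1
        rw [hK']; ring
      · refine htriv _ ((hg1 _ hK).trans ?_)
        have := le_abs_of_nonresonant (Δ := H.diff n m) (hΩ hω) hJ
          (K := k.natAbs) (by exact_mod_cast hK) (fun h => hr ⟨h.1, hK, h.2⟩)
        refine this.trans (le_of_eq ?_)
        rw [← abs_neg, Hamiltonian.diff, hK']; congr 1; ring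
    · have hnm : n ≠ m := by simpa using hne
      refine htriv _ ?_
      simpa using hg0.trans (gap_le_abs_diff H hnm)
    · have hK : 1 ≤ k.natAbs := by omega
      have hK' : (k : ℝ) = (k.natAbs : ℝ) := by
        rw [Nat.cast_natAbs, abs_of_pos hk]
      by_cases hr : res m n k.natAbs
      · refine le_norm_sylvester (hD ω hω n) (hD ω hω m) (hg _) (fun p q => ?_) X
        rw [min_comm]
        refine (hmem m n _ q p hr).trans (le_of_eq ?_)
        simp only [f, Hamiltonian.diff]
        rw [← abs_neg]
        congr 1
        rw [hK']; ring
      · refine htriv _ ((hg1 _ hK).trans ?_)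
        have := le_abs_of_nonresonant (Δ := H.diff m n) (hΩ hω) hJ
          (K := k.natAbs) (by exact_mod_cast hK) (fun h => hr ⟨h.1, hK, h.2⟩)
        refine this.trans (le_of_eq ?_)
        rw [Hamiltonian.diff, hK']; congr 1; ring

end Resonance

end Floquet
end

noncomputable section

namespace Floquet

/-! ### Exponential weights and the homological equation -/

/-- The weight `exp (x |k - l|)`. -/
def expWeight (x : ℝ) (i j : ℤ × ℕ) : ℝ≥0∞ := ENNReal.ofReal (Real.exp (x * (i.1 - j.1).natAbs))

theorem expWeight_self (x : ℝ) (i : ℤ × ℕ) : expWeight x i i ≤ 1 := by simp [expWeight]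

theorem one_le_expWeight {x : ℝ} (hx : 0 ≤ x) (i j : ℤ × ℕ) : 1 ≤ expWeight x i j := by
  rw [expWeight, ENNReal.one_le_ofReal]
  exact Real.one_le_exp (by positivity)

theorem expWeight_le_mul {x : ℝ} (hx : 0 ≤ x) (i l j : ℤ × ℕ) :
    expWeight x i j ≤ expWeight x i l * expWeight x l j := by
  unfold expWeight
  rw [← ENNReal.ofReal_mul (by positivity), ← Real.exp_add, ← mul_add]
  gcongr
  have : (i.1 - j.1).natAbs ≤ (i.1 - l.1).natAbs + (l.1 - j.1).natAbs := by omega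
  exact_mod_cast this

theorem expWeight_mono {x y : ℝ} (hxy : x ≤ y) (i j : ℤ × ℕ) : expWeight x i j ≤ expWeight y i j := by
  unfold expWeight
  gcongr

theorem enorm_le_of_mul_norm_le {F F' : Type*} [NormedAddCommGroup F] [NormedAddCommGroup F']
    {g : ℝ} (hg : 0 < g) {x : F} {y : F'} (h : g * ‖x‖ ≤ ‖y‖) : ‖x‖ₑ ≤ ENNReal.ofReal (1 / g) * ‖y‖ₑ := by
  rw [← ofReal_norm, ← ofReal_norm, ← ENNReal.ofReal_mul (by positivity)]
  refine ENNReal.ofReal_le_ofReal ?_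
  rw [one_div, inv_mul_eq_div, le_div_iff₀ hg, mul_comm]
  exact h

section Homological

variable {F G : Type*} [NormedAddCommGroup F] [InnerProductSpace ℂ F] [NormedAddCommGroup G]
  [InnerProductSpace ℂ G]

/-- The solution of a Sylvester equation depends on parameters in a Lipschitz way. -/
theorem ell_sylvester_solution_le {Ω : Set ℝ} {lam : ℝ → ℝ} {A : ℝ → F →L[ℂ] F} {B : ℝ → G →L[ℂ] G}
    {X O : ℝ → G →L[ℂ] F} {g K φ φ' : ℝ} (hg : 0 < g) (hφ' : 0 ≤ φ') (hφ : φ' ≤ φ) (hK : 0 ≤ K)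
    (hlow : ∀ ω ∈ Ω, ∀ Z, g * ‖Z‖ ≤ ‖sylvester (lam ω) (A ω) (B ω) Z‖)
    (hX : ∀ ω ∈ Ω, sylvester (lam ω) (A ω) (B ω) (X ω) = (1 / 2 : ℂ) • O ω)
    (hlam : ∀ ω ∈ Ω, ∀ ω' ∈ Ω, |lam ω - lam ω'| ≤ K * |ω - ω'|)
    (hA : ∀ ω ∈ Ω, ∀ ω' ∈ Ω, ‖A ω - A ω'‖ ≤ 1 / 4 * |ω - ω'|)
    (hB : ∀ ω ∈ Ω, ∀ ω' ∈ Ω, ‖B ω - B ω'‖ ≤ 1 / 4 * |ω - ω'|) :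
    ell Ω (ENNReal.ofReal φ') X ≤
      ENNReal.ofReal (1 / 2 * (1 / g + φ' * (K + 1 / 2) / g ^ 2)) * ell Ω (ENNReal.ofReal φ) O := by
  set s := supNorm Ω O
  set L := lipNorm Ω O
  have hhalf : ∀ Z : G →L[ℂ] F, ‖(1 / 2 : ℂ) • Z‖ₑ = ENNReal.ofReal (1 / 2) * ‖Z‖ₑ := fun Z => by
    rw [enorm_smul, ← ofReal_norm]; norm_num
  have h1 : ∀ ω ∈ Ω, ‖X ω‖ₑ ≤ ENNReal.ofReal (1 / 2 * (1 / g)) * s := fun ω hω => by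
    have h := enorm_le_of_mul_norm_le hg (hlow ω hω (X ω))
    rw [hX ω hω, hhalf, ← mul_assoc, ← ENNReal.ofReal_mul (by positivity), mul_comm (1 / g)] at h
    exact h.trans (by gcongr; exact enorm_le_supNorm hω)
  have h2 : ∀ ω ∈ Ω, ∀ ω' ∈ Ω, ‖X ω - X ω'‖ₑ ≤ (ENNReal.ofReal (1 / 2 * (1 / g)) * L +
      ENNReal.ofReal (1 / 2 * ((K + 1 / 2) / g ^ 2)) * s) * ‖ω - ω'‖ₑ := by
    intro ω hω ω' hω'
    -- `R` is the change of the Sylvester operator applied to `X ω'`. Thus `X ω - X ω'` again solves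
    -- a Sylvester equation at `ω`, and a second division by `g` gives the term in `1/g²`.
    set R := ((lam ω - lam ω' : ℝ) : ℂ) • X ω' + (A ω - A ω') ∘L X ω' - X ω' ∘L (B ω - B ω') with hR
    have e : sylvester (lam ω) (A ω) (B ω) (X ω - X ω') = (1 / 2 : ℂ) • (O ω - O ω') - R := by
      rw [smul_sub, ← hX ω hω, ← hX ω' hω', map_sub, hR]
      simp only [sylvester_apply, ContinuousLinearMap.sub_comp, ContinuousLinearMap.comp_sub]
      push_cast
      rw [sub_smul]
      abel
    have hRn : ‖R‖ ≤ ((K + 1 / 2) * |ω - ω'|) * ‖X ω'‖ := by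
      calc ‖R‖ ≤ ‖((lam ω - lam ω' : ℝ) : ℂ) • X ω'‖ + ‖(A ω - A ω') ∘L X ω'‖ +
            ‖X ω' ∘L (B ω - B ω')‖ := (norm_sub_le _ _).trans (by gcongr; exact norm_add_le _ _)
        _ ≤ (K * |ω - ω'|) * ‖X ω'‖ + (1 / 4 * |ω - ω'|) * ‖X ω'‖ +
            ‖X ω'‖ * (1 / 4 * |ω - ω'|) := by
            gcongr
            · rw [norm_smul, Complex.norm_real, Real.norm_eq_abs]
              gcongr
              exact hlam ω hω ω' hω'
            · exact (ContinuousLinearMap.opNorm_comp_le _ _).trans (by gcongr; exact hA ω hω ω' hω')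
            · exact (ContinuousLinearMap.opNorm_comp_le _ _).trans (by gcongr; exact hB ω hω ω' hω')
        _ = _ := by ring
    have hRe : ‖R‖ₑ ≤ ENNReal.ofReal (K + 1 / 2) * ‖ω - ω'‖ₑ * ‖X ω'‖ₑ := by
      rw [← ofReal_norm, ← ofReal_norm, ← ofReal_norm, ← ENNReal.ofReal_mul (by positivity),
        ← ENNReal.ofReal_mul (by positivity)]
      exact ENNReal.ofReal_le_ofReal hRn
    have h := enorm_le_of_mul_norm_le hg (hlow ω hω (X ω - X ω'))
    rw [e] at h
    calc _ ≤ ENNReal.ofReal (1 / g) * (‖(1 / 2 : ℂ) • (O ω - O ω')‖ₑ + ‖R‖ₑ) :=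
          h.trans (by gcongr; exact enorm_sub_le)
      _ ≤ ENNReal.ofReal (1 / g) * (ENNReal.ofReal (1 / 2) * (L * ‖ω - ω'‖ₑ) +
          ENNReal.ofReal (K + 1 / 2) * ‖ω - ω'‖ₑ * (ENNReal.ofReal (1 / 2 * (1 / g)) * s)) := by
          gcongr
          · rw [hhalf]; gcongr; exact enorm_sub_le_lipNorm hω hω'
          · exact hRe.trans (by gcongr; exact h1 ω' hω')
      _ = (ENNReal.ofReal (1 / g) * ENNReal.ofReal (1 / 2) * L + ENNReal.ofReal (1 / g) *
          ENNReal.ofReal (K + 1 / 2) * ENNReal.ofReal (1 / 2 * (1 / g)) * s) * ‖ω - ω'‖ₑ := by ring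
      _ = _ := by
          rw [← ENNReal.ofReal_mul (by positivity), ← ENNReal.ofReal_mul (by positivity),
            ← ENNReal.ofReal_mul (by positivity)]
          congr 4 <;> [ring; (field_simp)]
  refine (ell_le h1 h2).trans ?_
  have e3 : ENNReal.ofReal (1 / 2 * (1 / g + φ' * (K + 1 / 2) / g ^ 2)) =
      ENNReal.ofReal (1 / 2 * (1 / g)) +
        ENNReal.ofReal φ' * ENNReal.ofReal (1 / 2 * ((K + 1 / 2) / g ^ 2)) := by
    rw [← ENNReal.ofReal_mul hφ', ← ENNReal.ofReal_add (by positivity) (by positivity)]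
    congr 1; ring
  rw [e3]
  change _ ≤ _ * (s + ENNReal.ofReal φ * L)
  set a := ENNReal.ofReal (1 / 2 * (1 / g))
  set b := ENNReal.ofReal (1 / 2 * ((K + 1 / 2) / g ^ 2))
  calc a * s + ENNReal.ofReal φ' * (a * L + b * s)
      = (a + ENNReal.ofReal φ' * b) * s + a * (ENNReal.ofReal φ' * L) := by ring
    _ ≤ (a + ENNReal.ofReal φ' * b) * s + (a + ENNReal.ofReal φ' * b) * (ENNReal.ofReal φ * L) := by
        gcongr
        exact le_self_add
    _ = _ := by ring

end Homological

/-! ### The homological equation for Toeplitz block matrices -/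

section HomologicalBlock

variable {G : ℕ → Type*} [∀ n, NormedAddCommGroup (G n)] [∀ n, InnerProductSpace ℂ (G n)]
  [∀ n, CompleteSpace (G n)]

theorem isSelfAdjoint_block_diag {X : SeqSpace G →L[ℂ] SeqSpace G} (hX : IsSelfAdjoint X)
    (i : ℤ × ℕ) : IsSelfAdjoint (block X i i) := by
  rw [isSelfAdjoint_iff, ContinuousLinearMap.star_eq_adjoint]
  exact (block_star X i i).symm.trans (by rw [hX.star_eq])

variable [∀ n, FiniteDimensional ℂ (G n)]

/-- The diagonal part of the unperturbed Floquet operator. -/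
def modeEnergy (h : ℕ → ℝ) (ω : ℝ) (i : ℤ × ℕ) : ℝ := ω * i.1 + h i.2

/-- Solution of `[K + D, B] = O / 2` with a quantitative bound. -/
theorem exists_homological_solution (h : ℕ → ℝ) {Ω : Set ℝ} {D O : ℝ → SeqSpace G →L[ℂ] SeqSpace G}
    (hDs : ∀ ω ∈ Ω, IsSelfAdjoint (D ω)) (hOs : ∀ ω ∈ Ω, IsSelfAdjoint (O ω))
    (hDt : ∀ ω ∈ Ω, IsToeplitz (D ω)) (hOt : ∀ ω ∈ Ω, IsToeplitz (O ω))
    (hDd : ∀ ω ∈ Ω, ∀ i j, i ≠ j → block (D ω) i j = 0) (hOd : ∀ ω ∈ Ω, ∀ i, block (O ω) i i = 0)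
    (hDL : ∀ ω ∈ Ω, ∀ ω' ∈ Ω, ∀ i, ‖block (D ω) i i - block (D ω') i i‖ ≤ 1 / 4 * |ω - ω'|)
    {γ c x x' φ : ℝ} (hγ : 0 < γ) (hc : 0 ≤ c) (hx' : 0 ≤ x') (hx : x = x' + 2 * c) (hφ : γ ≤ φ)
    (hlow : ∀ ω ∈ Ω, ∀ i j : ℤ × ℕ, i ≠ j → ∀ Z : G j.2 →L[ℂ] G i.2,
      γ * √(max 1 ((i.1 - j.1).natAbs : ℝ)) * Real.exp (-(c * (i.1 - j.1).natAbs)) * ‖Z‖ ≤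
        ‖sylvester (modeEnergy h ω i - modeEnergy h ω j) (block (D ω) i i) (block (D ω) j j) Z‖)
    (hfin : rowNorm Ω (ENNReal.ofReal φ) (expWeight x) O ≠ ⊤) :
    ∃ B : ℝ → SeqSpace G →L[ℂ] SeqSpace G,
      (∀ ω ∈ Ω, star (B ω) = -B ω) ∧ (∀ ω ∈ Ω, IsToeplitz (B ω)) ∧
      (∀ ω ∈ Ω, IsCommutator (modeEnergy h ω) (B ω)
        ((1 / 2 : ℂ) • O ω - (D ω * B ω - B ω * D ω))) ∧
      rowNorm Ω (ENNReal.ofReal γ) (expWeight x') B ≤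
        ENNReal.ofReal (5 / (4 * γ)) * rowNorm Ω (ENNReal.ofReal φ) (expWeight x) O := by
  classical
  set g : ℤ × ℕ → ℤ × ℕ → ℝ := fun i j =>
    γ * √(max 1 ((i.1 - j.1).natAbs : ℝ)) * Real.exp (-(c * (i.1 - j.1).natAbs)) with hgdef
  have hg : ∀ i j, 0 < g i j := fun i j => by
    have : 0 < max 1 ((i.1 - j.1).natAbs : ℝ) := lt_max_of_lt_left one_pos
    simp only [hgdef]; positivity
  have hex : ∀ (ω : ℝ) (i j : ℤ × ℕ), ∃ Z : G j.2 →L[ℂ] G i.2,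
      (ω ∈ Ω → i ≠ j → sylvester (modeEnergy h ω i - modeEnergy h ω j) (block (D ω) i i)
        (block (D ω) j j) Z = (1 / 2 : ℂ) • block (O ω) i j) ∧ (i = j → Z = 0) := by
    intro ω i j
    by_cases hh : ω ∈ Ω ∧ i ≠ j
    · obtain ⟨Z, hZ⟩ := (sylvester_bijective (hg i j) (hlow ω hh.1 i j hh.2)).2
        ((1 / 2 : ℂ) • block (O ω) i j)
      exact ⟨Z, fun _ _ => hZ, fun e => absurd e hh.2⟩
    · exact ⟨0, fun h1 h2 => absurd ⟨h1, h2⟩ hh, fun _ => rfl⟩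
  choose b hb hb0 using hex
  -- Uniqueness of each block transfers the symmetries of `O` to `B`: the negative adjoint and the
  -- shifted block solve the same equations.
  have huniq : ∀ ω ∈ Ω, ∀ i j, i ≠ j → ∀ Z, sylvester (modeEnergy h ω i - modeEnergy h ω j)
      (block (D ω) i i) (block (D ω) j j) Z = (1 / 2 : ℂ) • block (O ω) i j → Z = b ω i j :=
    fun ω hω i j hij Z hZ => (sylvester_bijective (hg i j) (hlow ω hω i j hij)).1
      (hZ.trans (hb ω i j hω hij).symm)
  have hskew : ∀ ω ∈ Ω, ∀ i j, b ω i j = -ContinuousLinearMap.adjoint (b ω j i) := by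
    intro ω hω i j
    rcases eq_or_ne i j with rfl | hij
    · simp [hb0 ω i i rfl]
    refine (huniq ω hω i j hij _ ?_).symm
    have h1 := congrArg ContinuousLinearMap.adjoint (hb ω j i hω hij.symm)
    have hDi := fun i => (isSelfAdjoint_block_diag (hDs ω hω) i).adjoint_eq
    have hO : ContinuousLinearMap.adjoint (block (O ω) j i) = block (O ω) i j :=
      (block_star (O ω) i j).symm.trans (by rw [(hOs ω hω).star_eq])
    rw [sylvester_apply] at h1 ⊢
    simp only [map_sub, map_add, map_smulₛₗ, ContinuousLinearMap.adjoint_comp, hDi, hO] at h1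
    simp only [Complex.conj_ofReal, map_div₀, map_one, map_ofNat] at h1
    rw [← h1]
    simp only [smul_neg, ContinuousLinearMap.comp_neg, ContinuousLinearMap.neg_comp]
    push_cast
    module
  have hell : ∀ i j, ell Ω (ENNReal.ofReal γ) (fun ω => b ω i j) * expWeight x' i j ≤
      ENNReal.ofReal (5 / (4 * γ)) * (ell Ω (ENNReal.ofReal φ) (fun ω => block (O ω) i j) *
        expWeight x i j) := by
    intro i j
    rcases eq_or_ne i j with rfl | hij
    · have : ell Ω (ENNReal.ofReal γ) (fun ω => b ω i i) ≤ 0 :=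
        (ell_le_of_const (c := 0) fun ω _ => hb0 ω i i rfl).trans (by simp)
      rw [nonpos_iff_eq_zero.1 this, zero_mul]
      exact bot_le
    set K : ℝ := ((i.1 - j.1).natAbs : ℝ) with hK
    have hlam : ∀ ω ∈ Ω, ∀ ω' ∈ Ω, |(modeEnergy h ω i - modeEnergy h ω j) -
        (modeEnergy h ω' i - modeEnergy h ω' j)| ≤ K * |ω - ω'| := fun ω _ ω' _ => by
      rw [hK, Nat.cast_natAbs, Int.cast_abs, ← abs_mul]
      refine le_of_eq (congrArg _ ?_)
      simp only [modeEnergy]; push_cast; ring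
    have h1 := ell_sylvester_solution_le (X := fun ω => b ω i j) (O := fun ω => block (O ω) i j)
      (hg i j) hγ.le hφ (by positivity : 0 ≤ K) (fun ω hω => hlow ω hω i j hij)
      (fun ω hω => hb ω i j hω hij) hlam (fun ω hω ω' hω' => hDL ω hω ω' hω' i)
      (fun ω hω ω' hω' => hDL ω hω ω' hω' j)
    -- The root in the divisor cancels the growth `K + 1/2` of the Lipschitz constant in `ω`. The
    -- constant is `(1/2)(1 + 3/2) = 5/4`, and the two divisions cost at most `e^{2cK}`, absorbed by
    -- `x = x' + 2c`.
    have h2 : 1 / 2 * (1 / g i j + γ * (K + 1 / 2) / g i j ^ 2) ≤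
        5 / (4 * γ) * Real.exp (2 * c * K) := by
      set m := max 1 K with hm
      have hm1 : 1 ≤ m := le_max_left _ _
      have hmK : K ≤ m := le_max_right _ _
      have e1 : 1 ≤ √m := Real.one_le_sqrt.2 hm1
      have e2 : g i j = γ * √m * (Real.exp (c * K))⁻¹ := by simp only [hgdef, Real.exp_neg, hm, hK]
      have e3 : Real.exp (2 * c * K) = Real.exp (c * K) ^ 2 := by
        rw [← Real.exp_nat_mul]; congr 1; push_cast; ring
      have e4 : 1 ≤ Real.exp (c * K) := Real.one_le_exp (by positivity)
      set y := Real.exp (c * K)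
      have e5 : √m ^ 2 = m := Real.sq_sqrt (by positivity)
      have e6 : 1 / g i j ≤ 1 / γ * y ^ 2 := by
        rw [e2, one_div, mul_inv, inv_inv, mul_inv, one_div]
        gcongr ?_ * ?_
        · exact mul_le_of_le_one_right (by positivity) (inv_le_one_of_one_le₀ e1)
        · exact le_self_pow₀ e4 two_ne_zero
      have e7 : γ * (K + 1 / 2) / g i j ^ 2 ≤ 3 / 2 / γ * y ^ 2 := by
        have : γ * (K + 1 / 2) / g i j ^ 2 = (K + 1 / 2) / m / γ * y ^ 2 := by
          rw [e2, mul_pow, mul_pow, e5]; field_simp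
        have : (K + 1 / 2) / m ≤ 3 / 2 := by rw [div_le_iff₀ (by positivity)]; linarith
        rw [‹γ * (K + 1 / 2) / g i j ^ 2 = _›]
        gcongr
      rw [e3]
      calc _ ≤ 1 / 2 * (1 / γ * y ^ 2 + 3 / 2 / γ * y ^ 2) := by gcongr
        _ = _ := by field_simp; norm_num
    have h3 : expWeight x i j = ENNReal.ofReal (Real.exp (2 * c * K)) * expWeight x' i j := by
      unfold expWeight
      rw [← ENNReal.ofReal_mul (by positivity), ← Real.exp_add, hx]
      congr 2; ring
    rw [h3]
    calc _ ≤ ENNReal.ofReal (5 / (4 * γ) * Real.exp (2 * c * K)) *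
          ell Ω (ENNReal.ofReal φ) (fun ω => block (O ω) i j) * expWeight x' i j := by
          gcongr
          exact h1.trans (by gcongr)
      _ = _ := by rw [ENNReal.ofReal_mul (by positivity)]; ring
  have hrow : ∀ i, ∑' j, ell Ω (ENNReal.ofReal γ) (fun ω => b ω i j) * expWeight x' i j ≤
      ENNReal.ofReal (5 / (4 * γ)) * rowNorm Ω (ENNReal.ofReal φ) (expWeight x) O := fun i => by
    refine (ENNReal.tsum_le_tsum (hell i)).trans ?_
    rw [ENNReal.tsum_mul_left]
    gcongr
    exact tsum_le_rowNorm i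
  set C := ENNReal.ofReal (5 / (4 * γ)) * rowNorm Ω (ENNReal.ofReal φ) (expWeight x) O with hC
  have hCtop : C ≠ ⊤ := ENNReal.mul_ne_top (by simp) hfin
  have hrow' : ∀ ω ∈ Ω, ∀ i, ∑' j, ‖b ω i j‖ₑ ≤ C := fun ω hω i => by
    refine (ENNReal.tsum_le_tsum fun j => ?_).trans (hrow i)
    calc ‖b ω i j‖ₑ ≤ ell Ω (ENNReal.ofReal γ) (fun ω => b ω i j) * 1 := by
          rw [mul_one]
          exact (enorm_le_supNorm (f := fun ω => b ω i j) hω).trans supNorm_le_ell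
      _ ≤ _ := by gcongr; exact one_le_expWeight hx' i j
  have hop : ∀ ω, ∃ X : SeqSpace G →L[ℂ] SeqSpace G, ω ∈ Ω → ∀ i j, block X i j = b ω i j := by
    intro ω
    by_cases hω : ω ∈ Ω
    · obtain ⟨X, hX, -⟩ := exists_block_eq (G := fun i : ℤ × ℕ => G i.2) (b ω) C.toNNReal
        (fun i => by rw [ENNReal.coe_toNNReal hCtop]; exact hrow' ω hω i)
        (fun j => by
          rw [ENNReal.coe_toNNReal hCtop]
          refine le_trans (le_of_eq (tsum_congr fun i => ?_)) (hrow' ω hω j)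
          rw [hskew ω hω i j, enorm_neg]
          exact (ContinuousLinearMap.adjoint (𝕜 := ℂ) (E := G i.2) (F := G j.2)).enorm_map _)
      exact ⟨X, fun _ => hX⟩
    · exact ⟨0, fun h => absurd h hω⟩
  choose B hB using hop
  refine ⟨B, fun ω hω => block_ext fun i j => ?_, fun ω hω k l n m => ?_,
    fun ω hω i j => ?_, iSup_le fun i => ?_⟩
  · rw [block_star, block_neg, hB ω hω, hB ω hω, hskew ω hω i j, neg_neg]
  · rw [hB ω hω, hB ω hω]
    by_cases hij : ((k, n) : ℤ × ℕ) = (l, m)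
    · obtain ⟨rfl, rfl⟩ := Prod.mk.inj hij
      rw [hb0 ω (k, n) (k, n) rfl, hb0 ω (k + 1, n) (k + 1, n) rfl]
    · refine huniq ω hω (k, n) (l, m) hij _ ?_
      have hij' : ((k + 1, n) : ℤ × ℕ) ≠ (l + 1, m) := fun e => hij (by simpa using e)
      have := hb ω (k + 1, n) (l + 1, m) hω hij'
      rw [hDt ω hω, hDt ω hω, hOt ω hω] at this
      rw [← this]
      congr 2
      simp only [modeEnergy]; push_cast; ring
  · rw [block_sub, block_sub, block_smul, block_mul_of_diag_left (hDd ω hω),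
      block_mul_of_diag_right (hDd ω hω), hB ω hω]
    rcases eq_or_ne i j with rfl | hij
    · simp [hb0 ω i i rfl, hOd ω hω i]
    · rw [← hb ω i j hω hij, sylvester_apply]
      abel
  · refine le_trans (le_of_eq (tsum_congr fun j => ?_)) (hrow i)
    rw [ell_congr (f := fun ω => block (B ω) i j) (g := fun ω => b ω i j) fun ω hω => hB ω hω i j]

end HomologicalBlock

end Floquet
end

noncomputable section

namespace Floquet

/-! ### Masked block matrices -/

theorem enorm_zero_clm {F F' : Type*} [NormedAddCommGroup F] [NormedSpace ℂ F]
    [NormedAddCommGroup F'] [NormedSpace ℂ F'] : ‖(0 : F →L[ℂ] F')‖ₑ = 0 := by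
  rw [← ofReal_norm, norm_zero, ENNReal.ofReal_zero]

section Mask

variable {I : Type*} [DecidableEq I] {G : I → Type*} [∀ i, NormedAddCommGroup (G i)]
  [∀ i, InnerProductSpace ℂ (G i)]

theorem rowNorm_le_of_block_eq_or {Ω : Set ℝ} {φ : ℝ≥0∞} {w : I → I → ℝ≥0∞}
    {X Y : ℝ → lp G 2 →L[ℂ] lp G 2}
    (h : ∀ i j, (∀ ω ∈ Ω, block (Y ω) i j = block (X ω) i j) ∨ ∀ ω ∈ Ω, block (Y ω) i j = 0) :
    rowNorm Ω φ w Y ≤ rowNorm Ω φ w X := by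
  have := rowNorm_le_of_ell_le (Ω := Ω) (Ω' := Ω) (φ := φ) (φ' := φ) (w := w) (w' := w) (X := Y)
    (Y := X) 1 fun i j => by
      rw [one_mul]
      gcongr
      rcases h i j with h | h
      · rw [ell_congr h]
      · exact (ell_le_of_const h).trans (by rw [enorm_zero_clm]; exact bot_le)
  simpa using this

open Classical in
/-- The block matrix obtained from `X` by keeping only the blocks with `p i j`. -/
def mask (p : I → I → Prop) (X : lp G 2 →L[ℂ] lp G 2) : lp G 2 →L[ℂ] lp G 2 :=
  if h : ∃ Y : lp G 2 →L[ℂ] lp G 2, ∀ i j, block Y i j = if p i j then block X i j else 0 then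
    h.choose else 0

variable [∀ i, CompleteSpace (G i)]

theorem enorm_block_symm {X : lp G 2 →L[ℂ] lp G 2} (hX : IsSelfAdjoint X) (i j : I) :
    ‖block X i j‖ₑ = ‖block X j i‖ₑ := by
  rw [← enorm_block_star, hX.star_eq]

theorem enorm_block_symm_of_skew {X : lp G 2 →L[ℂ] lp G 2} (hX : star X = -X) (i j : I) :
    ‖block X i j‖ₑ = ‖block X j i‖ₑ := by
  rw [← enorm_block_star, hX, block_neg, enorm_neg]

-- The masked matrix is bounded by Schur's test; symmetry of `p` and self-adjointness of `X` supply
-- the column sums. Hence the default value in `mask` does not occur under these hypotheses.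
open Classical in
theorem block_mask {p : I → I → Prop} (hp : ∀ i j, p i j → p j i) {X : lp G 2 →L[ℂ] lp G 2}
    (hX : IsSelfAdjoint X) {C : ℝ≥0∞} (hC : C ≠ ⊤) (h : ∀ i, ∑' j, ‖block X i j‖ₑ ≤ C) (i j : I) :
    block (mask p X) i j = if p i j then block X i j else 0 := by
  have hr : ∀ i, ∑' j, ‖if p i j then block X i j else 0‖ₑ ≤ C := fun i => by
    refine (ENNReal.tsum_le_tsum fun j => ?_).trans (h i)
    split_ifs
    · exact le_rfl
    · rw [enorm_zero_clm]; exact bot_le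
  have hex : ∃ Y : lp G 2 →L[ℂ] lp G 2, ∀ i j, block Y i j = if p i j then block X i j else 0 := by
    obtain ⟨Y, hY, -⟩ := exists_block_eq (fun i j => if p i j then block X i j else 0) C.toNNReal
      (fun i => by rw [ENNReal.coe_toNNReal hC]; exact hr i)
      (fun j => by
        rw [ENNReal.coe_toNNReal hC]
        refine le_trans (le_of_eq (tsum_congr fun i => ?_)) (hr j)
        by_cases hij : p i j
        · rw [if_pos hij, if_pos (hp _ _ hij), enorm_block_symm hX]
        · rw [if_neg hij, if_neg fun h => hij (hp _ _ h), enorm_zero_clm, enorm_zero_clm])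
    exact ⟨Y, hY⟩
  rw [mask, dif_pos hex]
  exact hex.choose_spec i j

theorem isSelfAdjoint_mask {p : I → I → Prop} (hp : ∀ i j, p i j → p j i)
    {X : lp G 2 →L[ℂ] lp G 2} (hX : IsSelfAdjoint X) {C : ℝ≥0∞} (hC : C ≠ ⊤)
    (h : ∀ i, ∑' j, ‖block X i j‖ₑ ≤ C) : IsSelfAdjoint (mask p X) := by
  classical
  refine block_ext fun i j => ?_
  rw [block_star, block_mask hp hX hC h, block_mask hp hX hC h]
  by_cases hij : p i j
  · rw [if_pos hij, if_pos (hp _ _ hij), ← block_star, hX.star_eq]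
  · rw [if_neg hij, if_neg fun h => hij (hp _ _ h), map_zero]

theorem isToeplitz_mask {G : ℕ → Type*} [∀ n, NormedAddCommGroup (G n)]
    [∀ n, InnerProductSpace ℂ (G n)] [∀ n, CompleteSpace (G n)] {p : ℤ × ℕ → ℤ × ℕ → Prop}
    (hp : ∀ i j, p i j → p j i) {X : SeqSpace G →L[ℂ] SeqSpace G}
    (hps : ∀ k l n m, p (k + 1, n) (l + 1, m) ↔ p (k, n) (l, m))
    (hX : IsSelfAdjoint X) (hXt : IsToeplitz X) {C : ℝ≥0∞} (hC : C ≠ ⊤)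
    (h : ∀ i, ∑' j, ‖block X i j‖ₑ ≤ C) : IsToeplitz (mask p X) := fun k l n m => by
  classical
  rw [block_mask hp hX hC h, block_mask hp hX hC h, hXt]
  by_cases hh : p (k, n) (l, m)
  · rw [if_pos hh, if_pos ((hps k l n m).2 hh)]
  · rw [if_neg hh, if_neg (mt (hps k l n m).1 hh)]

end Mask

/-! ### One step of the progressive diagonalization -/

section Step

variable {G : ℕ → Type*} [∀ n, NormedAddCommGroup (G n)] [∀ n, InnerProductSpace ℂ (G n)]
  [∀ n, CompleteSpace (G n)]

/-- For frequencies in `Ω`, the unitary `U` conjugates `K + Vs` to `K + W`, where `W` has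
block-diagonal part `D`, and the norms of these objects are controlled. -/
structure Stage (h : ℕ → ℝ) (Vs : SeqSpace G →L[ℂ] SeqSpace G) (Ω : Set ℝ) (φ x : ℝ)
    (U W D : ℝ → SeqSpace G →L[ℂ] SeqSpace G) (u o d L : ℝ) : Prop where
  star_mul_self : ∀ ω ∈ Ω, star (U ω) * U ω = 1
  mul_star_self : ∀ ω ∈ Ω, U ω * star (U ω) = 1
  toeplitz_unitary : ∀ ω ∈ Ω, IsToeplitz (U ω)
  selfAdjoint_total : ∀ ω ∈ Ω, IsSelfAdjoint (W ω)
  toeplitz_total : ∀ ω ∈ Ω, IsToeplitz (W ω)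
  selfAdjoint_diag : ∀ ω ∈ Ω, IsSelfAdjoint (D ω)
  toeplitz_diag : ∀ ω ∈ Ω, IsToeplitz (D ω)
  block_diag : ∀ ω ∈ Ω, ∀ i j, i ≠ j → block (D ω) i j = 0
  block_sub_diag : ∀ ω ∈ Ω, ∀ i, block (W ω - D ω) i i = 0
  commutator : ∀ ω ∈ Ω, IsCommutator (modeEnergy h ω) (U ω) (U ω * Vs - W ω * U ω)
  rowNorm_unitary : rowNorm Ω (ENNReal.ofReal φ) (expWeight x) U ≤ ENNReal.ofReal u
  rowNorm_star : rowNorm Ω (ENNReal.ofReal φ) (expWeight x) (fun ω => star (U ω)) ≤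
    ENNReal.ofReal u
  rowNorm_sub_diag : rowNorm Ω (ENNReal.ofReal φ) (expWeight x) (fun ω => W ω - D ω) ≤
    ENNReal.ofReal o
  norm_diag : ∀ ω ∈ Ω, ∀ i, ‖block (D ω) i i‖ ≤ d
  lipschitz_diag : ∀ ω ∈ Ω, ∀ ω' ∈ Ω, ∀ i,
    ‖block (D ω) i i - block (D ω') i i‖ ≤ L * |ω - ω'|

theorem norm_le_one_of_star_mul_self {X : SeqSpace G →L[ℂ] SeqSpace G} (h : star X * X = 1) :
    ‖X‖ ≤ 1 := by
  have h1 : ‖X‖ * ‖X‖ ≤ 1 := by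
    rw [← CStarRing.norm_star_mul_self, h]
    exact ContinuousLinearMap.norm_id_le
  nlinarith [norm_nonneg X]

/-- Splitting off the block diagonal of a perturbation `Z` of a block-diagonal `D`. -/
theorem exists_diag_splitting {Ω : Set ℝ} {φ x z d L : ℝ} (hφ : 0 < φ) (hx : 0 ≤ x) (hz : 0 ≤ z)
    {D Z : ℝ → SeqSpace G →L[ℂ] SeqSpace G}
    (hDs : ∀ ω ∈ Ω, IsSelfAdjoint (D ω)) (hDt : ∀ ω ∈ Ω, IsToeplitz (D ω))
    (hDd : ∀ ω ∈ Ω, ∀ i j, i ≠ j → block (D ω) i j = 0)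
    (hDn : ∀ ω ∈ Ω, ∀ i, ‖block (D ω) i i‖ ≤ d)
    (hDL : ∀ ω ∈ Ω, ∀ ω' ∈ Ω, ∀ i, ‖block (D ω) i i - block (D ω') i i‖ ≤ L * |ω - ω'|)
    (hZs : ∀ ω ∈ Ω, IsSelfAdjoint (Z ω)) (hZt : ∀ ω ∈ Ω, IsToeplitz (Z ω))
    (hZ : rowNorm Ω (ENNReal.ofReal φ) (expWeight x) Z ≤ ENNReal.ofReal z) :
    ∃ D' : ℝ → SeqSpace G →L[ℂ] SeqSpace G,
      (∀ ω ∈ Ω, IsSelfAdjoint (D' ω)) ∧ (∀ ω ∈ Ω, IsToeplitz (D' ω)) ∧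
      (∀ ω ∈ Ω, ∀ i j, i ≠ j → block (D' ω) i j = 0) ∧
      (∀ ω ∈ Ω, ∀ i, block (D ω + Z ω - D' ω) i i = 0) ∧
      rowNorm Ω (ENNReal.ofReal φ) (expWeight x) (fun ω => D ω + Z ω - D' ω) ≤ ENNReal.ofReal z ∧
      (∀ ω ∈ Ω, ∀ i, ‖block (D' ω) i i‖ ≤ d + z) ∧
      (∀ ω ∈ Ω, ∀ ω' ∈ Ω, ∀ i,
        ‖block (D' ω) i i - block (D' ω') i i‖ ≤ (L + z / φ) * |ω - ω'|) ∧
      ∀ ω ∈ Ω, ‖D' ω - D ω‖ ≤ z := by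
  have hsymm : ∀ i j : ℤ × ℕ, i = j → j = i := fun i j h => h.symm
  have hC : ∀ ω ∈ Ω, ∀ i, ∑' j, ‖block (Z ω) i j‖ₑ ≤ ENNReal.ofReal z := fun ω hω i =>
    (tsum_enorm_block_le_rowNorm (one_le_expWeight hx) hω i).trans hZ
  have hM : ∀ ω ∈ Ω, ∀ i j, block (mask (· = ·) (Z ω)) i j = if i = j then block (Z ω) i j else 0 :=
    fun ω hω i j => by
      rw [block_mask hsymm (hZs ω hω) ENNReal.ofReal_ne_top (hC ω hω)]
      congr
  have hMi : ∀ ω ∈ Ω, ∀ i, block (mask (· = ·) (Z ω)) i i = block (Z ω) i i := fun ω hω i => by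
    rw [hM ω hω, if_pos rfl]
  have hMs : ∀ ω ∈ Ω, IsSelfAdjoint (mask (· = ·) (Z ω)) := fun ω hω =>
    isSelfAdjoint_mask hsymm (hZs ω hω) ENNReal.ofReal_ne_top (hC ω hω)
  have hMr : rowNorm Ω (ENNReal.ofReal φ) (expWeight x) (fun ω => mask (· = ·) (Z ω)) ≤
      ENNReal.ofReal z := by
    refine (rowNorm_le_of_block_eq_or fun i j => ?_).trans hZ
    by_cases hij : i = j
    · left; intro ω hω; rw [hM ω hω, if_pos hij]
    · right; intro ω hω; rw [hM ω hω, if_neg hij]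
  have hell : ∀ i, ell Ω (ENNReal.ofReal φ) (fun ω => block (Z ω) i i) ≤ ENNReal.ofReal z :=
    fun i => by
      refine le_trans ?_ ((ell_mul_le_rowNorm (w := expWeight x) i i).trans hZ)
      exact le_mul_of_one_le_right (by simp) (one_le_expWeight hx i i)
  -- The diagonal of `Z` joins `D` and the rest is the new off-diagonal part. The weighted bound `z`
  -- for `Z` becomes a Lipschitz bound `z/φ` for its diagonal blocks.
  refine ⟨fun ω => D ω + mask (· = ·) (Z ω), fun ω hω => (hDs ω hω).add (hMs ω hω),
    fun ω hω => (hDt ω hω).add ?_, fun ω hω i j hij => ?_, fun ω hω i => ?_, ?_,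
    fun ω hω i => ?_, fun ω hω ω' hω' i => ?_, fun ω hω => ?_⟩
  · refine isToeplitz_mask hsymm (fun k l n m => ?_) (hZs ω hω) (hZt ω hω) ENNReal.ofReal_ne_top
      (hC ω hω)
    simp
  · rw [block_add, hDd ω hω i j hij, hM ω hω, if_neg hij, add_zero]
  · rw [add_sub_add_left_eq_sub, block_sub, hMi ω hω, sub_self]
  · refine (rowNorm_le_of_block_eq_or fun i j => ?_).trans hZ
    by_cases hij : i = j
    · right; intro ω hω
      rw [add_sub_add_left_eq_sub, block_sub, hM ω hω, if_pos hij, sub_self]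
    · left; intro ω hω
      rw [add_sub_add_left_eq_sub, block_sub, hM ω hω, if_neg hij, sub_zero]
  · rw [block_add, hMi ω hω]
    refine (norm_add_le _ _).trans (add_le_add (hDn ω hω i) ?_)
    have h1 : ‖block (Z ω) i i‖ₑ ≤ ENNReal.ofReal z :=
      (enorm_le_supNorm (f := fun ω => block (Z ω) i i) hω).trans (supNorm_le_ell.trans (hell i))
    rw [← ofReal_norm] at h1
    exact (ENNReal.ofReal_le_ofReal_iff hz).1 h1
  · rw [block_add, block_add, hMi ω hω, hMi ω' hω', add_sub_add_comm, add_mul]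
    refine (norm_add_le _ _).trans (add_le_add (hDL ω hω ω' hω' i) ?_)
    have h1 : ENNReal.ofReal φ * ‖block (Z ω) i i - block (Z ω') i i‖ₑ ≤
        ENNReal.ofReal z * ‖ω - ω'‖ₑ := by
      calc _ ≤ ENNReal.ofReal φ * (lipNorm Ω (fun ω => block (Z ω) i i) * ‖ω - ω'‖ₑ) := by
            gcongr
            exact enorm_sub_le_lipNorm (f := fun ω => block (Z ω) i i) hω hω'
        _ ≤ _ := by
            rw [← mul_assoc]
            gcongr
            exact mul_lipNorm_le_ell.trans (hell i)
    rw [← ofReal_norm, ← ofReal_norm, ← ENNReal.ofReal_mul hφ.le, ← ENNReal.ofReal_mul hz,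
      ENNReal.ofReal_le_ofReal_iff (by positivity), Real.norm_eq_abs] at h1
    rw [div_mul_eq_mul_div, le_div_iff₀ hφ, mul_comm]
    exact h1
  · rw [add_sub_cancel_left]
    exact norm_le_of_rowNorm_le (X := fun ω => mask (· = ·) (Z ω)) (one_le_expWeight hx) hω
      (enorm_block_symm (hMs ω hω)) hz hMr

variable [∀ n, FiniteDimensional ℂ (G n)]

/-- Conjugation by the Cayley transform `C` of `B` replaces `O` by a remainder of size `3bo`. The
slice `V'`, conjugated by the full new unitary `U' = C U`, is added with size `(u(1+3b))² v`. The
diagonal of the sum updates `D`, and its off-diagonal part is the new error. -/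
theorem Stage.step {h : ℕ → ℝ} {Vs V' : SeqSpace G →L[ℂ] SeqSpace G} {Ω Ω' : Set ℝ}
    {φ x : ℝ} {U W D : ℝ → SeqSpace G →L[ℂ] SeqSpace G} {u o d L : ℝ}
    (S : Stage h Vs Ω φ x U W D u o d L) (hΩ : Ω' ⊆ Ω) {γ c x' b v : ℝ} (hγ : 0 < γ) (hc : 0 ≤ c)
    (hx' : 0 ≤ x') (hx : x = x' + 2 * c) (hφ : γ ≤ φ) (hL : L ≤ 1 / 4) (hu : 0 ≤ u) (ho : 0 ≤ o)
    (hb : 5 / (4 * γ) * o ≤ b) (hb1 : b ≤ 1 / 100)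
    (hlow : ∀ ω ∈ Ω', ∀ i j : ℤ × ℕ, i ≠ j → ∀ Z : G j.2 →L[ℂ] G i.2,
      γ * √(max 1 ((i.1 - j.1).natAbs : ℝ)) * Real.exp (-(c * (i.1 - j.1).natAbs)) * ‖Z‖ ≤
        ‖sylvester (modeEnergy h ω i - modeEnergy h ω j) (block (D ω) i i) (block (D ω) j j) Z‖)
    (hVs : IsSelfAdjoint V') (hVt : IsToeplitz V') (hv : 0 ≤ v)
    (hVn : rowNorm Ω' (ENNReal.ofReal γ) (expWeight x') (fun _ => V') ≤ ENNReal.ofReal v) :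
    ∃ U' W' D' : ℝ → SeqSpace G →L[ℂ] SeqSpace G,
      Stage h (Vs + V') Ω' γ x' U' W' D' (u * (1 + 3 * b))
        (3 * b * o + (u * (1 + 3 * b)) ^ 2 * v) (d + (3 * b * o + (u * (1 + 3 * b)) ^ 2 * v))
        (L + (3 * b * o + (u * (1 + 3 * b)) ^ 2 * v) / γ) ∧
      ∀ ω ∈ Ω', ‖U' ω - U ω‖ ≤ 2 * b ∧
        ‖D' ω - D ω‖ ≤ 3 * b * o + (u * (1 + 3 * b)) ^ 2 * v := by
  have hb0 : 0 ≤ b := le_trans (by positivity) hb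
  set O : ℝ → SeqSpace G →L[ℂ] SeqSpace G := fun ω => W ω - D ω with hO
  have hxx : x' ≤ x := by linarith
  have mono : ∀ X : ℝ → SeqSpace G →L[ℂ] SeqSpace G,
      rowNorm Ω' (ENNReal.ofReal γ) (expWeight x') X ≤
        rowNorm Ω (ENNReal.ofReal φ) (expWeight x) X := fun X =>
    rowNorm_mono hΩ (ENNReal.ofReal_le_ofReal hφ) (expWeight_mono hxx)
  have hOn : rowNorm Ω' (ENNReal.ofReal φ) (expWeight x) O ≤ ENNReal.ofReal o :=
    (rowNorm_mono hΩ le_rfl fun _ _ => le_rfl).trans S.rowNorm_sub_diag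
  have hOs : ∀ ω ∈ Ω', IsSelfAdjoint (O ω) := fun ω hω =>
    (S.selfAdjoint_total ω (hΩ hω)).sub (S.selfAdjoint_diag ω (hΩ hω))
  have hOt : ∀ ω ∈ Ω', IsToeplitz (O ω) := fun ω hω =>
    (S.toeplitz_total ω (hΩ hω)).sub (S.toeplitz_diag ω (hΩ hω))
  obtain ⟨B, hBs, hBt, hBc, hBn⟩ := exists_homological_solution h (D := D) (O := O)
    (fun ω hω => S.selfAdjoint_diag ω (hΩ hω)) hOs (fun ω hω => S.toeplitz_diag ω (hΩ hω)) hOt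
    (fun ω hω => S.block_diag ω (hΩ hω)) (fun ω hω => S.block_sub_diag ω (hΩ hω))
    (fun ω hω ω' hω' i => (S.lipschitz_diag ω (hΩ hω) ω' (hΩ hω') i).trans (by gcongr))
    hγ hc hx' hx hφ hlow (ne_top_of_le_ne_top ENNReal.ofReal_ne_top hOn)
  have hBn' : rowNorm Ω' (ENNReal.ofReal γ) (expWeight x') B ≤ ENNReal.ofReal b := by
    refine hBn.trans ((mul_le_mul_right hOn _).trans ?_)
    rw [← ENNReal.ofReal_mul (by positivity)]
    exact ENNReal.ofReal_le_ofReal hb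
  have hBop : ∀ ω ∈ Ω', ‖B ω‖ ≤ b := fun ω hω =>
    norm_le_of_rowNorm_le (one_le_expWeight hx') hω (enorm_block_symm_of_skew (hBs ω hω)) hb0 hBn'
  have hB1 : ∀ ω ∈ Ω', ‖B ω‖ < 1 := fun ω hω => (hBop ω hω).trans_lt (by linarith)
  have hB1' : ∀ ω ∈ Ω', ‖-B ω‖ < 1 := fun ω hω => by rw [norm_neg]; exact hB1 ω hω
  have hwm := expWeight_le_mul hx'
  have hw1 := expWeight_self x'
  set N : (ℝ → SeqSpace G →L[ℂ] SeqSpace G) → ℝ≥0∞ :=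
    fun X => rowNorm Ω' (ENNReal.ofReal γ) (expWeight x') X with hN
  have hNmul : ∀ {X Y : ℝ → SeqSpace G →L[ℂ] SeqSpace G} {a a' : ℝ}, 0 ≤ a →
      N X ≤ ENNReal.ofReal a → N Y ≤ ENNReal.ofReal a' →
      N (fun ω => X ω * Y ω) ≤ ENNReal.ofReal (a * a') := fun ha hX hY => by
    rw [ENNReal.ofReal_mul ha]
    exact (rowNorm_mul_le hwm).trans (mul_le_mul' hX hY)
  have hNadd : ∀ {X Y : ℝ → SeqSpace G →L[ℂ] SeqSpace G} {a a' : ℝ}, 0 ≤ a → 0 ≤ a' →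
      N X ≤ ENNReal.ofReal a → N Y ≤ ENNReal.ofReal a' →
      N (fun ω => X ω + Y ω) ≤ ENNReal.ofReal (a + a') := fun ha ha' hX hY => by
    rw [ENNReal.ofReal_add ha ha']
    exact rowNorm_add_le.trans (add_le_add hX hY)
  have hNsub : ∀ {X Y : ℝ → SeqSpace G →L[ℂ] SeqSpace G} {a a' : ℝ}, 0 ≤ a → 0 ≤ a' →
      N X ≤ ENNReal.ofReal a → N Y ≤ ENNReal.ofReal a' →
      N (fun ω => X ω - Y ω) ≤ ENNReal.ofReal (a + a') := fun ha ha' hX hY => by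
    rw [ENNReal.ofReal_add ha ha']
    exact rowNorm_sub_le.trans (add_le_add hX hY)
  have hnegB : N (fun ω => -B ω) ≤ ENNReal.ofReal b := by simp only [hN, rowNorm_neg]; exact hBn'
  have hgeom : ∀ {X : ℝ → SeqSpace G →L[ℂ] SeqSpace G}, N X ≤ ENNReal.ofReal b →
      (∀ ω ∈ Ω', ‖X ω‖ < 1) → N (fun ω => ∑' n : ℕ, X ω ^ n) ≤ ENNReal.ofReal (1 / (1 - b)) :=
    fun hX hX1 => by
      refine (rowNorm_geom_le hwm hw1 hX1).trans ?_
      rw [one_div, ENNReal.ofReal_inv_of_pos (by linarith), ENNReal.ofReal_sub _ hb0,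
        ENNReal.ofReal_one]
      gcongr
  set T : ℝ → SeqSpace G →L[ℂ] SeqSpace G := fun ω => ∑' n : ℕ, B ω ^ n with hT
  set T' : ℝ → SeqSpace G →L[ℂ] SeqSpace G := fun ω => ∑' n : ℕ, (-B ω) ^ n with hT'
  have hTn : N T ≤ ENNReal.ofReal (1 / (1 - b)) := hgeom hBn' hB1
  have hTn' : N T' ≤ ENNReal.ofReal (1 / (1 - b)) := hgeom hnegB hB1'
  have hTt : ∀ ω ∈ Ω', IsToeplitz (T ω) := fun ω hω => (hBt ω hω).geom (hB1 ω hω)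
  have hTt' : ∀ ω ∈ Ω', IsToeplitz (T' ω) := fun ω hω => (hBt ω hω).neg.geom (hB1' ω hω)
  have hTstar : ∀ ω ∈ Ω', star (T ω) = T' ω := fun ω hω => star_geom (hB1 ω hω) (hBs ω hω)
  have hTstar' : ∀ ω ∈ Ω', star (T' ω) = T ω := fun ω hω => by rw [← hTstar ω hω, star_star]
  have hbpos : 0 < 1 - b := by linarith
  have hone : N (fun _ => 1) ≤ ENNReal.ofReal 1 := by simpa using rowNorm_one_le hw1
  -- The weighted norm of a unitary need not be at most one, so its growth is tracked by this
  -- factor.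
  have hcay : 1 / (1 - b) * (1 + b) ≤ 1 + 3 * b := by
    rw [one_div, inv_mul_le_iff₀ hbpos]; nlinarith
  set C : ℝ → SeqSpace G →L[ℂ] SeqSpace G := fun ω => T ω * (1 + B ω) with hCdef
  have hCn : N C ≤ ENNReal.ofReal (1 + 3 * b) :=
    (hNmul (by positivity) hTn (hNadd zero_le_one hb0 hone hBn')).trans
      (ENNReal.ofReal_le_ofReal hcay)
  have hCstar : ∀ ω ∈ Ω', star (C ω) = (1 - B ω) * T' ω := fun ω hω => by
    rw [hCdef]
    simp only [star_mul, star_add, star_one, hBs ω hω, hTstar ω hω, sub_eq_add_neg]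
  have hCn' : N (fun ω => star (C ω)) ≤ ENNReal.ofReal (1 + 3 * b) := by
    rw [hN]
    simp only
    rw [rowNorm_congr hCstar]
    refine (hNmul (X := fun ω => 1 - B ω) (Y := T') (by positivity)
      (hNsub zero_le_one hb0 hone hBn') hTn').trans (ENNReal.ofReal_le_ofReal ?_)
    rwa [mul_comm]
  have hCt : ∀ ω ∈ Ω', IsToeplitz (C ω) := fun ω hω =>
    (hTt ω hω).mul (IsToeplitz.one.add (hBt ω hω))
  have hCu := fun ω hω => star_cayley_mul_self (hB1 ω hω) (hBs ω hω)
  set U' : ℝ → SeqSpace G →L[ℂ] SeqSpace G := fun ω => C ω * U ω with hU'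
  have hu' : 0 ≤ u * (1 + 3 * b) := by positivity
  have hU'n : N U' ≤ ENNReal.ofReal (u * (1 + 3 * b)) := by
    rw [mul_comm]
    exact hNmul (by positivity) hCn ((mono _).trans S.rowNorm_unitary)
  have hU'n' : N (fun ω => star (U' ω)) ≤ ENNReal.ofReal (u * (1 + 3 * b)) := by
    simp only [hU', star_mul]
    exact hNmul (X := fun ω => star (U ω)) (Y := fun ω => star (C ω)) hu
      ((mono _).trans S.rowNorm_star) hCn'
  have hU't : ∀ ω ∈ Ω', IsToeplitz (U' ω) := fun ω hω =>
    (hCt ω hω).mul (S.toeplitz_unitary ω (hΩ hω))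
  have hU'1 : ∀ ω ∈ Ω', star (U' ω) * U' ω = 1 := fun ω hω => by
    calc star (U' ω) * U' ω = star (U ω) * (star (C ω) * C ω) * U ω := by
          simp only [hU', star_mul]; noncomm_ring
      _ = 1 := by rw [(hCu ω hω).1, mul_one, S.star_mul_self ω (hΩ hω)]
  have hU'2 : ∀ ω ∈ Ω', U' ω * star (U' ω) = 1 := fun ω hω => by
    calc U' ω * star (U' ω) = C ω * (U ω * star (U ω)) * star (C ω) := by
          simp only [hU', star_mul]; noncomm_ring
      _ = 1 := by rw [S.mul_star_self ω (hΩ hω), mul_one, (hCu ω hω).2]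
  set Q : ℝ → SeqSpace G →L[ℂ] SeqSpace G := fun ω => B ω * O ω - O ω * B ω - B ω * O ω * B ω
    with hQ
  have hOn' : N O ≤ ENNReal.ofReal o := (mono _).trans S.rowNorm_sub_diag
  have hQn : N Q ≤ ENNReal.ofReal (b * o + o * b + b * o * b) :=
    hNsub (X := fun ω => B ω * O ω - O ω * B ω) (Y := fun ω => B ω * O ω * B ω) (by positivity)
      (by positivity)
      (hNsub (X := fun ω => B ω * O ω) (Y := fun ω => O ω * B ω) (by positivity) (by positivity)
        (hNmul hb0 hBn' hOn') (hNmul ho hOn' hBn'))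
      (hNmul (X := fun ω => B ω * O ω) (by positivity) (hNmul hb0 hBn' hOn') hBn')
  have hQs : ∀ ω ∈ Ω', IsSelfAdjoint (Q ω) := fun ω hω => by
    rw [isSelfAdjoint_iff]
    simp only [hQ, star_sub, star_mul, hBs ω hω, (hOs ω hω).star_eq]
    noncomm_ring
  have hQt : ∀ ω ∈ Ω', IsToeplitz (Q ω) := fun ω hω =>
    ((((hBt ω hω).mul (hOt ω hω)).sub ((hOt ω hω).mul (hBt ω hω))).sub
      (((hBt ω hω).mul (hOt ω hω)).mul (hBt ω hω)))
  set Z : ℝ → SeqSpace G →L[ℂ] SeqSpace G := fun ω =>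
    T ω * Q ω * T' ω + U' ω * V' * star (U' ω) with hZ
  set z := 3 * b * o + (u * (1 + 3 * b)) ^ 2 * v with hz
  have hz0 : 0 ≤ z := by positivity
  have hZn : N Z ≤ ENNReal.ofReal z := by
    refine (hNadd (X := fun ω => T ω * Q ω * T' ω) (Y := fun ω => U' ω * V' * star (U' ω))
      (by positivity) (by positivity)
      (hNmul (X := fun ω => T ω * Q ω) (by positivity) (hNmul (by positivity) hTn hQn) hTn')
      (hNmul (X := fun ω => U' ω * V') (by positivity) (hNmul hu' hU'n hVn) hU'n')).trans
      (ENNReal.ofReal_le_ofReal ?_)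
    rw [hz]
    refine add_le_add ?_ (le_of_eq (by ring))
    have e1 : 1 / (1 - b) * (b * o + o * b + b * o * b) * (1 / (1 - b)) =
        (2 + b) / (1 - b) ^ 2 * (b * o) := by field_simp; ring
    -- The three terms of `Q` give `(2 + b) bo`, and the two Neumann series give `(1 - b)⁻²`.
    have e2 : (2 + b) / (1 - b) ^ 2 ≤ 3 := by
      rw [div_le_iff₀ (by positivity)]; nlinarith
    rw [e1, mul_assoc 3]
    exact mul_le_mul_of_nonneg_right e2 (by positivity)
  have hZs : ∀ ω ∈ Ω', IsSelfAdjoint (Z ω) := fun ω hω => by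
    rw [isSelfAdjoint_iff]
    simp only [hZ, star_add, star_mul, star_star, hTstar ω hω, hTstar' ω hω, (hQs ω hω).star_eq,
      hVs.star_eq]
    noncomm_ring
  have hZt : ∀ ω ∈ Ω', IsToeplitz (Z ω) := fun ω hω =>
    (((hTt ω hω).mul (hQt ω hω)).mul (hTt' ω hω)).add
      (((hU't ω hω).mul hVt).mul (hU't ω hω).star)
  obtain ⟨D', hD's, hD't, hD'd, hD'O, hD'n, hD'b, hD'L, hD'D⟩ := exists_diag_splitting hγ hx' hz0
    (fun ω hω => S.selfAdjoint_diag ω (hΩ hω)) (fun ω hω => S.toeplitz_diag ω (hΩ hω))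
    (fun ω hω => S.block_diag ω (hΩ hω)) (fun ω hω => S.norm_diag ω (hΩ hω))
    (fun ω hω ω' hω' => S.lipschitz_diag ω (hΩ hω) ω' (hΩ hω')) hZs hZt hZn
  refine ⟨U', fun ω => D ω + Z ω, D', ⟨hU'1, hU'2, hU't,
    fun ω hω => (S.selfAdjoint_diag ω (hΩ hω)).add (hZs ω hω),
    fun ω hω => (S.toeplitz_diag ω (hΩ hω)).add (hZt ω hω), hD's, hD't, hD'd, hD'O,
    fun ω hω => ?_, hU'n, hU'n', hD'n, hD'b, hD'L⟩, fun ω hω => ⟨?_, hD'D ω hω⟩⟩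
  -- Product rule `[K, C U] = [K, C] U + C [K, U]`; unitarity of `U'` turns the conjugated slice
  -- times `U'` into `U' V'`.
  · have h1 := (hBc ω hω).cayley (hB1 ω hω)
    have h2 := h1.mul (S.commutator ω (hΩ hω))
    convert h2 using 1
    change C ω * U ω * (Vs + V') - (D ω + (T ω * Q ω * T' ω + U' ω * V' * star (U' ω))) * (U' ω) =
      (C ω * (D ω + O ω) - (D ω + T ω * Q ω * T' ω) * C ω) * U ω +
        C ω * (U ω * Vs - W ω * U ω)
    have e : W ω = D ω + O ω := by simp [hO]
    calc _ = C ω * U ω * (Vs + V') - (D ω + T ω * Q ω * T' ω) * U' ω -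
          U' ω * V' * (star (U' ω) * U' ω) := by noncomm_ring
      _ = _ := by rw [hU'1 ω hω, mul_one, e, hU']; noncomm_ring
  -- From `(1 - B) C = 1 + B` follows `C - 1 = B (C + 1)`; with `C` and `U` unitary this is at most
  -- `2b` in norm.
  · have e1 : U' ω - U ω = B ω * (C ω + 1) * U ω := by
      have e2 : (1 - B ω) * C ω = 1 + B ω := by
        rw [hCdef]
        simp only
        rw [← mul_assoc, mul_neg_geom_series (B ω) (hB1 ω hω), one_mul]
      have e3 : C ω = 1 + B ω + B ω * C ω := by rw [← e2]; noncomm_ring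
      calc U' ω - U ω = (C ω - 1) * U ω := by rw [hU']; noncomm_ring
        _ = (1 + B ω + B ω * C ω - 1) * U ω := by rw [← e3]
        _ = _ := by noncomm_ring
    rw [e1]
    calc ‖B ω * (C ω + 1) * U ω‖ ≤ ‖B ω‖ * ‖C ω + 1‖ * ‖U ω‖ :=
          (norm_mul_le _ _).trans (by gcongr; exact norm_mul_le _ _)
      _ ≤ b * (1 + 1) * 1 := by
          gcongr
          · exact hBop ω hω
          · refine (norm_add_le _ _).trans (add_le_add ?_ ContinuousLinearMap.norm_id_le)
            exact norm_le_one_of_star_mul_self (hCu ω hω).1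
          · exact norm_le_one_of_star_mul_self (S.star_mul_self ω (hΩ hω))
      _ = 2 * b := by ring

end Step

end Floquet
end

noncomputable section

namespace Floquet

open Filter Topology

/-! ### Truncation of the perturbation in the Fourier variable -/

section Cut

variable {G : ℕ → Type*} [∀ n, NormedAddCommGroup (G n)] [∀ n, InnerProductSpace ℂ (G n)]

/-- The perturbation `V` has weighted row sums bounded by `ε`, with weight `max (|k|^r) 1`. -/
def RegularityBound (V : SeqSpace G →L[ℂ] SeqSpace G) (r ε : ℝ) : Prop :=
  ∀ i, ∑' j, ‖block V i j‖ₑ * ENNReal.ofReal (max (((i.1 - j.1).natAbs : ℝ) ^ r) 1) ≤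
    ENNReal.ofReal ε

/-- A constant family has no Lipschitz part, so it is enough to compare the exponential weight with
the polynomial one on the surviving blocks. -/
theorem RegularityBound.rowNorm_le {V Y : SeqSpace G →L[ℂ] SeqSpace G} {r ε c x : ℝ}
    (hV : RegularityBound V r ε) (hc : 0 ≤ c) {Ω : Set ℝ} {φ : ℝ≥0∞}
    (hY : ∀ i j, block Y i j = 0 ∨ (block Y i j = block V i j ∧
      Real.exp (x * (i.1 - j.1).natAbs) ≤ c * max (((i.1 - j.1).natAbs : ℝ) ^ r) 1)) :
    rowNorm Ω φ (expWeight x) (fun _ => Y) ≤ ENNReal.ofReal (c * ε) := by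
  refine iSup_le fun i => ?_
  rw [ENNReal.ofReal_mul hc]
  refine le_trans ?_ (mul_le_mul_right (hV i) _)
  rw [← ENNReal.tsum_mul_left]
  refine ENNReal.tsum_le_tsum fun j => ?_
  refine (mul_le_mul_left (ell_le_of_const fun _ _ => rfl) _).trans ?_
  rcases hY i j with h | ⟨h, h'⟩
  · rw [h, enorm_zero_clm, zero_mul]; exact bot_le
  · rw [h, mul_left_comm, ← ENNReal.ofReal_mul hc]
    gcongr
    exact ENNReal.ofReal_le_ofReal h'

theorem RegularityBound.tsum_le {V : SeqSpace G →L[ℂ] SeqSpace G} {r ε : ℝ}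
    (hV : RegularityBound V r ε) (i : ℤ × ℕ) : ∑' j, ‖block V i j‖ₑ ≤ ENNReal.ofReal ε := by
  refine (ENNReal.tsum_le_tsum fun j => ?_).trans (hV i)
  refine le_mul_of_one_le_right (by simp) ?_
  rw [ENNReal.one_le_ofReal]
  exact le_max_right _ _

/-- The part of `V` with Fourier index at most `exp (2 s / r)`. -/
def cut (r : ℝ) (V : SeqSpace G →L[ℂ] SeqSpace G) (s : ℕ) : SeqSpace G →L[ℂ] SeqSpace G :=
  mask (fun i j => ((i.1 - j.1).natAbs : ℝ) ≤ Real.exp (2 * s / r)) V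

variable [∀ n, CompleteSpace (G n)] {V : SeqSpace G →L[ℂ] SeqSpace G} {r ε : ℝ}

theorem cut_symm (s : ℕ) (i j : ℤ × ℕ) (h : ((i.1 - j.1).natAbs : ℝ) ≤ Real.exp (2 * s / r)) :
    ((j.1 - i.1).natAbs : ℝ) ≤ Real.exp (2 * s / r) := by
  rwa [← neg_sub i.1 j.1, Int.natAbs_neg]

open Classical in
theorem block_cut (hVs : IsSelfAdjoint V) (hV : RegularityBound V r ε) (s : ℕ) (i j : ℤ × ℕ) :
    block (cut r V s) i j =
      if ((i.1 - j.1).natAbs : ℝ) ≤ Real.exp (2 * s / r) then block V i j else 0 :=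
  block_mask (cut_symm s) hVs ENNReal.ofReal_ne_top hV.tsum_le i j

theorem isSelfAdjoint_cut (hVs : IsSelfAdjoint V) (hV : RegularityBound V r ε) (s : ℕ) :
    IsSelfAdjoint (cut r V s) :=
  isSelfAdjoint_mask (cut_symm s) hVs ENNReal.ofReal_ne_top hV.tsum_le

theorem isToeplitz_cut (hVs : IsSelfAdjoint V) (hVt : IsToeplitz V) (hV : RegularityBound V r ε)
    (s : ℕ) : IsToeplitz (cut r V s) :=
  isToeplitz_mask (cut_symm s) (fun k l n m => by simp) hVs hVt ENNReal.ofReal_ne_top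
    hV.tsum_le

theorem isSelfAdjoint_cut_sub (hVs : IsSelfAdjoint V) (hV : RegularityBound V r ε) (s t : ℕ) :
    IsSelfAdjoint (cut r V s - cut r V t) :=
  (isSelfAdjoint_cut hVs hV s).sub (isSelfAdjoint_cut hVs hV t)

theorem le_max_rpow {r K : ℝ} (hr : 0 < r) {s : ℕ} (hK : Real.exp (2 * s / r) ≤ K) :
    Real.exp (2 * s) ≤ max (K ^ r) 1 := by
  refine le_max_of_le_left ?_
  calc Real.exp (2 * s) = Real.exp (2 * s / r) ^ r := by
        rw [← Real.exp_mul]; congr 1; field_simp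
    _ ≤ K ^ r := Real.rpow_le_rpow (Real.exp_nonneg _) hK hr.le

/-- The rate is the reciprocal of the cutoff, so the exponential weight is at most `e` on every
surviving block. -/
theorem rowNorm_cut_one_le (hVs : IsSelfAdjoint V) (hV : RegularityBound V r ε) {Ω : Set ℝ}
    {φ : ℝ≥0∞} : rowNorm Ω φ (expWeight (Real.exp (-(2 * (1 : ℕ) / r)))) (fun _ => cut r V 1) ≤
      ENNReal.ofReal (Real.exp 1 * ε) := by
  classical
  refine hV.rowNorm_le (Real.exp_nonneg _) fun i j => ?_
  rw [block_cut hVs hV]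
  split_ifs with h
  · refine .inr ⟨rfl, ?_⟩
    refine le_trans ?_ (le_mul_of_one_le_right (Real.exp_nonneg _) (le_max_right _ _))
    rw [Real.exp_le_exp, Real.exp_neg, inv_mul_le_iff₀ (Real.exp_pos _), mul_one]
    exact h
  · exact .inl rfl

/-- Surviving indices satisfy `e^{2s/r} < |k| ≤ e^{2(s+1)/r}`: the upper bound keeps the exponential
weight below `e`, and the lower one makes `|k|^r` at least `e^{2s}`. -/
theorem rowNorm_cut_succ_sub_le (hr : 0 < r) (hVs : IsSelfAdjoint V) (hV : RegularityBound V r ε)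
    {Ω : Set ℝ} {φ : ℝ≥0∞} (s : ℕ) :
    rowNorm Ω φ (expWeight (Real.exp (-(2 * (s + 1 : ℕ) / r))))
      (fun _ => cut r V (s + 1) - cut r V s) ≤
      ENNReal.ofReal (Real.exp 1 * Real.exp (-(2 * s)) * ε) := by
  classical
  refine hV.rowNorm_le (by positivity) fun i j => ?_
  rw [block_sub, block_cut hVs hV, block_cut hVs hV]
  split_ifs with h1 h2 h2
  · left; rw [sub_self]
  · refine .inr ⟨sub_zero _, ?_⟩
    have h3 := le_max_rpow hr (not_le.1 h2).le
    rw [mul_assoc]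
    calc _ ≤ Real.exp 1 := by
          rw [Real.exp_le_exp, Real.exp_neg, inv_mul_le_iff₀ (Real.exp_pos _), mul_one]
          exact h1
      _ = Real.exp 1 * (Real.exp (-(2 * s)) * Real.exp (2 * s)) := by
          rw [← Real.exp_add]; simp
      _ ≤ _ := by gcongr
  · exfalso
    refine h1 (h2.trans ?_)
    gcongr
    simp
  · left; rw [sub_self]

theorem norm_sub_cut_le (hr : 0 < r) (hε : 0 ≤ ε) (hVs : IsSelfAdjoint V)
    (hV : RegularityBound V r ε) (s : ℕ) : ‖V - cut r V s‖ ≤ Real.exp (-(2 * s)) * ε := by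
  classical
  refine norm_le_of_rowNorm_le (Ω := univ) (ω := 0) (φ := 0) (X := fun _ => V - cut r V s)
    (one_le_expWeight le_rfl) (mem_univ _)
    (enorm_block_symm (hVs.sub (isSelfAdjoint_cut hVs hV s))) (by positivity) ?_
  refine hV.rowNorm_le (by positivity) fun i j => ?_
  rw [block_sub, block_cut hVs hV]
  split_ifs with h
  · left; rw [sub_self]
  · refine .inr ⟨sub_zero _, ?_⟩
    have h3 := le_max_rpow hr (not_le.1 h).le
    rw [zero_mul, Real.exp_zero, Real.exp_neg, inv_mul_eq_div, one_le_div (Real.exp_pos _)]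
    exact h3

end Cut

/-! ### Constants of the iteration -/

section Constants

/-- Size of the divisors kept at stage `t`. -/
def divisorSize (ε : ℝ) (t : ℕ) : ℝ :=
  60 * Real.exp 5 * ε * (t + 1) ^ 2 * Real.exp (-(2 * (t + 1)))

/-- Bound for the off-diagonal part at stage `t`. -/
def offBound (ε : ℝ) (t : ℕ) : ℝ := 2 * Real.exp 3 * ε * Real.exp (-(2 * (t + 1)))

/-- Rate of the exponential weight at stage `t`. -/
def weightRate (r : ℝ) (t : ℕ) : ℝ := Real.exp (-(2 * (t + 1 : ℕ) / r))

theorem divisorSize_pos {ε : ℝ} (hε : 0 < ε) (t : ℕ) : 0 < divisorSize ε t := by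
  unfold divisorSize; positivity

theorem divisorSize_antitone {ε : ℝ} (hε : 0 < ε) : Antitone (divisorSize ε) := by
  refine antitone_nat_of_succ_le fun t => ?_
  unfold divisorSize
  have h1 : Real.exp (-(2 * ((t + 1 : ℕ) + 1 : ℝ))) = Real.exp (-(2 * (t + 1))) * Real.exp (-1) ^ 2 := by
    rw [← Real.exp_nat_mul, ← Real.exp_add]; congr 1; push_cast; ring
  have h2 : Real.exp (-1) ≤ 1 / 2 := by
    rw [Real.exp_neg, one_div]
    have := Real.add_one_le_exp (1 : ℝ)
    gcongr
    linarith
  have h3 : ((t + 1 : ℕ) + 1 : ℝ) * Real.exp (-1) ≤ t + 1 := by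
    calc ((t + 1 : ℕ) + 1 : ℝ) * Real.exp (-1) ≤ ((t + 1 : ℕ) + 1 : ℝ) * (1 / 2) := by gcongr
      _ ≤ t + 1 := by push_cast; linarith [(Nat.cast_nonneg t : (0 : ℝ) ≤ t)]
  rw [h1]
  calc _ = 60 * Real.exp 5 * ε * (((t + 1 : ℕ) + 1 : ℝ) * Real.exp (-1)) ^ 2 *
        Real.exp (-(2 * (t + 1))) := by ring
    _ ≤ _ := by gcongr

theorem divisorSize_le {ε : ℝ} (hε : 0 < ε) (t : ℕ) : divisorSize ε t ≤ 60 * Real.exp 3 * ε := by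
  refine (divisorSize_antitone hε t.zero_le).trans (le_of_eq ?_)
  have : Real.exp 3 = Real.exp 5 * Real.exp (-2) := by rw [← Real.exp_add]; norm_num
  rw [this]
  simp only [divisorSize, Nat.cast_zero, zero_add, one_pow, mul_one]
  ring

theorem offBound_pos {ε : ℝ} (hε : 0 < ε) (t : ℕ) : 0 < offBound ε t := by
  unfold offBound; positivity

theorem offBound_succ (ε : ℝ) (t : ℕ) : offBound ε (t + 1) = offBound ε t * Real.exp (-2) := by
  unfold offBound
  rw [mul_assoc _ (Real.exp (-(2 * ((t : ℝ) + 1)))), ← Real.exp_add]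
  congr 2; push_cast; ring

theorem seven_le_exp_two : (7 : ℝ) ≤ Real.exp 2 := by
  have h := Real.exp_one_gt_d9
  have : Real.exp 2 = Real.exp 1 ^ 2 := by rw [← Real.exp_nat_mul]; norm_num
  rw [this]; nlinarith

theorem exp_two_le_eight : Real.exp 2 ≤ 8 := by
  have h := Real.exp_one_lt_d9
  have h0 := Real.exp_pos 1
  have : Real.exp 2 = Real.exp 1 ^ 2 := by rw [← Real.exp_nat_mul]; norm_num
  rw [this]; nlinarith

theorem exp_neg_two_le : Real.exp (-2) ≤ 1 / 7 := by
  rw [Real.exp_neg, one_div]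
  gcongr
  exact seven_le_exp_two

theorem offBound_div_divisorSize {ε : ℝ} (hε : 0 < ε) (t : ℕ) :
    offBound ε t / divisorSize ε t = Real.exp (-2) / (30 * (t + 1) ^ 2) := by
  have h5 : Real.exp 5 = Real.exp 3 * Real.exp 2 := by rw [← Real.exp_add]; norm_num
  unfold offBound divisorSize
  rw [h5, Real.exp_neg 2]
  have : ((t : ℝ) + 1) ≠ 0 := by positivity
  field_simp
  norm_num

/-- The factor `(t + 1)²` in `divisorSize` makes the size of `B` summable over the stages: `5/4 ·
e⁻²/30 ≤ 5/4 · 1/210 = 1/168`. -/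
theorem step_ratio_le {ε : ℝ} (hε : 0 < ε) (t : ℕ) :
    5 / (4 * divisorSize ε t) * offBound ε t ≤ 1 / (168 * (t + 1) ^ 2) := by
  have h1 : 5 / (4 * divisorSize ε t) * offBound ε t =
      5 / 4 * (offBound ε t / divisorSize ε t) := by
    have := (divisorSize_pos hε t).ne'
    field_simp
  rw [h1, offBound_div_divisorSize hε]
  calc 5 / 4 * (Real.exp (-2) / (30 * (t + 1) ^ 2)) ≤ 5 / 4 * (1 / 7 / (30 * (t + 1) ^ 2)) := by
        gcongr
        exact exp_neg_two_le
    _ = _ := by field_simp; norm_num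

theorem inv_succ_sub_inv_succ (t : ℕ) : (1 : ℝ) / (8 * (t + 1) ^ 2) ≤
    1 / (4 * (t + 1)) - 1 / (4 * ((t + 1 : ℕ) + 1)) := by
  have h1 : (1 : ℝ) / (4 * (t + 1)) - 1 / (4 * ((t + 1 : ℕ) + 1)) =
      1 / (4 * (t + 1) * (t + 2)) := by push_cast; field_simp; ring
  rw [h1]
  refine one_div_le_one_div_of_le (by positivity) ?_
  nlinarith [(Nat.cast_nonneg t : (0 : ℝ) ≤ t)]

/-- Bound for the conjugating unitary at stage `t`. -/
def unitaryBound (t : ℕ) : ℝ := 5 / 4 - 1 / (4 * (t + 1))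

theorem one_le_unitaryBound (t : ℕ) : 1 ≤ unitaryBound t := by
  unfold unitaryBound
  have : (1 : ℝ) / (4 * (t + 1)) ≤ 1 / 4 := by gcongr; linarith [(Nat.cast_nonneg t : (0 : ℝ) ≤ t)]
  linarith

theorem unitaryBound_le (t : ℕ) : unitaryBound t ≤ 5 / 4 := by
  unfold unitaryBound
  have : (0 : ℝ) ≤ 1 / (4 * (t + 1)) := by positivity
  linarith

/-- The increment is at most `1/(8(t+1)²)`, which is below the telescoping difference of
`1/(4(t+1))`. -/
theorem unitaryBound_step (t : ℕ) :
    unitaryBound t * (1 + 3 * (1 / (168 * (t + 1) ^ 2))) ≤ unitaryBound (t + 1) := by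
  have h1 := unitaryBound_le t
  have h2 := inv_succ_sub_inv_succ t
  have h3 : unitaryBound t * (3 * (1 / (168 * (t + 1) ^ 2))) ≤
      5 / 4 * (3 * (1 / (168 * (t + 1) ^ 2))) := by gcongr
  have h4 : (5 : ℝ) / 4 * (3 * (1 / (168 * (t + 1) ^ 2))) ≤ 1 / (8 * (t + 1) ^ 2) := by
    rw [show (5 : ℝ) / 4 * (3 * (1 / (168 * (t + 1) ^ 2))) = 5 / 28 * (1 / (8 * (t + 1) ^ 2)) by
      field_simp; norm_num]
    exact mul_le_of_le_one_left (by positivity) (by norm_num)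
  rw [mul_add, mul_one]
  have h5 : unitaryBound (t + 1) = 5 / 4 - 1 / (4 * ((t + 1 : ℕ) + 1)) := rfl
  have h6 : unitaryBound t = 5 / 4 - 1 / (4 * (t + 1)) := rfl
  linarith

/-- As `offBound ε t` is at most `8` times its successor, the quadratic part uses at most `3 · 8/168
= 1/7` of the successor and the new slice `(5/4)²/2 = 25/32`; together they stay below `1`. -/
theorem offBound_step {ε : ℝ} (hε : 0 < ε) (t : ℕ) :
    3 * (1 / (168 * (t + 1) ^ 2)) * offBound ε t +
      (unitaryBound t * (1 + 3 * (1 / (168 * (t + 1) ^ 2)))) ^ 2 * (offBound ε (t + 1) / 2) ≤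
      offBound ε (t + 1) := by
  have h0 := offBound_pos hε (t + 1)
  have h1 : offBound ε t = offBound ε (t + 1) * Real.exp 2 := by
    rw [offBound_succ, mul_assoc, ← Real.exp_add]; norm_num
  have h2 : (1 : ℝ) / (168 * (t + 1) ^ 2) ≤ 1 / 168 := by
    gcongr
    have : (1 : ℝ) ≤ (t + 1) ^ 2 := one_le_pow₀ (by linarith [(Nat.cast_nonneg t : (0 : ℝ) ≤ t)])
    linarith
  have h3 : (unitaryBound t * (1 + 3 * (1 / (168 * (t + 1) ^ 2)))) ^ 2 ≤ (5 / 4) ^ 2 := by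
    refine pow_le_pow_left₀ ?_ ((unitaryBound_step t).trans (unitaryBound_le _)) 2
    exact mul_nonneg (zero_le_one.trans (one_le_unitaryBound t)) (by positivity)
  calc _ ≤ 3 * (1 / 168) * (offBound ε (t + 1) * 8) + (5 / 4) ^ 2 * (offBound ε (t + 1) / 2) := by
        rw [h1]
        gcongr
        exact exp_two_le_eight
    _ ≤ _ := by linarith

/-- Bound for the block-diagonal part at stage `t`. -/
def diagBound (ε : ℝ) (t : ℕ) : ℝ := offBound ε 0 * (2 - (1 / 2) ^ t)

/-- Off-diagonal bounds decay by `e⁻² ≤ 1/2`, so the diagonal updates are dominated by a geometric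
series. -/
theorem diagBound_step {ε : ℝ} (hε : 0 < ε) (t : ℕ) :
    diagBound ε t + offBound ε (t + 1) ≤ diagBound ε (t + 1) := by
  have h : ∀ t, offBound ε t ≤ offBound ε 0 * (1 / 2) ^ t := fun t => by
    induction t with
    | zero => simp
    | succ t ih =>
      rw [offBound_succ, pow_succ, ← mul_assoc]
      have := offBound_pos hε t
      exact mul_le_mul ih (exp_neg_two_le.trans (by norm_num)) (Real.exp_nonneg _)
        (this.le.trans ih)
  have := h (t + 1)
  unfold diagBound
  rw [pow_succ] at *
  linarith

theorem diagBound_le {ε : ℝ} (hε : 0 < ε) (t : ℕ) : diagBound ε t ≤ 4 * Real.exp 1 * ε := by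
  have h1 : offBound ε 0 = 2 * Real.exp 1 * ε := by
    have : Real.exp 1 = Real.exp 3 * Real.exp (-2) := by rw [← Real.exp_add]; norm_num
    rw [this]; simp only [offBound, Nat.cast_zero, zero_add, mul_one]; ring
  have h2 : (0 : ℝ) ≤ (1 / 2) ^ t := by positivity
  have h3 := Real.exp_pos 1
  unfold diagBound
  rw [h1]
  nlinarith [mul_pos h3 hε, mul_nonneg (mul_pos h3 hε).le h2]

/-- Bound for the Lipschitz constant of the block-diagonal part at stage `t`. -/
def lipBound (t : ℕ) : ℝ := 1 / 4 - 1 / (4 * (t + 1))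

theorem lipBound_le (t : ℕ) : lipBound t ≤ 1 / 4 := by
  unfold lipBound
  have : (0 : ℝ) ≤ 1 / (4 * (t + 1)) := by positivity
  linarith

/-- An update of size `offBound`, in a norm that weights Lipschitz constants by `divisorSize`, costs
their ratio. The ratios telescope against `1/(4(t+1))`, which keeps the total below the `1/4`
required for expansion. -/
theorem lipBound_step {ε : ℝ} (hε : 0 < ε) (t : ℕ) :
    lipBound t + offBound ε (t + 1) / divisorSize ε t ≤ lipBound (t + 1) := by
  have h1 : offBound ε (t + 1) / divisorSize ε t ≤ 1 / (8 * (t + 1) ^ 2) := by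
    rw [offBound_succ, mul_div_right_comm, offBound_div_divisorSize hε]
    have h2 : Real.exp (-2) ≤ 1 := exp_neg_two_le.trans (by norm_num)
    calc _ ≤ (1 : ℝ) / (30 * (t + 1) ^ 2) * 1 := by gcongr
      _ ≤ _ := by rw [mul_one]; gcongr; norm_num
  have h2 := inv_succ_sub_inv_succ t
  have h3 : lipBound (t + 1) = 1 / 4 - 1 / (4 * ((t + 1 : ℕ) + 1)) := rfl
  have h4 : lipBound t = 1 / 4 - 1 / (4 * (t + 1)) := rfl
  linarith

theorem weightRate_nonneg (r : ℝ) (t : ℕ) : 0 ≤ weightRate r t := Real.exp_nonneg _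

/-- Half the decrement of the weight rate. -/
def rateDrop (r : ℝ) (t : ℕ) : ℝ := (1 - Real.exp (-(2 / r))) / 2 * weightRate r t

theorem weightRate_eq (r : ℝ) (t : ℕ) :
    weightRate r t = weightRate r (t + 1) + 2 * rateDrop r t := by
  have : weightRate r (t + 1) = Real.exp (-(2 / r)) * weightRate r t := by
    unfold weightRate
    rw [← Real.exp_add]; congr 1; push_cast; ring
  rw [this, rateDrop]; ring

theorem one_sub_exp_pos {r : ℝ} (hr : 0 < r) : 0 < 1 - Real.exp (-(2 / r)) := by
  have : Real.exp (-(2 / r)) < 1 := by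
    rw [Real.exp_lt_one_iff]
    have := div_pos two_pos hr
    linarith
  linarith

theorem rateDrop_pos {r : ℝ} (hr : 0 < r) (t : ℕ) : 0 < rateDrop r t :=
  mul_pos (half_pos (one_sub_exp_pos hr)) (Real.exp_pos _)

/-- The right side is the maximum of the left over `x`, attained at `x = a/c`; it follows from `y ≤
e^{y-1}` with `y = cx/a`. -/
theorem rpow_mul_exp_neg_le {a c x : ℝ} (ha : 0 < a) (hc : 0 < c) (hx : 0 < x) :
    x ^ a * Real.exp (-(c * x)) ≤ (a / (c * Real.exp 1)) ^ a := by
  have h1 : x * Real.exp (-(c * x / a)) ≤ a / (c * Real.exp 1) := by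
    have h2 := Real.add_one_le_exp (c * x / a - 1)
    have h3 : c * x / a ≤ Real.exp (c * x / a) / Real.exp 1 := by
      rw [← Real.exp_sub]; linarith
    have h4 : c * x * Real.exp 1 ≤ a * Real.exp (c * x / a) := by
      rw [div_le_div_iff₀ ha (Real.exp_pos 1)] at h3; linarith
    rw [Real.exp_neg, ← div_eq_mul_inv, div_le_div_iff₀ (Real.exp_pos _) (by positivity)]
    linarith
  calc x ^ a * Real.exp (-(c * x)) = (x * Real.exp (-(c * x / a))) ^ a := by
        rw [Real.mul_rpow hx.le (Real.exp_nonneg _), ← Real.exp_mul]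
        congr 2; field_simp
    _ ≤ _ := Real.rpow_le_rpow (by positivity) h1 ha.le

end Constants

end Floquet
end

noncomputable section

namespace Floquet

open Filter Topology

/-! ### The iteration and its limit -/

section Iteration

variable {E : Type*} [NormedAddCommGroup E] [InnerProductSpace ℂ E] [CompleteSpace E]

theorem Stage.mono {G : ℕ → Type*} [∀ n, NormedAddCommGroup (G n)]
    [∀ n, InnerProductSpace ℂ (G n)] [∀ n, CompleteSpace (G n)] {h : ℕ → ℝ}
    {Vs : SeqSpace G →L[ℂ] SeqSpace G} {Ω : Set ℝ} {φ x : ℝ}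
    {U W D : ℝ → SeqSpace G →L[ℂ] SeqSpace G} {u o d L u' o' d' L' : ℝ}
    (S : Stage h Vs Ω φ x U W D u o d L) (hu : u ≤ u') (ho : o ≤ o') (hd : d ≤ d') (hL : L ≤ L') :
    Stage h Vs Ω φ x U W D u' o' d' L' where
  __ := S
  rowNorm_unitary := S.rowNorm_unitary.trans (ENNReal.ofReal_le_ofReal hu)
  rowNorm_star := S.rowNorm_star.trans (ENNReal.ofReal_le_ofReal hu)
  rowNorm_sub_diag := S.rowNorm_sub_diag.trans (ENNReal.ofReal_le_ofReal ho)
  norm_diag := fun ω hω i => (S.norm_diag ω hω i).trans hd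
  lipschitz_diag := fun ω hω ω' hω' i => (S.lipschitz_diag ω hω ω' hω' i).trans (by gcongr)

/-- The measure of the resonant frequencies removed at stage `t`, up to the factor `Δ_σ(J)`. -/
def removedBound (σ r ε : ℝ) (t : ℕ) : ℝ :=
  16 * (divisorSize ε t * ((σ + 1 / 2) / (rateDrop r t * Real.exp 1)) ^ (σ + 1 / 2)) * 2 ^ σ

/-- `960 = 16 · 60`. The factor `e^{-2(t+1)}` of the divisor size competes with the power `σ + 1/2`
of the reciprocal rate drop, which grows like `e^{2(t+1)/r}`; the net exponent is a multiple of `r -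
σ - 1/2`. -/
theorem removedBound_eq {σ r ε : ℝ} (hr : 0 < r) (hσ : 0 < σ) (t : ℕ) :
    removedBound σ r ε t = 960 * Real.exp 5 * 2 ^ σ *
      ((2 * σ + 1) / ((1 - Real.exp (-(2 / r))) * Real.exp 1)) ^ (σ + 1 / 2) * ε *
      (((t : ℝ) + 1) ^ 2 * Real.exp (-(2 / r * (r - σ - 1 / 2) * ((t : ℝ) + 1)))) := by
  have hq := one_sub_exp_pos hr
  have h1 : (σ + 1 / 2) / (rateDrop r t * Real.exp 1) =
      (2 * σ + 1) / ((1 - Real.exp (-(2 / r))) * Real.exp 1) *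
        Real.exp (2 * (t + 1) / r) := by
    unfold rateDrop weightRate
    rw [Real.exp_neg (2 * _ / r)]
    push_cast
    field_simp
  rw [removedBound, h1, Real.mul_rpow (by positivity) (Real.exp_nonneg _), ← Real.exp_mul,
    divisorSize]
  have h2 : Real.exp (-(2 / r * (r - σ - 1 / 2) * ((t : ℝ) + 1))) =
      Real.exp (-(2 * (t + 1))) * Real.exp (2 * (t + 1) / r * (σ + 1 / 2)) := by
    rw [← Real.exp_add]; congr 1; field_simp; ring
  rw [h2]; ring

theorem summable_sq_mul_exp {a : ℝ} (ha : 0 < a) :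
    Summable fun t : ℕ => ((t : ℝ) + 1) ^ 2 * Real.exp (-(a * ((t : ℝ) + 1))) := by
  have h := Real.summable_pow_mul_exp_neg_nat_mul 2 ha
  have h' := (summable_nat_add_iff 1).2 h
  refine h'.congr fun t => ?_
  push_cast
  ring_nf

/-- The iteration needs only the constant `960`; `deltaStar` has `1440`. -/
theorem tsum_removedBound_le {σ r ε S : ℝ} (hσ : 0 < σ) (hr : σ + 1 / 2 < r) (hε : 0 < ε)
    (hS : 0 ≤ S) :
    ∑' t, ENNReal.ofReal (removedBound σ r ε t) * ENNReal.ofReal S ≤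
      ENNReal.ofReal (deltaStar σ r S * ε) := by
  have hr0 : 0 < r := by linarith
  have hq := one_sub_exp_pos hr0
  have hs := summable_sq_mul_exp (a := 2 / r * (r - σ - 1 / 2))
    (mul_pos (by positivity) (by linarith))
  simp only [removedBound_eq hr0 hσ]
  set c := ((2 * σ + 1) / ((1 - Real.exp (-(2 / r))) * Real.exp 1)) ^ (σ + 1 / 2) with hc
  have hc0 : 0 ≤ c := by positivity
  rw [ENNReal.tsum_mul_right, ← ENNReal.ofReal_tsum_of_nonneg (fun t => by positivity)
    (hs.mul_left _), ← ENNReal.ofReal_mul (tsum_nonneg fun t => by positivity), tsum_mul_left]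
  refine ENNReal.ofReal_le_ofReal ?_
  rw [deltaStar, ← hc]
  set T := ∑' t : ℕ, ((t : ℝ) + 1) ^ 2 * Real.exp (-(2 / r * (r - σ - 1 / 2) * ((t : ℝ) + 1)))
  have hT : 0 ≤ T := tsum_nonneg fun t => by positivity
  calc _ = 960 * (Real.exp 5 * 2 ^ σ * c * T * S * ε) := by ring
    _ ≤ 1440 * (Real.exp 5 * 2 ^ σ * c * T * S * ε) := by gcongr; norm_num
    _ = _ := by ring

variable (H : Hamiltonian E)

/-- The step of the iteration, with explicit constants. -/
theorem exists_next_stage {J σ r ε : ℝ} (hJ : 0 < J) (hσ : 0 < σ) (hr : 0 < r) (hε : 0 < ε)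
    (hεs : ε < epsStar H.gap J) {V : SeqSpace (fun n => H.level n) →L[ℂ] SeqSpace fun n => H.level n}
    (hVs : IsSelfAdjoint V) (hVt : IsToeplitz V) (hV : RegularityBound V r ε) (t : ℕ)
    {Ω : Set ℝ} (hΩ : Ω ⊆ frequencies J) (hΩm : MeasurableSet Ω)
    {U W D : ℝ → SeqSpace (fun n => H.level n) →L[ℂ] SeqSpace fun n => H.level n}
    (S : Stage H.h (cut r V (t + 1)) Ω (divisorSize ε (t - 1)) (weightRate r t) U W D
      (unitaryBound t) (offBound ε t) (diagBound ε t) (lipBound t)) :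
    ∃ Ω' ⊆ Ω, MeasurableSet Ω' ∧
      volume (Ω \ Ω') ≤ ENNReal.ofReal (removedBound σ r ε t) * H.gapSum σ J ∧
      ∃ U' W' D' : ℝ → SeqSpace (fun n => H.level n) →L[ℂ] SeqSpace fun n => H.level n,
        Stage H.h (cut r V (t + 2)) Ω' (divisorSize ε t) (weightRate r (t + 1)) U' W' D'
          (unitaryBound (t + 1)) (offBound ε (t + 1)) (diagBound ε (t + 1)) (lipBound (t + 1)) ∧
        ∀ ω ∈ Ω', ‖U' ω - U ω‖ ≤ 2 * (1 / (168 * ((t : ℝ) + 1) ^ 2)) ∧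
          ‖D' ω - D ω‖ ≤ offBound ε (t + 1) := by
  set γ := divisorSize ε t with hγdef
  have hγ : 0 < γ := divisorSize_pos hε t
  set c := rateDrop r t with hcdef
  have hc : 0 < c := rateDrop_pos hr t
  set g : ℕ → ℝ := fun k => γ * √(max 1 (k : ℝ)) * Real.exp (-(c * k)) with hg
  have hg0 : ∀ k, 0 ≤ g k := fun k => by positivity
  -- The divisor size is at most `60 e³ ε` and twice the diagonal bound at most `(8/7) e³ ε`. Their
  -- sum is below `270/4 · e³ ε`, hence below the gap, and below `7/18` of `270 e³ ε`, hence below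
  -- `(7/18) J`.
  have hsmall1 : 270 * Real.exp 3 * ε < 4 * H.gap ∧ 270 * Real.exp 3 * ε < J := by
    rw [epsStar, lt_div_iff₀ (by positivity), lt_min_iff] at hεs
    exact ⟨by linarith [hεs.1], by linarith [hεs.2]⟩
  have he3 : Real.exp 3 = Real.exp 1 * Real.exp 2 := by rw [← Real.exp_add]; norm_num
  have hd : diagBound ε t * 7 ≤ 4 * (Real.exp 3 * ε) := by
    have h1 := diagBound_le hε t
    have h2 := mul_le_mul_of_nonneg_right seven_le_exp_two
      (mul_nonneg (Real.exp_nonneg 1) hε.le)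
    rw [he3]
    nlinarith
  have hγle := divisorSize_le hε t
  rw [← hγdef] at hγle
  set A := γ * ((σ + 1 / 2) / (c * Real.exp 1)) ^ (σ + 1 / 2) with hA
  obtain ⟨Ω', hΩ', hΩ'm, hvol, hlow⟩ := exists_nonresonant_subset H hJ (A := A) (by positivity) hσ hΩ
    hΩm (fun ω n => block (D ω) (0, n) (0, n))
    (fun ω hω n => isSelfAdjoint_block_diag (S.selfAdjoint_diag ω hω) (0, n))
    (fun ω hω n => S.norm_diag ω hω (0, n))
    (fun ω hω ω' hω' n => (S.lipschitz_diag ω hω ω' hω' (0, n)).trans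
      (by gcongr; exact lipBound_le t)) hg0
    (by
      simp only [hg, Nat.cast_zero, max_eq_left zero_le_one, Real.sqrt_one, mul_one, mul_zero,
        neg_zero, Real.exp_zero]
      nlinarith [mul_pos (Real.exp_pos 3) hε])
    (fun k hk => by
      have hk' : (1 : ℝ) ≤ k := by exact_mod_cast hk
      have h1 : g k ≤ γ * k := by
        simp only [hg, max_eq_right hk']
        have h2 : √(k : ℝ) ≤ k := by
          rw [Real.sqrt_le_left (by positivity)]; nlinarith
        have h3 : Real.exp (-(c * k)) ≤ 1 := by
          rw [Real.exp_le_one_iff]; have : 0 ≤ c * k := by positivity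
          linarith
        calc γ * √(k : ℝ) * Real.exp (-(c * k)) ≤ γ * k * 1 := by gcongr
          _ = _ := mul_one _
      have h4 : J ≤ J * k := le_mul_of_one_le_right hJ.le hk'
      have h5 : γ * k ≤ 60 / 270 * J * k := by
        gcongr
        linarith [hsmall1.2]
      nlinarith [hsmall1.2])
    -- The polynomial envelope `A k^{-σ}` of `γ √k e^{-ck}` amounts to bounding `k^{σ+1/2} e^{-ck}`
    -- by its maximum.
    (fun k hk => by
      have hk' : (1 : ℝ) ≤ k := by exact_mod_cast hk
      have hk0 : (0 : ℝ) < k := by linarith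
      simp only [hg, max_eq_right hk', hA, mul_assoc]
      refine mul_le_mul_of_nonneg_left ?_ hγ.le
      have h1 := rpow_mul_exp_neg_le (a := σ + 1 / 2) (by positivity) hc hk0
      rw [Real.sqrt_eq_rpow, Real.rpow_neg hk0.le, ← div_eq_mul_inv, le_div_iff₀ (by positivity)]
      refine le_trans (le_of_eq ?_) h1
      rw [Real.rpow_add hk0]; ring)
  refine ⟨Ω', hΩ', hΩ'm, hvol, ?_⟩
  have hVdiff : IsSelfAdjoint (cut r V (t + 2) - cut r V (t + 1)) :=
    isSelfAdjoint_cut_sub hVs hV _ _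
  have hVtdiff : IsToeplitz (cut r V (t + 2) - cut r V (t + 1)) :=
    (isToeplitz_cut hVs hVt hV _).sub (isToeplitz_cut hVs hVt hV _)
  have hVn : rowNorm Ω' (ENNReal.ofReal γ) (expWeight (weightRate r (t + 1)))
      (fun _ => cut r V (t + 2) - cut r V (t + 1)) ≤ ENNReal.ofReal (offBound ε (t + 1) / 2) := by
    refine (rowNorm_cut_succ_sub_le hr hVs hV (t + 1)).trans (ENNReal.ofReal_le_ofReal (le_of_eq ?_))
    unfold offBound
    have e : Real.exp 1 * Real.exp (-(2 * (t + 1 : ℕ))) =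
        Real.exp 3 * Real.exp (-(2 * ((t + 1 : ℕ) + 1))) := by
      rw [← Real.exp_add, ← Real.exp_add]; congr 1; push_cast; ring
    rw [e]; ring
  have hbb : (1 : ℝ) / (168 * (t + 1) ^ 2) ≤ 1 / 100 := by
    gcongr
    have : (1 : ℝ) ≤ (t + 1) ^ 2 := one_le_pow₀ (by linarith [(Nat.cast_nonneg t : (0 : ℝ) ≤ t)])
    linarith
  -- At `t = 0` the truncated subtraction `t - 1` gives the same divisor size, so the required
  -- monotonicity also holds at the start.
  obtain ⟨U', W', D', hS', hdist⟩ := S.step hΩ' (V' := cut r V (t + 2) - cut r V (t + 1)) hγ hc.le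
    (weightRate_nonneg r (t + 1)) (weightRate_eq r t) (divisorSize_antitone hε (t.sub_le 1))
    (lipBound_le t) (zero_le_one.trans (one_le_unitaryBound t)) (offBound_pos hε t).le
    (step_ratio_le hε t) hbb
    (fun ω hω i j hij Z => by
      obtain ⟨k, n⟩ := i
      obtain ⟨l, m⟩ := j
      have hne : k - l ≠ 0 ∨ n ≠ m := by
        by_contra! hh
        exact hij (Prod.ext (by simpa [sub_eq_zero] using hh.1) hh.2)
      have := hlow ω hω (k - l) n m hne Z
      have e : modeEnergy H.h ω (k, n) - modeEnergy H.h ω (l, m) =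
          ω * ((k - l : ℤ) : ℝ) + H.h n - H.h m := by
        simp only [modeEnergy]; push_cast; ring
      -- Shift invariance makes the divisor depend only on `k - l`, `n`, `m`, so each resonance is
      -- excised once and not for every pair of Fourier indices.
      rw [e, (S.toeplitz_diag ω (hΩ' hω)).block_diag k n, (S.toeplitz_diag ω (hΩ' hω)).block_diag l m]
      exact this)
    hVdiff hVtdiff (half_pos (offBound_pos hε (t + 1))).le hVn
  rw [add_sub_cancel] at hS'
  have hstep := offBound_step hε t
  refine ⟨U', W', D', hS'.mono (unitaryBound_step t) hstep ?_ ?_, fun ω hω =>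
    ⟨(hdist ω hω).1, (hdist ω hω).2.trans hstep⟩⟩
  · exact (add_le_add_right hstep _).trans (diagBound_step hε t)
  · refine le_trans ?_ (lipBound_step hε t)
    gcongr

end Iteration

end Floquet
end

noncomputable section

namespace Floquet

open Filter Topology

/-! ### Initial stage and norm limit of the iteration -/

section Limit

variable {G : ℕ → Type*} [∀ n, NormedAddCommGroup (G n)] [∀ n, InnerProductSpace ℂ (G n)]
  [∀ n, CompleteSpace (G n)] {V : SeqSpace G →L[ℂ] SeqSpace G} {r ε : ℝ}

/-- The stage at which the iteration starts. -/
theorem initial_stage (h : ℕ → ℝ) (hε : 0 < ε) (hVs : IsSelfAdjoint V) (hVt : IsToeplitz V)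
    (hV : RegularityBound V r ε) (Ω : Set ℝ) (φ : ℝ) :
    Stage h (cut r V 1) Ω φ (weightRate r 0) (fun _ => 1) (fun _ => cut r V 1)
      (fun _ => mask (· = ·) (cut r V 1)) (unitaryBound 0) (offBound ε 0) (diagBound ε 0)
      (lipBound 0) := by
  have hsymm : ∀ i j : ℤ × ℕ, i = j → j = i := fun i j h => h.symm
  have hs := isSelfAdjoint_cut hVs hV 1
  have ht := isToeplitz_cut hVs hVt hV 1
  have hN : ∀ {Ω : Set ℝ} {φ : ℝ≥0∞}, rowNorm Ω φ (expWeight (weightRate r 0))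
      (fun _ => cut r V 1) ≤ ENNReal.ofReal (offBound ε 0) := fun {Ω φ} => by
    refine le_trans (by simpa [weightRate] using rowNorm_cut_one_le hVs hV)
      (ENNReal.ofReal_le_ofReal ?_)
    have e : Real.exp 1 = Real.exp 3 * Real.exp (-2) := by rw [← Real.exp_add]; norm_num
    rw [e]
    simp only [offBound, Nat.cast_zero, zero_add, mul_one]
    nlinarith [mul_pos (mul_pos (Real.exp_pos 3) (Real.exp_pos (-2))) hε]
  have hw := one_le_expWeight (weightRate_nonneg r 0)
  have hC : ∀ i, ∑' j, ‖block (cut r V 1) i j‖ₑ ≤ ENNReal.ofReal (offBound ε 0) := fun i =>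
    (tsum_enorm_block_le_rowNorm (X := fun _ => cut r V 1) hw (mem_univ (0 : ℝ)) i).trans
      (hN (Ω := univ) (φ := 0))
  have hM : ∀ i j, block (mask (· = ·) (cut r V 1)) i j =
      if i = j then block (cut r V 1) i j else 0 := fun i j => by
    rw [block_mask hsymm hs ENNReal.ofReal_ne_top hC]
    congr
  have hu : unitaryBound 0 = 1 := by norm_num [unitaryBound]
  have hone : rowNorm Ω (ENNReal.ofReal φ) (expWeight (weightRate r 0))
      (fun _ => (1 : SeqSpace G →L[ℂ] SeqSpace G)) ≤ ENNReal.ofReal (unitaryBound 0) := by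
    rw [hu, ENNReal.ofReal_one]
    exact rowNorm_one_le (expWeight_self _)
  refine ⟨fun _ _ => by simp, fun _ _ => by simp, fun _ _ => IsToeplitz.one, fun _ _ => hs,
    fun _ _ => ht, fun _ _ => isSelfAdjoint_mask hsymm hs ENNReal.ofReal_ne_top hC,
    fun _ _ => isToeplitz_mask hsymm (fun k l n m => by simp) hs ht ENNReal.ofReal_ne_top hC,
    fun _ _ i j hij => by rw [hM, if_neg hij], fun _ _ i => by rw [block_sub, hM, if_pos rfl, sub_self],
    fun _ _ => ?_, hone, by simpa only [star_one] using hone, ?_, fun _ _ i => ?_,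
    fun _ _ _ _ i => ?_⟩
  · rw [one_mul, mul_one, sub_self]
    exact fun i j => by
      have := IsCommutator.one (lam := modeEnergy h ‹ℝ›) (G := fun i : ℤ × ℕ => G i.2) i j
      exact this
  · refine (rowNorm_le_of_block_eq_or fun i j => ?_).trans hN
    by_cases hij : i = j
    · right; intro ω hω; rw [block_sub, hM, if_pos hij, sub_self]
    · left; intro ω hω; rw [block_sub, hM, if_neg hij, sub_zero]
  · have hd : diagBound ε 0 = offBound ε 0 := by norm_num [diagBound]
    rw [hM, if_pos rfl, hd]
    have h1 := (ENNReal.le_tsum (f := fun j => ‖block (cut r V 1) i j‖ₑ) i).trans (hC i)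
    rw [← ofReal_norm] at h1
    exact (ENNReal.ofReal_le_ofReal_iff (offBound_pos hε 0).le).1 h1
  · rw [sub_self, norm_zero]
    norm_num [lipBound]

theorem summable_offBound (ε : ℝ) : Summable fun t : ℕ => offBound ε t := by
  have h := (summable_geometric_of_lt_one (Real.exp_nonneg (-2))
    (Real.exp_lt_one_iff.2 (by norm_num))).mul_left (2 * Real.exp 3 * ε * Real.exp (-2))
  refine h.congr fun t => ?_
  rw [offBound, ← Real.exp_nat_mul, mul_assoc, ← Real.exp_add]
  congr 2
  ring

theorem tendsto_of_norm_sub_le {F : Type*} [NormedAddCommGroup F] [CompleteSpace F] {x : ℕ → F}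
    {b : ℕ → ℝ} (hb : Summable b) (h : ∀ t, ‖x (t + 1) - x t‖ ≤ b t) :
    ∃ y, Tendsto x atTop (𝓝 y) :=
  cauchySeq_tendsto_of_complete
    (cauchySeq_of_dist_le_of_summable b (fun t => by rw [dist_comm, dist_eq_norm]; exact h t) hb)

/-- The limit of the iteration at a fixed frequency. -/
theorem exists_limit {lam : ℤ × ℕ → ℝ} (hr : 0 < r) (hε : 0 < ε) (hVs : IsSelfAdjoint V)
    (hV : RegularityBound V r ε) {U W D : ℕ → SeqSpace G →L[ℂ] SeqSpace G}
    (hU : ∀ t, star (U t) * U t = 1) (hU' : ∀ t, U t * star (U t) = 1)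
    (hDs : ∀ t, IsSelfAdjoint (D t)) (hDd : ∀ t i j, i ≠ j → block (D t) i j = 0)
    (hc : ∀ t, IsCommutator lam (U t) (U t * cut r V (t + 1) - W t * U t))
    (hUU : ∀ t, ‖U (t + 1) - U t‖ ≤ 2 * (1 / (168 * ((t : ℝ) + 1) ^ 2)))
    (hDD : ∀ t, ‖D (t + 1) - D t‖ ≤ offBound ε (t + 1))
    (hWD : ∀ t, ‖W t - D t‖ ≤ offBound ε t) :
    ∃ U D : SeqSpace G →L[ℂ] SeqSpace G, star U * U = 1 ∧ U * star U = 1 ∧ IsSelfAdjoint D ∧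
      (∀ i j, i ≠ j → block D i j = 0) ∧ IsCommutator lam U (U * V - D * U) := by
  have hs : Summable fun t : ℕ => 2 * (1 / (168 * ((t : ℝ) + 1) ^ 2)) := by
    have h := (summable_nat_add_iff 1).2 (Real.summable_one_div_nat_pow.2 one_lt_two)
    refine (h.mul_left (1 / 84)).congr fun t => ?_
    push_cast
    field_simp
    norm_num
  obtain ⟨A, hA⟩ := tendsto_of_norm_sub_le hs hUU
  obtain ⟨B, hB⟩ := tendsto_of_norm_sub_le ((summable_nat_add_iff 1).2 (summable_offBound ε)) hDD
  -- The off-diagonal part tends to zero, so `W` has the same, block-diagonal, limit as `D`.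
  have hWlim : Tendsto W atTop (𝓝 B) := by
    have h0 : Tendsto (fun t => W t - D t) atTop (𝓝 0) :=
      squeeze_zero_norm hWD (summable_offBound ε).tendsto_atTop_zero
    simpa using h0.add hB
  have hVlim : Tendsto (fun t : ℕ => cut r V (t + 1)) atTop (𝓝 V) := by
    rw [tendsto_iff_norm_sub_tendsto_zero]
    refine squeeze_zero (fun _ => norm_nonneg _) (g := fun t : ℕ => offBound ε t) (fun t => ?_)
      (summable_offBound ε).tendsto_atTop_zero
    rw [norm_sub_rev]
    refine (norm_sub_cut_le hr hε.le hVs hV (t + 1)).trans ?_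
    have h1 : (1 : ℝ) ≤ 2 * Real.exp 3 := by
      have := Real.one_le_exp (show (0 : ℝ) ≤ 3 by norm_num)
      linarith
    rw [offBound]
    push_cast
    calc Real.exp (-(2 * ((t : ℝ) + 1))) * ε = 1 * (Real.exp (-(2 * ((t : ℝ) + 1))) * ε) := by ring
      _ ≤ 2 * Real.exp 3 * (Real.exp (-(2 * ((t : ℝ) + 1))) * ε) := by gcongr
      _ = _ := by ring
  have hAs : Tendsto (fun t => star (U t)) atTop (𝓝 (star A)) := (continuous_star.tendsto _).comp hA
  have e1 := tendsto_nhds_unique (hAs.mul hA) (tendsto_const_nhds.congr fun t => (hU t).symm)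
  have e2 := tendsto_nhds_unique (hA.mul hAs) (tendsto_const_nhds.congr fun t => (hU' t).symm)
  have e3 := tendsto_nhds_unique ((continuous_star.tendsto _).comp hB)
    (hB.congr fun t => (hDs t).star_eq.symm)
  refine ⟨A, B, e1, e2, e3, fun i j hij => ?_,
    IsCommutator.of_tendsto hc hA ((hA.mul hVlim).sub (hWlim.mul hA))⟩
  have h1 := ((blockL i j).continuous.tendsto _).comp hB
  exact tendsto_nhds_unique h1 (tendsto_const_nhds.congr fun t => (hDd t i j hij).symm)

/-- Iterating an available step, and passing to the limit. -/
theorem exists_diagonalization_of_step {h : ℕ → ℝ} (hr : 0 < r) (hε : 0 < ε)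
    (hVs : IsSelfAdjoint V) (hVt : IsToeplitz V) (hV : RegularityBound V r ε) {Ω₀ : Set ℝ}
    (hΩ₀ : MeasurableSet Ω₀) {c : ℕ → ℝ≥0∞}
    (step : ∀ t Ω, Ω ⊆ Ω₀ → MeasurableSet Ω → ∀ U W D : ℝ → SeqSpace G →L[ℂ] SeqSpace G,
      Stage h (cut r V (t + 1)) Ω (divisorSize ε (t - 1)) (weightRate r t) U W D
        (unitaryBound t) (offBound ε t) (diagBound ε t) (lipBound t) →
      ∃ Ω' ⊆ Ω, MeasurableSet Ω' ∧ volume (Ω \ Ω') ≤ c t ∧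
        ∃ U' W' D' : ℝ → SeqSpace G →L[ℂ] SeqSpace G,
          Stage h (cut r V (t + 2)) Ω' (divisorSize ε t) (weightRate r (t + 1)) U' W' D'
            (unitaryBound (t + 1)) (offBound ε (t + 1)) (diagBound ε (t + 1)) (lipBound (t + 1)) ∧
          ∀ ω ∈ Ω', ‖U' ω - U ω‖ ≤ 2 * (1 / (168 * ((t : ℝ) + 1) ^ 2)) ∧
            ‖D' ω - D ω‖ ≤ offBound ε (t + 1)) :
    ∃ Ω ⊆ Ω₀, MeasurableSet Ω ∧ volume (Ω₀ \ Ω) ≤ ∑' t, c t ∧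
      ∀ ω ∈ Ω, ∃ U D : SeqSpace G →L[ℂ] SeqSpace G, star U * U = 1 ∧ U * star U = 1 ∧
        IsSelfAdjoint D ∧ (∀ i j, i ≠ j → block D i j = 0) ∧
        IsCommutator (modeEnergy h ω) U (U * V - D * U) := by
  -- The invariants are bundled with the data, so that choosing a successor defines the sequence of
  -- stages by recursion.
  let State := fun t : ℕ => {p : Set ℝ × (ℝ → SeqSpace G →L[ℂ] SeqSpace G) ×
    (ℝ → SeqSpace G →L[ℂ] SeqSpace G) × (ℝ → SeqSpace G →L[ℂ] SeqSpace G) //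
    p.1 ⊆ Ω₀ ∧ MeasurableSet p.1 ∧
    Stage h (cut r V (t + 1)) p.1 (divisorSize ε (t - 1)) (weightRate r t) p.2.1 p.2.2.1 p.2.2.2
      (unitaryBound t) (offBound ε t) (diagBound ε t) (lipBound t)}
  have hstep : ∀ (t : ℕ) (s : State t), ∃ s' : State (t + 1), s'.1.1 ⊆ s.1.1 ∧
      volume (s.1.1 \ s'.1.1) ≤ c t ∧ ∀ ω ∈ s'.1.1,
        ‖s'.1.2.1 ω - s.1.2.1 ω‖ ≤ 2 * (1 / (168 * ((t : ℝ) + 1) ^ 2)) ∧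
        ‖s'.1.2.2.2 ω - s.1.2.2.2 ω‖ ≤ offBound ε (t + 1) := by
    rintro t ⟨⟨Ω, U, W, D⟩, hΩ, hΩm, S⟩
    obtain ⟨Ω', hΩ', hΩ'm, hvol, U', W', D', S', hd⟩ := step t Ω hΩ hΩm U W D S
    exact ⟨⟨⟨Ω', U', W', D'⟩, hΩ'.trans hΩ, hΩ'm, S'⟩, hΩ', hvol, hd⟩
  choose next hnext1 hnext2 hnext3 using hstep
  let seq : ∀ t, State t := fun t => Nat.rec
    ⟨⟨Ω₀, fun _ => 1, fun _ => cut r V 1, fun _ => mask (· = ·) (cut r V 1)⟩, subset_rfl, hΩ₀,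
      initial_stage h hε hVs hVt hV Ω₀ _⟩ next t
  have hseq : ∀ t, seq (t + 1) = next t (seq t) := fun t => rfl
  refine ⟨⋂ t, (seq t).1.1, iInter_subset _ 0, MeasurableSet.iInter fun t => (seq t).2.2.1, ?_,
    fun ω hω => ?_⟩
  · have hsub : Ω₀ \ ⋂ t, (seq t).1.1 ⊆ ⋃ t, (seq t).1.1 \ (seq (t + 1)).1.1 := by
      rintro ω ⟨hω, hn⟩
      by_contra hcon
      refine hn (mem_iInter.2 fun t => ?_)
      induction t with
      | zero => exact hω
      | succ t ih =>
        by_contra hh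
        exact hcon (mem_iUnion.2 ⟨t, ih, hh⟩)
    refine (measure_mono hsub).trans ((measure_iUnion_le _).trans
      (ENNReal.tsum_le_tsum fun t => ?_))
    rw [hseq]
    exact hnext2 t (seq t)
  · have hm : ∀ t, ω ∈ (seq t).1.1 := mem_iInter.1 hω
    have S := fun t => (seq t).2.2.2
    refine exists_limit (U := fun t => (seq t).1.2.1 ω) (W := fun t => (seq t).1.2.2.1 ω)
      (D := fun t => (seq t).1.2.2.2 ω) hr hε hVs hV
      (fun t => (S t).star_mul_self ω (hm t)) (fun t => (S t).mul_star_self ω (hm t))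
      (fun t => (S t).selfAdjoint_diag ω (hm t)) (fun t => (S t).block_diag ω (hm t))
      (fun t => (S t).commutator ω (hm t)) (fun t => ?_) (fun t => ?_) fun t => ?_
    · exact (hnext3 t (seq t) ω (hm (t + 1))).1
    · exact (hnext3 t (seq t) ω (hm (t + 1))).2
    · exact norm_le_of_rowNorm_le (X := fun ω => (seq t).1.2.2.1 ω - (seq t).1.2.2.2 ω)
        (one_le_expWeight (weightRate_nonneg r t)) (hm t)
        (enorm_block_symm (((S t).selfAdjoint_total ω (hm t)).sub
          ((S t).selfAdjoint_diag ω (hm t)))) (offBound_pos hε t).le (S t).rowNorm_sub_diag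

end Limit

/-- For most frequencies, `K + V` is unitarily equivalent to a block-diagonal operator. -/
theorem exists_diagonalization {E : Type*} [NormedAddCommGroup E] [InnerProductSpace ℂ E]
    [CompleteSpace E] (H : Hamiltonian E) {J σ r ε : ℝ} (hJ : 0 < J) (hσ : 0 < σ)
    (hr : σ + 1 / 2 < r) (hε : 0 < ε) (hεs : ε < epsStar H.gap J) (hsum : H.gapSum σ J ≠ ⊤)
    {V : SeqSpace (fun n => H.level n) →L[ℂ] SeqSpace fun n => H.level n}
    (hVs : IsSelfAdjoint V) (hVt : IsToeplitz V) (hV : RegularityBound V r ε) :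
    ∃ Ω ⊆ frequencies J, MeasurableSet Ω ∧ volume (frequencies J \ Ω) ≤
        ENNReal.ofReal (deltaStar σ r (H.gapSum σ J).toReal * ε) ∧
      ∀ ω ∈ Ω, ∃ U D : SeqSpace (fun n => H.level n) →L[ℂ] SeqSpace fun n => H.level n,
        star U * U = 1 ∧ U * star U = 1 ∧ IsSelfAdjoint D ∧ (∀ i j, i ≠ j → block D i j = 0) ∧
        IsCommutator (modeEnergy H.h ω) U (U * V - D * U) := by
  have hr0 : 0 < r := by linarith
  obtain ⟨Ω, hΩ, hΩm, hvol, hlim⟩ := exists_diagonalization_of_step (h := H.h) hr0 hε hVs hVt hV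
    (Ω₀ := frequencies J) measurableSet_Icc fun t Ω hΩ hΩm U W D S =>
      exists_next_stage H hJ hσ hr0 hε hεs hVs hVt hV t hΩ hΩm S
  refine ⟨Ω, hΩ, hΩm, hvol.trans ?_, hlim⟩
  have := tsum_removedBound_le hσ hr hε (S := (H.gapSum σ J).toReal) ENNReal.toReal_nonneg
  rwa [ENNReal.ofReal_toReal hsum] at this

end Floquet
end

noncomputable section

namespace Floquet

/-! ### Bounded perturbations of operators that are diagonal in some coordinates -/

section DiagonalOperator

variable {I : Type*} {G : I → Type*} [∀ i, NormedAddCommGroup (G i)]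
  [∀ i, InnerProductSpace ℂ (G i)] {F : Type*} [NormedAddCommGroup F] [InnerProductSpace ℂ F]
  {Φ : F ≃ₗᵢ[ℂ] lp G 2} {lam : I → ℝ} {K : F →ₗ.[ℂ] F} {B : F →ₗ[ℂ] F} {X : lp G 2 →L[ℂ] lp G 2}

theorem mem_graph_vadd_iff
    (hK : ∀ f g, (f, g) ∈ K.graph ↔ ∀ i, Φ g i = (lam i : ℂ) • Φ f i)
    (hB : ∀ f, Φ (B f) = X (Φ f)) (f g : F) :
    (f, g) ∈ (B +ᵥ K).graph ↔ ∀ i, Φ g i = X (Φ f) i + (lam i : ℂ) • Φ f i := by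
  have h1 : (f, g) ∈ (B +ᵥ K).graph ↔ (f, g - B f) ∈ K.graph := by
    rw [LinearPMap.mem_graph_iff, LinearPMap.mem_graph_iff]
    constructor
    · rintro ⟨y, rfl, h⟩
      refine ⟨y, rfl, ?_⟩
      dsimp only at h ⊢
      rw [← h, LinearPMap.vadd_apply, add_sub_cancel_left]
    · rintro ⟨y, rfl, h⟩
      refine ⟨y, rfl, ?_⟩
      rw [LinearPMap.vadd_apply]
      exact (congrArg _ h).trans (add_sub_cancel _ _)
  rw [h1, hK]
  refine forall_congr' fun i => ?_
  rw [map_sub, hB, lp.coeFn_sub, Pi.sub_apply, sub_eq_iff_eq_add']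

variable [DecidableEq I] [∀ i, CompleteSpace (G i)] [CompleteSpace F]

/-- Single-block vectors lie in the domain: they make it dense, and testing the adjoint on them
returns the blockwise description of the graph. Conversely, real entries and a self-adjoint `X` make
the pairing symmetric. -/
theorem isSelfAdjoint_vadd
    (hK : ∀ f g, (f, g) ∈ K.graph ↔ ∀ i, Φ g i = (lam i : ℂ) • Φ f i)
    (hB : ∀ f, Φ (B f) = X (Φ f)) (hX : IsSelfAdjoint X) : IsSelfAdjoint (B +ᵥ K) := by
  have hsing : ∀ i (v : G i), (Φ.symm (lp.single 2 i v),
      Φ.symm (X (lp.single 2 i v) + (lam i : ℂ) • lp.single 2 i v)) ∈ (B +ᵥ K).graph := by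
    intro i v
    rw [mem_graph_vadd_iff hK hB]
    intro j
    simp only [LinearIsometryEquiv.apply_symm_apply, lp.coeFn_add, lp.coeFn_smul, Pi.add_apply,
      Pi.smul_apply]
    rcases eq_or_ne j i with rfl | hji
    · rfl
    · rw [lp.single_apply_ne _ _ _ hji, smul_zero, smul_zero]
  have hsymm : ∀ x y : lp G 2, inner ℂ (X x) y = inner ℂ x (X y) := fun x y => by
    rw [← ContinuousLinearMap.adjoint_inner_left, ← ContinuousLinearMap.star_eq_adjoint, hX.star_eq]
  have hdense : Dense ((B +ᵥ K).domain : Set F) := by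
    rw [Submodule.dense_iff_topologicalClosure_eq_top, Submodule.topologicalClosure_eq_top_iff,
      Submodule.eq_bot_iff]
    intro f hf
    rw [Submodule.mem_orthogonal] at hf
    refine Φ.map_eq_zero_iff.1 (lp.ext (funext fun i => ?_))
    refine ext_inner_left ℂ fun v => ?_
    rw [lp.coeFn_zero, Pi.zero_apply, inner_zero_right, ← lp.inner_single_left,
      ← Φ.symm.inner_map_map, Φ.symm_apply_apply]
    exact hf _ (LinearPMap.mem_domain_of_mem_graph (hsing i v))
  rw [LinearPMap.isSelfAdjoint_def]
  refine LinearPMap.eq_of_eq_graph ?_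
  rw [LinearPMap.adjoint_graph_eq_graph_adjoint hdense]
  ext ⟨f, g⟩
  rw [Submodule.mem_adjoint_iff, mem_graph_vadd_iff hK hB]
  constructor
  · intro h i
    refine ext_inner_left ℂ fun v => ?_
    have h1 := sub_eq_zero.1 (h _ _ (hsing i v))
    rw [← Φ.inner_map_map, ← Φ.inner_map_map] at h1
    simp only [LinearIsometryEquiv.apply_symm_apply] at h1
    rw [lp.inner_single_left, inner_add_left, inner_smul_left, hsymm, lp.inner_single_left,
      lp.inner_single_left] at h1
    rw [← h1, inner_add_right, inner_smul_right, Complex.conj_ofReal]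
  · intro h a b hab
    rw [mem_graph_vadd_iff hK hB] at hab
    have e : ∀ {x y : lp G 2}, (∀ i, y i = X x i + (lam i : ℂ) • x i) →
        ∀ i, (y - X x : lp G 2) i = (lam i : ℂ) • x i := fun hy i => by
      rw [lp.coeFn_sub, Pi.sub_apply, hy i, add_sub_cancel_left]
    have key : inner ℂ (Φ b - X (Φ a)) (Φ f) = inner ℂ (Φ a) (Φ g - X (Φ f)) := by
      rw [lp.inner_eq_tsum, lp.inner_eq_tsum]
      refine tsum_congr fun i => ?_
      rw [e h, e hab, inner_smul_left, inner_smul_right, Complex.conj_ofReal]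
    rw [inner_sub_left, inner_sub_right, hsymm] at key
    dsimp only
    rw [← Φ.inner_map_map, ← Φ.inner_map_map a g, sub_eq_zero]
    exact sub_left_injective key

/-- The adjoint of the relation for `U` intertwines `K + D` with `K + X` through `U*`. Eigenvectors
of the finite blocks of `D` therefore become eigenvectors with eigenvalue `a + lam j`, and a vector
orthogonal to all of them is annihilated by the isometry `U`. -/
theorem hasPurePointSpectrum_vadd [∀ i, FiniteDimensional ℂ (G i)]
    (hK : ∀ f g, (f, g) ∈ K.graph ↔ ∀ i, Φ g i = (lam i : ℂ) • Φ f i)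
    (hB : ∀ f, Φ (B f) = X (Φ f)) (hX : IsSelfAdjoint X) {U D : lp G 2 →L[ℂ] lp G 2}
    (hU : star U * U = 1) (hD : IsSelfAdjoint D) (hDd : ∀ i j, i ≠ j → block D i j = 0)
    (hc : IsCommutator lam U (U * X - D * U)) : HasPurePointSpectrum (B +ᵥ K) := by
  refine ⟨isSelfAdjoint_vadd hK hB hX, ?_⟩
  have hc' := hc.star
  have e : -star (U * X - D * U) = star U * D - X * star U := by
    rw [star_sub, star_mul, star_mul, hX.star_eq, hD.star_eq, neg_sub]
  rw [e] at hc'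
  set S := (⨆ z : ℂ, eigenspace (B +ᵥ K) z) with hS
  have heig : ∀ j (v : G j) (a : ℝ), block D j j v = (a : ℂ) • v →
      Φ.symm (star U (lp.single 2 j v)) ∈ S := by
    intro j v a hv
    set y := star U (lp.single 2 j v) with hy
    have hg : (Φ.symm y, ((a + lam j : ℝ) : ℂ) • Φ.symm y) ∈ (B +ᵥ K).graph := by
      rw [mem_graph_vadd_iff hK hB]
      intro i
      rw [map_smul, Φ.apply_symm_apply, lp.coeFn_smul, Pi.smul_apply]
      have h1 : block (star U * D - X * star U) i j v =
          (((lam i - lam j : ℝ) : ℂ) • block (star U) i j) v := by rw [hc' i j]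
      rw [block_sub, _root_.sub_apply, block_mul_of_diag_right hDd,
        ContinuousLinearMap.comp_apply, hv, map_smul, _root_.smul_apply, block_apply,
        block_apply, mul_apply_eq_comp, ← hy, sub_eq_iff_eq_add] at h1
      have h2 : ((a + lam j : ℝ) : ℂ) • y i = (a : ℂ) • y i + (lam j : ℂ) • y i := by
        rw [← add_smul]; push_cast; rfl
      rw [h2, h1]
      have h3 : ((lam i - lam j : ℝ) : ℂ) • y i = (lam i : ℂ) • y i - (lam j : ℂ) • y i := by
        rw [← sub_smul]; push_cast; rfl
      rw [h3]
      abel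
    obtain ⟨z, hz1, hz2⟩ := (LinearPMap.mem_graph_iff _).1 hg
    refine Submodule.mem_iSup_of_mem ((a + lam j : ℝ) : ℂ) ⟨z, ?_, hz1⟩
    rw [SetLike.mem_coe, LinearMap.mem_ker]
    simp only at hz1 hz2
    rw [← hz1] at hz2
    rw [LinearMap.sub_apply, LinearMap.smul_apply, Submodule.subtype_apply, sub_eq_zero]
    exact hz2
  have hall : ∀ j (v : G j), Φ.symm (star U (lp.single 2 j v)) ∈ S := by
    intro j v
    have hDj : IsSelfAdjoint (block D j j) := by
      rw [isSelfAdjoint_iff, ContinuousLinearMap.star_eq_adjoint, ← block_star, hD.star_eq]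
    obtain ⟨u, hu⟩ := exists_eigenbasis hDj
    -- Finite dimension enters here: every vector of a block is a finite combination of eigenvectors
    -- of that block.
    have hcomap : v ∈ S.comap (Φ.symm.toLinearEquiv.toLinearMap ∘ₗ (star U).toLinearMap ∘ₗ
        lp.lsingle (𝕜 := ℂ) 2 j) := by
      rw [← u.sum_repr v]
      exact Submodule.sum_mem _ fun p _ => Submodule.smul_mem _ _ (heig j (u p) _ (hu p))
    exact hcomap
  rw [Submodule.topologicalClosure_eq_top_iff, Submodule.eq_bot_iff]
  intro f hf
  rw [Submodule.mem_orthogonal] at hf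
  have h0 : U (Φ f) = 0 := by
    refine lp.ext (funext fun i => ?_)
    refine ext_inner_left ℂ fun v => ?_
    rw [lp.coeFn_zero, Pi.zero_apply, inner_zero_right, ← lp.inner_single_left,
      ← ContinuousLinearMap.adjoint_inner_left, ← ContinuousLinearMap.star_eq_adjoint,
      ← Φ.symm.inner_map_map, Φ.symm_apply_apply]
    exact hf _ (hall i v)
  have h1 : Φ f = star U (U (Φ f)) := by
    rw [← mul_apply_eq_comp, hU, one_apply_eq_self]
  rw [h0, map_zero] at h1
  exact Φ.map_eq_zero_iff.1 h1

theorem exists_diagonalization_zero (lam : I → ℝ) : ∃ U D : lp G 2 →L[ℂ] lp G 2,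
    star U * U = 1 ∧ IsSelfAdjoint D ∧ (∀ i j, i ≠ j → block D i j = 0) ∧
      IsCommutator lam U (U * 0 - D * U) := by
  refine ⟨1, 0, by simp, IsSelfAdjoint.zero _, fun i j _ => block_zero i j, ?_⟩
  rw [mul_zero, zero_mul, sub_zero]
  exact IsCommutator.one

end DiagonalOperator

end Floquet
end

noncomputable section

namespace Floquet

/-! ### Fourier modes -/

section Modes

variable {E : Type*} [NormedAddCommGroup E] [InnerProductSpace ℂ E] {ω : ℝ}

/-- The normalized exponential of frequency `k ω` on the period interval. -/
def wave (ω : ℝ) (k : ℤ) (t : ℝ) : ℂ :=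
  ((√(2 * Real.pi / ω))⁻¹ : ℝ) * Complex.exp (((k * ω : ℝ) : ℂ) * Complex.I * t)

theorem period_pos (hω : 0 < ω) : 0 < 2 * Real.pi / ω := div_pos Real.two_pi_pos hω

theorem continuous_wave (ω : ℝ) (k : ℤ) : Continuous (wave ω k) := by
  unfold wave; fun_prop

theorem norm_wave_le (ω : ℝ) (k : ℤ) (t : ℝ) : ‖wave ω k t‖ ≤ (√(2 * Real.pi / ω))⁻¹ := by
  rw [wave, norm_mul, Complex.norm_real, Real.norm_of_nonneg (by positivity)]
  have : ((k * ω : ℝ) : ℂ) * Complex.I * t = ((k * ω * t : ℝ) : ℂ) * Complex.I := by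
    push_cast; ring
  rw [this, Complex.norm_exp_ofReal_mul_I, mul_one]

theorem conj_wave_mul_wave (hω : 0 < ω) (k l : ℤ) (t : ℝ) :
    (starRingEnd ℂ) (wave ω k t) * wave ω l t =
      ((2 * Real.pi / ω)⁻¹ : ℝ) * Complex.exp (-(Complex.I * ((k - l : ℤ) : ℂ) * ((ω * t : ℝ) : ℂ))) := by
  rw [wave, wave, map_mul, Complex.conj_ofReal, ← Complex.exp_conj, mul_mul_mul_comm,
    ← Complex.exp_add, ← Complex.ofReal_mul, ← mul_inv, Real.mul_self_sqrt (period_pos hω).le]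
  congr 2
  simp only [map_mul, Complex.conj_ofReal, Complex.conj_I]
  push_cast
  ring

theorem hasDerivAt_wave (ω : ℝ) (k : ℤ) (t : ℝ) :
    HasDerivAt (wave ω k) (((k * ω : ℝ) : ℂ) * Complex.I * wave ω k t) t := by
  have h1 : HasDerivAt (fun t : ℝ => ((k * ω : ℝ) : ℂ) * Complex.I * (t : ℂ))
      (((k * ω : ℝ) : ℂ) * Complex.I) t := by
    simpa using (Complex.ofRealCLM.hasDerivAt (x := t)).const_mul (((k * ω : ℝ) : ℂ) * Complex.I)
  have h2 := (h1.cexp).const_mul (((√(2 * Real.pi / ω))⁻¹ : ℝ) : ℂ)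
  refine h2.congr_deriv ?_
  rw [wave]; ring

theorem periodic_wave (hω : 0 < ω) (k : ℤ) : Function.Periodic (wave ω k) (2 * Real.pi / ω) := by
  intro t
  rw [wave, wave]
  congr 1
  rw [Complex.exp_eq_exp_iff_exists_int]
  refine ⟨k, ?_⟩
  have : (ω : ℂ) ≠ 0 := by exact_mod_cast hω.ne'
  push_cast
  field_simp

theorem memLp_wave_smul (ω : ℝ) (k : ℤ) (x : E) :
    MemLp (fun t => wave ω k t • x) 2 (periodMeasure ω) := by
  refine MemLp.of_bound (((continuous_wave ω k).smul continuous_const).aestronglyMeasurable)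
    ((√(2 * Real.pi / ω))⁻¹ * ‖x‖) (.of_forall fun t => ?_)
  rw [norm_smul]
  gcongr
  exact norm_wave_le ω k t

/-- The Fourier mode `t ↦ e^{ikωt} x`, normalized. -/
def mode (ω : ℝ) (k : ℤ) : E →ₗ[ℂ] Space E ω where
  toFun x := (memLp_wave_smul ω k x).toLp _
  map_add' x y := by
    rw [← MemLp.toLp_add]
    exact MemLp.toLp_congr _ _ (.of_forall fun t => smul_add _ _ _)
  map_smul' c x := by
    rw [RingHom.id_apply, ← MemLp.toLp_const_smul]
    exact MemLp.toLp_congr _ _ (.of_forall fun t => smul_comm _ _ _)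

theorem coeFn_mode (ω : ℝ) (k : ℤ) (x : E) :
    mode ω k x =ᵐ[periodMeasure ω] fun t => wave ω k t • x :=
  MemLp.coeFn_toLp (memLp_wave_smul ω k x)

theorem integral_periodMeasure {F : Type*} [NormedAddCommGroup F] [NormedSpace ℝ F] (hω : 0 < ω)
    (f : ℝ → F) : ∫ t, f t ∂periodMeasure ω = ∫ t in (0 : ℝ)..2 * Real.pi / ω, f t := by
  rw [intervalIntegral.integral_of_le (period_pos hω).le, integral_Icc_eq_integral_Ioc]

theorem inner_mode (hω : 0 < ω) (k : ℤ) (x : E) (ψ : Space E ω) {f : ℝ → E}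
    (hf : ψ =ᵐ[periodMeasure ω] f) :
    inner ℂ (mode ω k x) ψ =
      ∫ t in (0 : ℝ)..2 * Real.pi / ω, (starRingEnd ℂ) (wave ω k t) * inner ℂ x (f t) := by
  rw [L2.inner_def, ← integral_periodMeasure hω]
  refine integral_congr_ae ?_
  filter_upwards [coeFn_mode ω k x, hf] with t h1 h2
  rw [h1, h2, inner_smul_left]

theorem integral_exp_int (hω : 0 < ω) {k : ℤ} (hk : k ≠ 0) :
    ∫ t in (0 : ℝ)..2 * Real.pi / ω,
      Complex.exp (-(Complex.I * (k : ℂ) * ((ω * t : ℝ) : ℂ))) = 0 := by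
  have hω' : (ω : ℂ) ≠ 0 := by exact_mod_cast hω.ne'
  have hk' : (k : ℂ) ≠ 0 := by exact_mod_cast hk
  have h := integral_exp_mul_complex (a := 0) (b := 2 * Real.pi / ω) (c := -(Complex.I * k * ω))
    (neg_ne_zero.2 (mul_ne_zero (mul_ne_zero Complex.I_ne_zero hk') hω'))
  have e : Complex.exp (-(Complex.I * k * ω) * ((2 * Real.pi / ω : ℝ) : ℂ)) = 1 := by
    rw [Complex.exp_eq_one_iff]
    refine ⟨-k, ?_⟩
    push_cast
    field_simp
  rw [e] at h
  simp only [Complex.ofReal_zero, mul_zero, Complex.exp_zero, sub_self, zero_div] at h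
  rw [← h]
  refine intervalIntegral.integral_congr fun t _ => ?_
  congr 1
  push_cast
  ring

theorem inner_mode_mode (hω : 0 < ω) (k l : ℤ) (x y : E) :
    inner ℂ (mode ω k x) (mode ω l y) = if k = l then inner ℂ x y else 0 := by
  rw [inner_mode hω k x _ (coeFn_mode ω l y)]
  simp only [inner_smul_right, ← mul_assoc, conj_wave_mul_wave hω]
  rw [intervalIntegral.integral_mul_const, intervalIntegral.integral_const_mul]
  split_ifs with h
  · subst h
    have : (ω : ℂ) ≠ 0 := by exact_mod_cast hω.ne'
    simp only [sub_self, Int.cast_zero, mul_zero, zero_mul, neg_zero, Complex.exp_zero,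
      intervalIntegral.integral_const, sub_zero]
    rw [Complex.real_smul, mul_one, ← Complex.ofReal_mul, inv_mul_cancel₀ (period_pos hω).ne',
      Complex.ofReal_one, one_mul]
  · rw [integral_exp_int hω (sub_ne_zero.2 h), mul_zero, zero_mul]

/-- The Fourier mode as an isometry. -/
def modeIsometry (hω : 0 < ω) (k : ℤ) : E →ₗᵢ[ℂ] Space E ω :=
  (mode ω k).isometryOfInner fun x y => by rw [inner_mode_mode hω, if_pos rfl]

/-- Parseval for the scalar function `t ↦ ⟨x, ψ(t)⟩`, all of whose Fourier coefficients vanish. -/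
theorem ae_inner_eq_zero (hω : 0 < ω) {ψ : Space E ω} {x : E}
    (h : ∀ k, inner ℂ (mode ω k x) ψ = 0) : ∀ᵐ t ∂periodMeasure ω, inner ℂ x (ψ t) = 0 := by
  have hT := period_pos hω
  set f : ℝ → ℂ := fun t => inner ℂ x (ψ t) with hf
  have hL2 : MemLp f 2 (periodMeasure ω) := (Lp.memLp ψ).const_inner x
  have hL2' : MemLp f 2 (volume.restrict (Ioc 0 (2 * Real.pi / ω))) :=
    hL2.mono_measure (Measure.restrict_mono Ioc_subset_Icc_self le_rfl)
  have hc : ∀ k, fourierCoeffOn hT f k = 0 := by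
    intro k
    rw [fourierCoeffOn_eq_integral]
    have h1 := h k
    rw [inner_mode hω k x ψ (Filter.EventuallyEq.refl _ _)] at h1
    have h2 : ∀ t : ℝ, (fourier (-k)) (t : AddCircle (2 * Real.pi / ω - 0)) • f t =
        (√(2 * Real.pi / ω) : ℂ) * ((starRingEnd ℂ) (wave ω k t) * inner ℂ x (ψ t)) := by
      intro t
      have h3 : (√(2 * Real.pi / ω) : ℂ) ≠ 0 := by
        exact_mod_cast (Real.sqrt_pos.2 hT).ne'
      have hω' : (ω : ℂ) ≠ 0 := by exact_mod_cast hω.ne'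
      rw [fourier_coe_apply, smul_eq_mul, wave, map_mul, Complex.conj_ofReal, ← Complex.exp_conj,
        Complex.ofReal_inv, ← mul_assoc, mul_inv_cancel_left₀ h3]
      congr 2
      simp only [map_mul, Complex.conj_ofReal, Complex.conj_I]
      push_cast
      have : (Real.pi : ℂ) ≠ 0 := by exact_mod_cast Real.pi_ne_zero
      rw [sub_zero]
      field_simp
    simp only [h2]
    rw [intervalIntegral.integral_const_mul, h1, mul_zero, smul_zero]
  have hs := hasSum_sq_fourierCoeffOn hT hL2'
  simp only [hc, norm_zero, ne_eq, OfNat.ofNat_ne_zero, not_false_eq_true, zero_pow] at hs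
  have h0 := hs.unique hasSum_zero
  rw [sub_zero, smul_eq_mul, mul_eq_zero, or_iff_right (inv_pos.2 hT).ne',
    ← integral_periodMeasure hω, integral_eq_zero_iff_of_nonneg (fun t => by positivity)] at h0
  · filter_upwards [h0] with t ht
    simpa using ht
  · exact (memLp_two_iff_integrable_sq_norm hL2.1).1 hL2

end Modes

end Floquet
end

noncomputable section

namespace Floquet

/-! ### The free operator in Fourier coordinates -/

section Free

variable {E : Type*} [NormedAddCommGroup E] [InnerProductSpace ℂ E] [CompleteSpace E]
  (H : Hamiltonian E) {ω : ℝ}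

theorem Hamiltonian.exists_of_mem_level {n : ℕ} {x : E} (hx : x ∈ H.level n) :
    ∃ y : H.op.domain, (y : E) = x ∧ H.op y = (H.h n : ℂ) • x := by
  obtain ⟨y, hy, rfl⟩ := hx
  rw [SetLike.mem_coe, LinearMap.mem_ker, LinearMap.sub_apply, sub_eq_zero] at hy
  exact ⟨y, rfl, hy⟩

theorem Hamiltonian.inner_op (x y : H.op.domain) :
    inner ℂ (H.op x) (y : E) = inner ℂ (x : E) (H.op y) := by
  have h := LinearPMap.adjoint_isFormalAdjoint H.isSelfAdjoint.dense_domain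
  rw [LinearPMap.isSelfAdjoint_def.1 H.isSelfAdjoint] at h
  exact h x y

theorem Hamiltonian.inner_op_of_mem_level {n : ℕ} {v : E} (hv : v ∈ H.level n)
    (x : H.op.domain) : inner ℂ v (H.op x) = (H.h n : ℂ) * inner ℂ v (x : E) := by
  obtain ⟨y, rfl, hy⟩ := H.exists_of_mem_level hv
  rw [← H.inner_op, hy, inner_smul_left, Complex.conj_ofReal]

theorem Hamiltonian.inner_level_eq_zero {n m : ℕ} (hnm : n ≠ m) {x y : E} (hx : x ∈ H.level n)
    (hy : y ∈ H.level m) : inner ℂ x y = 0 := by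
  obtain ⟨y, rfl, hy'⟩ := H.exists_of_mem_level hy
  have h := H.inner_op_of_mem_level hx y
  rw [hy', inner_smul_right, ← sub_eq_zero, ← sub_mul, mul_eq_zero, sub_eq_zero] at h
  refine h.resolve_left fun e => hnm (H.h_injective ?_)
  exact_mod_cast e.symm

theorem Hamiltonian.eq_zero_of_inner_level {x : E} (h : ∀ n, ∀ v ∈ H.level n, inner ℂ v x = 0) :
    x = 0 := by
  have h1 := Submodule.topologicalClosure_eq_top_iff.1 H.total
  rw [Submodule.eq_bot_iff] at h1
  refine h1 x ?_
  rw [← Submodule.iInf_orthogonal, Submodule.mem_iInf]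
  exact fun n => (Submodule.mem_orthogonal _ _).2 (h n)

/-- The Fourier mode of index `i.1`, with values in the level `i.2`. -/
def levelMode (hω : 0 < ω) (i : ℤ × ℕ) : H.level i.2 →ₗᵢ[ℂ] Space E ω :=
  (modeIsometry hω i.1).comp (H.level i.2).subtypeₗᵢ

theorem levelMode_apply (hω : 0 < ω) (i : ℤ × ℕ) (v : H.level i.2) :
    levelMode H hω i v = mode ω i.1 (v : E) := rfl

/-- For totality, finite bases of the levels give countably many test vectors, hence one null set
outside which `ψ(t)` is orthogonal to every eigenspace and so vanishes. -/
theorem isHilbertSum_levelMode (hω : 0 < ω) :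
    IsHilbertSum ℂ (fun i : ℤ × ℕ => H.level i.2) (levelMode H hω) := by
  refine IsHilbertSum.mk (fun i j hij v w => ?_) ?_
  · rw [levelMode_apply, levelMode_apply, inner_mode_mode hω]
    split_ifs with h
    · exact H.inner_level_eq_zero (fun h' => hij (Prod.ext h h')) v.2 w.2
    · rfl
  · rw [top_le_iff, Submodule.topologicalClosure_eq_top_iff, Submodule.eq_bot_iff]
    intro ψ hψ
    rw [← Submodule.iInf_orthogonal, Submodule.mem_iInf] at hψ
    have h1 : ∀ k n, ∀ v ∈ H.level n, inner ℂ (mode ω k v) ψ = 0 := fun k n v hv =>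
      (Submodule.mem_orthogonal _ _).1 (hψ (k, n)) _ ⟨⟨v, hv⟩, rfl⟩
    have h2 : ∀ᵐ t ∂periodMeasure ω, ∀ n (p : Fin (Module.finrank ℂ (H.level n))),
        inner ℂ (Module.finBasis ℂ (H.level n) p : E) (ψ t) = 0 := by
      rw [ae_all_iff]
      intro n
      rw [ae_all_iff]
      exact fun p => ae_inner_eq_zero hω fun k => h1 k n _ (Subtype.prop _)
    refine (Lp.eq_zero_iff_ae_eq_zero).2 ?_
    filter_upwards [h2] with t ht
    refine H.eq_zero_of_inner_level fun n v hv => ?_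
    have h3 := (Module.finBasis ℂ (H.level n)).sum_repr ⟨v, hv⟩
    have h4 : v = ∑ p, ((Module.finBasis ℂ (H.level n)).repr ⟨v, hv⟩ p) •
        (Module.finBasis ℂ (H.level n) p : E) := by
      have h5 := congrArg (H.level n).subtype h3
      rw [map_sum] at h5
      exact h5.symm
    rw [h4, sum_inner]
    exact Finset.sum_eq_zero fun p _ => by rw [inner_smul_left, ht n p, mul_zero]

/-- Fourier coordinates on `L²([0, T], E)`. -/
def fourierIso (hω : 0 < ω) : Space E ω ≃ₗᵢ[ℂ] SeqSpace fun n => H.level n :=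
  (isHilbertSum_levelMode H hω).linearIsometryEquiv

theorem fourierIso_symm_single (hω : 0 < ω) (i : ℤ × ℕ) (v : H.level i.2) :
    (fourierIso H hω).symm (lp.single 2 i v) = mode ω i.1 (v : E) :=
  (isHilbertSum_levelMode H hω).linearIsometryEquiv_symm_apply_single v

theorem inner_fourierIso (hω : 0 < ω) (ψ : Space E ω) (i : ℤ × ℕ) (v : H.level i.2) :
    inner ℂ v (fourierIso H hω ψ i) = inner ℂ (mode ω i.1 (v : E)) ψ := by
  rw [← fourierIso_symm_single H hω, ← (fourierIso H hω).inner_map_map,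
    LinearIsometryEquiv.apply_symm_apply]
  exact (lp.inner_single_left (𝕜 := ℂ) i v (fourierIso H hω ψ)).symm

/-- The graph of the operator of multiplication by `modeEnergy` in Fourier coordinates. -/
def diagGraph (hω : 0 < ω) : Submodule ℂ (Space E ω × Space E ω) where
  carrier := {p | ∀ i, fourierIso H hω p.2 i = (modeEnergy H.h ω i : ℂ) • fourierIso H hω p.1 i}
  zero_mem' := fun i => by simp
  add_mem' := fun {p q} hp hq i => by
    simp only [Prod.fst_add, Prod.snd_add, map_add, lp.coeFn_add, Pi.add_apply]
    rw [hp i, hq i, smul_add]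
  smul_mem' := fun c p hp i => by
    simp only [Prod.smul_fst, Prod.smul_snd, map_smul, lp.coeFn_smul, Pi.smul_apply]
    rw [hp i, smul_comm]

theorem mem_diagGraph_iff_inner (hω : 0 < ω) (p : Space E ω × Space E ω) :
    p ∈ diagGraph H hω ↔ ∀ (i : ℤ × ℕ) (v : H.level i.2), inner ℂ (mode ω i.1 (v : E)) p.2 =
      (modeEnergy H.h ω i : ℂ) * inner ℂ (mode ω i.1 (v : E)) p.1 := by
  refine forall_congr' fun i => ?_
  simp only [← inner_fourierIso H hω]
  simp only [← inner_smul_right]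
  exact ⟨fun h v => by rw [h], fun h => ext_inner_left ℂ h⟩

theorem isClosed_diagGraph (hω : 0 < ω) :
    IsClosed (diagGraph H hω : Set (Space E ω × Space E ω)) := by
  have : (diagGraph H hω : Set (Space E ω × Space E ω)) =
      ⋂ (i : ℤ × ℕ) (v : H.level i.2), {p | inner ℂ (mode ω i.1 (v : E)) p.2 =
        (modeEnergy H.h ω i : ℂ) * inner ℂ (mode ω i.1 (v : E)) p.1} := by
    ext p
    simp only [mem_iInter]
    exact mem_diagGraph_iff_inner H hω p
  rw [this]
  exact isClosed_iInter fun i => isClosed_iInter fun v =>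
    isClosed_eq (by fun_prop) (by fun_prop)

/-- Integration by parts against a mode; periodicity cancels the boundary terms, and symmetry of `H`
moves it onto the eigenvector. -/
theorem freeGenerators_subset (hω : 0 < ω) :
    H.freeGenerators ω ⊆ (diagGraph H hω : Set (Space E ω × Space E ω)) := by
  rintro p ⟨f, x, hf, hper, hp1, hp2⟩
  rw [SetLike.mem_coe, mem_diagGraph_iff_inner]
  rintro ⟨k, n⟩ v
  rw [inner_mode hω k _ _ hp1, inner_mode hω k _ _ hp2]
  have hT := period_pos hω
  set T := 2 * Real.pi / ω with hTdef
  set a : ℂ := inner ℂ (v : E) (x : E) with ha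
  set w : ℝ → ℂ := fun t => (starRingEnd ℂ) (wave ω k t) with hw
  have hwd : ∀ t, HasDerivAt w (-(((k * ω : ℝ) : ℂ) * Complex.I) * w t) t := fun t => by
    refine (hasDerivAt_wave ω k t).star.congr_deriv ?_
    rw [hw, ← starRingEnd_apply, map_mul, map_mul, Complex.conj_ofReal, Complex.conj_I]
    ring
  have hwc : Continuous w := Complex.continuous_conj.comp (continuous_wave ω k)
  have hfd : ∀ t, HasDerivAt f (deriv f t) t := fun t =>
    (hf.differentiable one_ne_zero t).hasDerivAt
  have hfc : Continuous (deriv f) := hf.continuous_deriv le_rfl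
  have hparts := intervalIntegral.integral_mul_deriv_eq_deriv_mul (a := 0) (b := T) (u := w)
    (v := f) (fun t _ => hwd t) (fun t _ => hfd t)
    ((continuous_const.mul hwc).intervalIntegrable _ _) (hfc.intervalIntegrable _ _)
  have hwT : w T = w 0 := by
    have := periodic_wave hω k 0
    rw [zero_add] at this
    simp only [hw, hTdef, this]
  have hfT : f T = f 0 := by simpa using hper 0
  rw [hwT, hfT, sub_self, zero_sub] at hparts
  have e1 : ∀ t, w t * inner ℂ (v : E) ((-Complex.I * deriv f t) • (x : E) + f t • H.op x) =
      -Complex.I * a * (w t * deriv f t) + (H.h n : ℂ) * a * (w t * f t) := fun t => by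
    rw [inner_add_right, inner_smul_right, inner_smul_right, H.inner_op_of_mem_level v.2]
    ring
  have e2 : ∀ t, w t * inner ℂ (v : E) (f t • (x : E)) = a * (w t * f t) := fun t => by
    rw [inner_smul_right]; ring
  have e3 : ∀ t, -(((k * ω : ℝ) : ℂ) * Complex.I) * w t * f t =
      -(((k * ω : ℝ) : ℂ) * Complex.I) * (w t * f t) := fun t => mul_assoc _ _ _
  simp only [e3] at hparts
  rw [intervalIntegral.integral_const_mul] at hparts
  change ∫ t in (0 : ℝ)..T, w t * inner ℂ (v : E) ((-Complex.I * deriv f t) • (x : E) + f t • H.op x) =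
    _ * ∫ t in (0 : ℝ)..T, w t * inner ℂ (v : E) (f t • (x : E))
  simp only [e1, e2]
  rw [intervalIntegral.integral_add, intervalIntegral.integral_const_mul,
    intervalIntegral.integral_const_mul, intervalIntegral.integral_const_mul, hparts, modeEnergy]
  · push_cast
    linear_combination (-(k * ω * a * ∫ t in (0 : ℝ)..T, w t * f t)) * Complex.I_sq
  · exact (continuous_const.mul (hwc.mul hfc)).intervalIntegrable _ _
  · exact (continuous_const.mul (hwc.mul hf.continuous)).intervalIntegrable _ _

theorem mode_mem_freeGenerators (hω : 0 < ω) (i : ℤ × ℕ) (v : H.level i.2) :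
    (mode ω i.1 (v : E), (modeEnergy H.h ω i : ℂ) • mode ω i.1 (v : E)) ∈ H.freeGenerators ω := by
  obtain ⟨y, hy, hy'⟩ := H.exists_of_mem_level v.2
  refine ⟨wave ω i.1, y, ?_, periodic_wave hω i.1, ?_, ?_⟩
  · exact contDiff_const.mul (contDiff_const.mul Complex.ofRealCLM.contDiff).cexp
  · rw [hy]
    exact coeFn_mode ω i.1 (v : E)
  · filter_upwards [Lp.coeFn_smul (modeEnergy H.h ω i : ℂ) (mode ω i.1 (v : E)),
      coeFn_mode ω i.1 (v : E)] with t h1 h2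
    rw [h1, Pi.smul_apply, h2, hy, hy', (hasDerivAt_wave ω i.1 t).deriv, smul_smul, smul_smul,
      ← add_smul]
    congr 1
    rw [modeEnergy]
    push_cast
    linear_combination (i.1 * ω * wave ω i.1 t) * Complex.I_sq

/-- The diagonal graph is closed and contains the generators. Conversely, the Fourier expansion of a
pair in it converges in the product space, with partial sums in the span since modes are generators.
-/
theorem closure_span_freeGenerators (hω : 0 < ω) :
    (Submodule.span ℂ (H.freeGenerators ω)).topologicalClosure = diagGraph H hω := by
  refine le_antisymm (Submodule.topologicalClosure_minimal _
    (Submodule.span_le.2 (freeGenerators_subset H hω)) (isClosed_diagGraph H hω)) ?_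
  rintro ⟨f, g⟩ hfg
  have hs : ∀ ψ : Space E ω,
      HasSum (fun i => mode ω i.1 (fourierIso H hω ψ i : E)) ψ := fun ψ => by
    have := (isHilbertSum_levelMode H hω).hasSum_linearIsometryEquiv_symm (fourierIso H hω ψ)
    have e : (isHilbertSum_levelMode H hω).linearIsometryEquiv.symm (fourierIso H hω ψ) = ψ :=
      (fourierIso H hω).symm_apply_apply ψ
    rw [e] at this
    exact this
  have hs2 : HasSum (fun i => (mode ω i.1 (fourierIso H hω f i : E),
      (modeEnergy H.h ω i : ℂ) • mode ω i.1 (fourierIso H hω f i : E))) (f, g) := by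
    refine (hs f).prodMk ?_
    refine (hs g).congr_fun fun i => ?_
    rw [hfg i, Submodule.coe_smul, map_smul]
  refine mem_closure_of_tendsto hs2 (.of_forall fun s => ?_)
  exact Submodule.sum_mem _ fun i _ => Submodule.subset_span (mode_mem_freeGenerators H hω i _)

theorem mem_graph_free (hω : 0 < ω) (f g : Space E ω) : (f, g) ∈ (H.free ω).graph ↔
    ∀ i, fourierIso H hω g i = (modeEnergy H.h ω i : ℂ) • fourierIso H hω f i := by
  rw [Hamiltonian.free, closure_span_freeGenerators H hω, Submodule.toLinearPMap_graph_eq]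
  · rfl
  · rintro ⟨f, g⟩ h hf
    simp only at hf
    subst hf
    refine (fourierIso H hω).map_eq_zero_iff.1 (lp.ext (funext fun i => ?_))
    rw [h i]
    simp

end Free

end Floquet
end

noncomputable section

namespace Floquet

/-! ### The perturbation in Fourier coordinates -/

section Perturbation

variable {E : Type*} [NormedAddCommGroup E] [InnerProductSpace ℂ E] [CompleteSpace E]
  (H : Hamiltonian E) (V : Potential E) {ω : ℝ}

/-- `V` is measurable only vector by vector, so integrability of the operator-valued integrand in
`coeff` is not automatic. Writing it as a finite sum over a basis of the level reduces it to
vector-valued integrability. -/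
theorem map_intervalIntegral_of_eq_sum {ι Y F : Type*} [Fintype ι] [NormedAddCommGroup Y]
    [NormedSpace ℂ Y] [CompleteSpace Y] [NormedAddCommGroup F] [NormedSpace ℂ F] {a b : ℝ}
    (S : ι → F →L[ℂ] Y) {g : ι → ℝ → F} (hg : ∀ p, IntervalIntegrable (g p) volume a b)
    {f : ℝ → Y} (hf : ∀ t, f t = ∑ p, S p (g p t)) (L : Y →L[ℂ] ℂ) :
    L (∫ t in a..b, f t) = ∫ t in a..b, L (f t) := by
  have h1 : IntervalIntegrable f volume a b := by
    have h2 := IntervalIntegrable.sum (μ := volume) (a := a) (b := b) Finset.univ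
      (f := fun p t => S p (g p t)) fun p _ =>
        ⟨(S p).integrable_comp (hg p).1, (S p).integrable_comp (hg p).2⟩
    have h3 : f = ∑ p, fun t => S p (g p t) := by
      funext t
      rw [hf, Finset.sum_apply]
    rw [h3]
    exact h2
  exact (L.intervalIntegral_comp_comm h1).symm

theorem Hamiltonian.intervalIntegrable_projection (k : ℤ) (n : ℕ) (x : E) (a b : ℝ) :
    IntervalIntegrable (fun t : ℝ => Complex.exp (-(Complex.I * k * t)) •
      (H.level n).orthogonalProjectionOnto (V.toFun t x)) volume a b := by
  obtain ⟨C, hC⟩ := V.bounded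
  have hm : StronglyMeasurable fun t : ℝ => Complex.exp (-(Complex.I * k * t)) •
      (H.level n).orthogonalProjectionOnto (V.toFun t x) := by
    have hexp : Continuous fun t : ℝ => Complex.exp (-(Complex.I * k * t)) := by fun_prop
    exact hexp.stronglyMeasurable.smul
      ((H.level n).orthogonalProjectionOnto.continuous.comp_stronglyMeasurable
        (V.stronglyMeasurable _))
  refine (intervalIntegrable_const (c := C * ‖x‖)).mono_fun' hm.aestronglyMeasurable
    (.of_forall fun t => ?_)
  have h1 : ‖Complex.exp (-(Complex.I * k * t))‖ = 1 := by
    rw [show -(Complex.I * k * t) = ((-(k * t) : ℝ) : ℂ) * Complex.I by push_cast; ring,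
      Complex.norm_exp_ofReal_mul_I]
  change ‖Complex.exp (-(Complex.I * k * t)) • _‖ ≤ C * ‖x‖
  rw [norm_smul, h1, one_mul]
  exact ((H.level n).norm_orthogonalProjectionOnto_apply_le _).trans
    ((V.toFun t).le_of_opNorm_le (hC t) _)

theorem Hamiltonian.inner_coeff (k : ℤ) (n m : ℕ) (w : H.level n) (v : H.level m) :
    inner ℂ w (H.coeff V k n m v) = ((2 * Real.pi)⁻¹ : ℝ) *
      ∫ t in (0 : ℝ)..2 * Real.pi, Complex.exp (-(Complex.I * k * t)) *
        inner ℂ (w : E) (V.toFun t (v : E)) := by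
  set L : (H.level m →L[ℂ] H.level n) →L[ℂ] ℂ :=
    (innerSL ℂ w) ∘L ContinuousLinearMap.apply ℂ (H.level n) v with hL
  set u := stdOrthonormalBasis ℂ (H.level m) with hu
  have hsum : ∀ A : H.level m →L[ℂ] H.level n,
      A = ∑ p, ContinuousLinearMap.smulRightL ℂ _ _ (innerSL ℂ (u p)) (A (u p)) := fun A => by
    ext1 v
    conv_lhs => rw [← u.sum_repr' v, map_sum]
    rw [sum_apply]
    exact Finset.sum_congr rfl fun p _ => by rw [map_smul]; rfl
  have h1 : inner ℂ w (H.coeff V k n m v) = L (H.coeff V k n m) := rfl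
  have h2 := map_intervalIntegral_of_eq_sum
    (fun p => ContinuousLinearMap.smulRightL ℂ (H.level m) (H.level n) (innerSL ℂ (u p)))
    (fun p => H.intervalIntegrable_projection V k n (u p : E) 0 (2 * Real.pi))
    (f := fun t : ℝ => Complex.exp (-(Complex.I * k * t)) •
      ((H.level n).orthogonalProjectionOnto ∘L V.toFun t ∘L (H.level m).subtypeL))
    (fun t => hsum _) L
  rw [h1, Hamiltonian.coeff, ContinuousLinearMap.map_smul_of_tower, h2, Complex.real_smul]
  congr 1
  refine intervalIntegral.integral_congr fun t _ => ?_
  change inner ℂ w (Complex.exp (-(Complex.I * k * t)) •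
    (H.level n).orthogonalProjectionOnto (V.toFun t (v : E))) = _
  rw [inner_smul_right]
  congr 1
  exact (H.level n).inner_orthogonalProjectionOnto_eq_of_mem_left w _

variable [SecondCountableTopology E]

theorem Potential.coeFn_mulOp (ω : ℝ) (ψ : Space E ω) :
    V.mulOp ω ψ =ᵐ[periodMeasure ω] fun t => V.toFun (ω * t) (ψ t) :=
  MemLp.coeFn_toLp (V.memLp_mul ω (Lp.memLp ψ))

/-- The multiplication operator as a continuous linear map. -/
def Potential.mulCLM (ω : ℝ) : Space E ω →L[ℂ] Space E ω :=
  (V.mulOp ω).mkContinuous V.bounded.choose fun ψ => by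
    refine Lp.norm_le_mul_norm_of_ae_le_mul ?_
    filter_upwards [V.coeFn_mulOp ω ψ] with t ht
    rw [ht]
    exact (V.toFun (ω * t)).le_of_opNorm_le (V.bounded.choose_spec _) _

/-- The multiplication operator in Fourier coordinates. -/
def fourierOp (hω : 0 < ω) : SeqSpace (fun n => H.level n) →L[ℂ] SeqSpace fun n => H.level n :=
  (fourierIso H hω : Space E ω →L[ℂ] _) ∘L V.mulCLM ω ∘L ((fourierIso H hω).symm : _ →L[ℂ] _)

theorem fourierIso_mulOp (hω : 0 < ω) (ψ : Space E ω) :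
    fourierIso H hω (V.mulOp ω ψ) = fourierOp H V hω (fourierIso H hω ψ) := by
  change _ = fourierIso H hω (V.mulOp ω ((fourierIso H hω).symm (fourierIso H hω ψ)))
  rw [LinearIsometryEquiv.symm_apply_apply]

theorem inner_mode_mulOp_mode (hω : 0 < ω) (k l : ℤ) (x y : E) :
    inner ℂ (mode ω k x) (V.mulOp ω (mode ω l y)) = ((2 * Real.pi)⁻¹ : ℝ) *
      ∫ t in (0 : ℝ)..2 * Real.pi, Complex.exp (-(Complex.I * ((k - l : ℤ) : ℂ) * t)) *
        inner ℂ x (V.toFun t y) := by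
  have h1 : V.mulOp ω (mode ω l y) =ᵐ[periodMeasure ω]
      fun t => V.toFun (ω * t) (wave ω l t • y) := by
    filter_upwards [V.coeFn_mulOp ω (mode ω l y), coeFn_mode ω l y] with t h1 h2
    rw [h1, h2]
  rw [inner_mode hω k x _ h1]
  simp only [map_smul, inner_smul_right, ← mul_assoc, conj_wave_mul_wave hω]
  have h2 := intervalIntegral.integral_comp_mul_left (a := 0) (b := 2 * Real.pi / ω)
    (fun s : ℝ => ((2 * Real.pi / ω)⁻¹ : ℝ) * (Complex.exp (-(Complex.I * ((k - l : ℤ) : ℂ) * s)) *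
        inner ℂ x (V.toFun s y))) hω.ne'
  simp only [← mul_assoc] at h2
  rw [h2, mul_zero, mul_div_cancel₀ _ hω.ne']
  simp only [mul_assoc]
  rw [intervalIntegral.integral_const_mul, Complex.real_smul, ← mul_assoc, ← Complex.ofReal_mul]
  congr 2
  field_simp

theorem block_fourierOp (hω : 0 < ω) (i j : ℤ × ℕ) :
    block (fourierOp H V hω) i j = H.coeff V (i.1 - j.1) i.2 j.2 := by
  ext1 v
  refine ext_inner_left ℂ fun w => ?_
  have h1 : block (fourierOp H V hω) i j v =
      fourierIso H hω (V.mulOp ω ((fourierIso H hω).symm (lp.single 2 j v))) i := rfl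
  rw [h1, inner_fourierIso, fourierIso_symm_single, inner_mode_mulOp_mode V hω]
  exact (H.inner_coeff V (i.1 - j.1) i.2 j.2 w v).symm

/-- The substitution `s = ωt` removes the frequency, so one block matrix serves for all `ω`. -/
theorem fourierOp_eq_one (hω : 0 < ω) : fourierOp H V hω = fourierOp H V one_pos :=
  block_ext fun i j => by rw [block_fourierOp, block_fourierOp]

theorem isToeplitz_fourierOp (hω : 0 < ω) : IsToeplitz (fourierOp H V hω) := fun k l n m => by
  rw [block_fourierOp, block_fourierOp, add_sub_add_right_eq_sub]

theorem inner_mulOp_one (f g : Space E 1) :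
    inner ℂ (V.mulOp 1 f) g = inner ℂ f (V.mulOp 1 g) := by
  rw [L2.inner_def, L2.inner_def]
  refine integral_congr_ae ?_
  filter_upwards [V.coeFn_mulOp 1 f, V.coeFn_mulOp 1 g,
    ae_restrict_of_ae V.isSelfAdjoint] with t h1 h2 h3
  rw [h1, h2, one_mul, ← ContinuousLinearMap.adjoint_inner_left, h3.adjoint_eq]

theorem isSelfAdjoint_fourierOp : IsSelfAdjoint (fourierOp H V one_pos) := by
  rw [isSelfAdjoint_iff, ContinuousLinearMap.star_eq_adjoint]
  refine (ContinuousLinearMap.eq_adjoint_iff _ _).2 (fun x y => ?_) |>.symm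
  have h1 : ∀ x, fourierOp H V one_pos x =
      fourierIso H one_pos (V.mulOp 1 ((fourierIso H one_pos).symm x)) := fun _ => rfl
  rw [h1, h1]
  have h2 : ∀ a b, inner ℂ (fourierIso H one_pos a) b =
      inner ℂ a ((fourierIso H one_pos).symm b) := fun a b => by
    rw [← (fourierIso H one_pos).symm.inner_map_map, LinearIsometryEquiv.symm_apply_apply]
  have h3 : ∀ a b, inner ℂ a (fourierIso H one_pos b) =
      inner ℂ ((fourierIso H one_pos).symm a) b := fun a b => by
    rw [← (fourierIso H one_pos).symm.inner_map_map, LinearIsometryEquiv.symm_apply_apply]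
  rw [h2, h3, inner_mulOp_one]

/-- A row of the matrix lists the coefficients at `k - l`; the reflection `l ↦ k - l` turns its
weighted sum into the one in `size`. -/
theorem regularityBound_fourierOp {r : ℝ} (hsize : H.size V r ≠ ⊤) :
    RegularityBound (fourierOp H V one_pos) r (H.size V r).toReal := by
  rintro ⟨k, n⟩
  rw [ENNReal.ofReal_toReal hsize, ENNReal.tsum_prod']
  refine le_trans (le_of_eq ?_) (le_iSup (fun n : ℕ => ∑' (k : ℤ) (m : ℕ),
    ENNReal.ofReal (‖H.coeff V k n m‖ * max (|(k : ℝ)| ^ r) 1)) n)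
  rw [← (Equiv.subLeft k).tsum_eq]
  refine tsum_congr fun l => tsum_congr fun m => ?_
  have e : k - Equiv.subLeft k l = l := by simp
  rw [block_fourierOp, e, ENNReal.ofReal_mul (ContinuousLinearMap.opNorm_nonneg _), ofReal_norm,
    Nat.cast_natAbs, Int.cast_abs]

end Perturbation

end Floquet
end

noncomputable section

namespace Floquet

/-! ### Positivity of the constants and the spectrum of the Floquet Hamiltonian -/

section Main

variable {E : Type*} [NormedAddCommGroup E] [InnerProductSpace ℂ E] [CompleteSpace E]
  (H : Hamiltonian E)

/-- The infinitely many eigenvalues are at least the gap apart, so their rescaled floors are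
distinct and cannot all lie in a bounded interval. It makes the sum `Δ_σ(J)` nonempty, hence `δ⋆`
positive. -/
theorem Hamiltonian.exists_lt_diff (hgap : 0 < H.gap) (a : ℝ) : ∃ m n, a < H.diff m n := by
  by_contra! hcon
  have hinj : Function.Injective fun n => ⌊H.h n / H.gap⌋ := fun n m hnm => by
    by_contra hne
    have h1 := gap_le_abs_diff H hne
    have h2 := Int.abs_sub_lt_one_of_floor_eq_floor hnm
    rw [← sub_div, abs_div, abs_of_pos hgap, div_lt_one hgap] at h2
    exact absurd h1 (not_le.2 h2)
  refine Set.infinite_of_injective_forall_mem hinj (fun n => ?_)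
    (Set.finite_Icc ⌊(H.h 0 - a) / H.gap⌋ ⌊(H.h 0 + a) / H.gap⌋)
  have h1 := hcon n 0
  have h2 := hcon 0 n
  unfold Hamiltonian.diff at h1 h2
  exact ⟨Int.floor_mono (by gcongr; linarith), Int.floor_mono (by gcongr; linarith)⟩

theorem Hamiltonian.mult_pos (m : ℕ) : 0 < H.mult m := by
  have : Nontrivial (H.level m) := (Submodule.nontrivial_iff_ne_bot).2 (H.eigenspace_ne_bot m)
  exact Module.finrank_pos

theorem Hamiltonian.gapSum_pos {σ J : ℝ} (hJ : 0 < J) (hgap : 0 < H.gap) :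
    0 < H.gapSum σ J := by
  obtain ⟨m, n, hmn⟩ := H.exists_lt_diff hgap (J / 2)
  have hd : 0 < H.diff m n := (half_pos hJ).trans hmn
  have hm : (0 : ℝ) < H.mult m := by exact_mod_cast H.mult_pos m
  have hn : (0 : ℝ) < H.mult n := by exact_mod_cast H.mult_pos n
  have hmu : 0 < H.mu m n := by
    unfold Hamiltonian.mu
    have := Real.sqrt_pos.2 (lt_min hm hn)
    positivity
  refine ENNReal.mul_pos (by simpa using Real.rpow_pos_of_pos hJ σ) (ne_of_gt ?_)
  refine lt_of_lt_of_le ?_ (ENNReal.le_tsum m)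
  refine lt_of_lt_of_le ?_ (ENNReal.le_tsum n)
  rw [if_pos hmn, ENNReal.ofReal_pos]
  exact div_pos hmu (Real.rpow_pos_of_pos hd σ)

theorem deltaStar_pos {σ r S : ℝ} (hσ : 0 < σ) (hr : σ + 1 / 2 < r) (hS : 0 < S) :
    0 < deltaStar σ r S := by
  have hr0 : 0 < r := by linarith
  have hq := one_sub_exp_pos hr0
  have hs := summable_sq_mul_exp (a := 2 / r * (r - σ - 1 / 2))
    (mul_pos (by positivity) (by linarith))
  have hT := hs.tsum_pos (fun t => by positivity) 0 (by positivity)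
  unfold deltaStar
  positivity

theorem epsStar_pos {gap J : ℝ} (hgap : 0 < gap) (hJ : 0 < J) : 0 < epsStar gap J :=
  div_pos (lt_min (by positivity) hJ) (by positivity)

variable [SecondCountableTopology E]

theorem hasPurePointSpectrum_floquetOp (V : Potential E) {ω : ℝ} (hω : 0 < ω)
    {U D : SeqSpace (fun n => H.level n) →L[ℂ] SeqSpace fun n => H.level n}
    (hU : star U * U = 1) (hD : IsSelfAdjoint D) (hDd : ∀ i j, i ≠ j → block D i j = 0)
    (hc : IsCommutator (modeEnergy H.h ω) U (U * fourierOp H V one_pos - D * U)) :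
    HasPurePointSpectrum (floquetOp H V ω) :=
  hasPurePointSpectrum_vadd (mem_graph_free H hω)
    (fun f => by rw [← fourierOp_eq_one H V hω]; exact fourierIso_mulOp H V hω f)
    (isSelfAdjoint_fourierOp H V) hU hD hDd hc

theorem fourierOp_eq_zero {V : Potential E} {r : ℝ} (h : H.size V r = 0) :
    fourierOp H V one_pos = 0 := by
  have h1 := regularityBound_fourierOp H V (r := r) (by simp [h])
  refine block_ext fun i j => ?_
  have h2 := (ENNReal.le_tsum (f := fun j => ‖block (fourierOp H V one_pos) i j‖ₑ) j).trans
    (h1.tsum_le i)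
  rw [h, ENNReal.toReal_zero, ENNReal.ofReal_zero, nonpos_iff_eq_zero, ← ofReal_norm,
    ENNReal.ofReal_eq_zero] at h2
  rw [block_zero]
  exact norm_le_zero_iff.1 h2

/-- Pure point spectrum away from a set of frequencies of small measure. -/
theorem exists_hasPurePointSpectrum {J σ r : ℝ} (hJ : 0 < J) (hσ : 0 < σ) (hr : σ + 1 / 2 < r)
    (hsum : H.gapSum σ J ≠ ⊤) {V : Potential E} (hV : H.size V r ≠ ⊤)
    (hVs : (H.size V r).toReal < epsStar H.gap J) :
    ∃ Ω ⊆ frequencies J, MeasurableSet Ω ∧ volume (frequencies J \ Ω) ≤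
        ENNReal.ofReal (deltaStar σ r (H.gapSum σ J).toReal * (H.size V r).toReal) ∧
      ∀ ω ∈ Ω, HasPurePointSpectrum (floquetOp H V ω) := by
  have hpos : ∀ ω ∈ frequencies J, 0 < ω := fun ω hω =>
    lt_of_lt_of_le (by positivity) hω.1
  -- The iteration needs `ε > 0` to have positive divisor sizes. If the size is zero, the matrix of
  -- `V` vanishes and `K` is already diagonal.
  rcases eq_or_ne (H.size V r) 0 with h0 | h0
  · refine ⟨frequencies J, subset_rfl, measurableSet_Icc, by simp, fun ω hω => ?_⟩
    obtain ⟨U, D, hU, hD, hDd, hc⟩ :=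
      exists_diagonalization_zero (G := fun i : ℤ × ℕ => H.level i.2) (modeEnergy H.h ω)
    refine hasPurePointSpectrum_floquetOp H V (hpos ω hω) hU hD hDd ?_
    rw [fourierOp_eq_zero H h0]
    exact hc
  · obtain ⟨Ω, hΩ, hΩm, hvol, h⟩ := exists_diagonalization H hJ hσ hr
      (ENNReal.toReal_pos h0 hV) hVs hsum (isSelfAdjoint_fourierOp H V)
      (isToeplitz_fourierOp H V one_pos) (regularityBound_fourierOp H V hV)
    refine ⟨Ω, hΩ, hΩm, hvol, fun ω hω => ?_⟩
    obtain ⟨U, D, hU, -, hD, hDd, hc⟩ := h ω hω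
    exact hasPurePointSpectrum_floquetOp H V (hpos ω (hΩ hω)) hU hD hDd hc

end Main

end Floquet
end

theorem theorem1 {E : Type*} [NormedAddCommGroup E] [InnerProductSpace ℂ E] [CompleteSpace E]
    [SecondCountableTopology E] (H : Floquet.Hamiltonian E)
    (J : ℝ) (hJ : 0 < J) (hgap : 0 < H.gap)
    (σ : ℝ) (hσ : 0 < σ) (hsum : H.gapSum σ J < ⊤) (r : ℝ) (hr : σ + 1 / 2 < r) :
    0 < Floquet.epsStar H.gap J ∧
    0 < Floquet.deltaStar σ r (H.gapSum σ J).toReal ∧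
    ∀ V : Floquet.Potential E,
      H.size V r < ENNReal.ofReal (min (Floquet.epsStar H.gap J)
        (volume.real (Floquet.frequencies J) / Floquet.deltaStar σ r (H.gapSum σ J).toReal)) →
      ∃ Ω ⊆ Floquet.frequencies J, MeasurableSet Ω ∧
        volume.real (Floquet.frequencies J) -
          Floquet.deltaStar σ r (H.gapSum σ J).toReal * (H.size V r).toReal ≤ volume.real Ω ∧
        ∀ ω ∈ Ω, Floquet.HasPurePointSpectrum (Floquet.floquetOp H V ω) := by
  refine ⟨Floquet.epsStar_pos hgap hJ, Floquet.deltaStar_pos hσ hr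
    (ENNReal.toReal_pos (H.gapSum_pos hJ hgap).ne' hsum.ne), fun V hV => ?_⟩
  have hfin : H.size V r ≠ ⊤ := ne_top_of_lt hV
  obtain ⟨Ω, hΩ, hΩm, hvol, h⟩ := Floquet.exists_hasPurePointSpectrum H hJ hσ hr hsum.ne hfin
    ((ENNReal.lt_ofReal_iff_toReal_lt hfin).1 hV |>.trans_le (min_le_left _ _))
  refine ⟨Ω, hΩ, hΩm, ?_, h⟩
  have hδ := Floquet.deltaStar_pos hσ hr
    (ENNReal.toReal_pos (H.gapSum_pos hJ hgap).ne' hsum.ne)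
  have h1 := ENNReal.toReal_le_of_le_ofReal (mul_nonneg hδ.le ENNReal.toReal_nonneg) hvol
  have h2 := measureReal_sdiff (μ := volume) hΩ hΩm
    (h₁ := (isCompact_Icc : IsCompact (Floquet.frequencies J)).measure_lt_top.ne)
  rw [Measure.real] at h2
  linarith
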